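/- Let $0<q<1$, let $m\ge 1$ be an integer, $\mu=1+q^{2-m}$ and $\beta>0$. We use $[u]_q=\frac{q^u-1}{q-1}$, $[n]_q!=[1]_q\cdots[n]_q$, the $q$-Gamma function $\Gamma_q(t)=\frac{(q;q)_\infty}{(q^t;q)_\infty}(1-q)^{1-t}$, where $(u;q)_\infty=\prod_{k\ge0}(1-uq^k)$, the exponentials $e_q(t)=\sum_j\frac{t^j}{[j]_q!}$ and $E_q(t)=\sum_j q^{j(j-1)/2}\frac{t^j}{[j]_q!}$, and the Jackson integrals $$\int_0^a f(r)\,d_qr=(1-q)a\sum_{k\ge0}f(q^ka)q^k,\qquad \int_0^{\gamma\cdot\infty}f(r)\,d_qr=(1-q)\gamma\sum_{k\in\mathbb Z}f(q^k\gamma)q^k .$$ For $\nu>-1$ the first $q$-Bessel function is $$J^{(1)}_\nu(x|q^2)=\Big(\frac{x}{1+q}\Big)^{\nu}\sum_{i\ge0}\frac{(-1)^i}{[i]_{q^2}!\,\Gamma_{q^2}(i+\nu+1)}\Big(\frac{x}{1+q}\Big)^{2i}\qquad\Big(|x|<\tfrac1{1-q}\Big),$$ continued analytically to all $x>0$. *Quantum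 Euclidean space.* For $1\le i\le m$ put $i'=m+1-i$, $\rho_i=\frac m2-i$ if $i<i'$, $\rho_i=0$ if $i=i'$, $\rho_i=-\rho_{i'}$ if $i>i'$. The metric is $C_{ij}=C^{ij}=q^{-\rho_i}\delta_{ij'}$ and the braid matrix of $O_q(m)$ is $$\hat R^{ij}_{kl}=q^{\delta_{ij}-\delta_{ij'}}\delta_{il}\delta_{jk}+(q-q^{-1})\,\theta(k<j)\,\big(\delta_{ik}\delta_{jl}-C^{ij}C_{kl}\big),$$ where $\theta(k<j)$ is $1$ if $k<j$ and $0$ otherwise. It decomposes as $\hat R=q\mathcal P_S-q^{-1}\mathcal P_A+q^{1-m}\mathcal P_1$ with projections of sum $1$, where $(\mathcal P_1)^{ij}_{kl}=C^{ij}C_{kl}/\sum_{a,b}C^{ab}C_{ab}$. Summing over repeated indices, let $\mathcal P$ be the complex algebra generated by $x^1,\dots,x^m$ with relations $(\mathcal P_A)^{ij}_{kl}x^kx^l=0$, $\mathcal P_k$ its homogeneous part of degree $k$, $\mathcal O_q$ the algebra of the formal power series $\sum_kR_k$ with $R_k\in\mathcal P_k$, and $\mathbf x^2=x^iC_{ij}x^j$.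 For $f$ analytic at the origin, or a formal power series, $f(\mathbf x^2)\in\mathcal O_q$ is defined by the Taylor series of $f$. The partial derivatives are the linear operators on $\mathcal P$ with $\partial^i(1)=0$ and $\partial^ix^j=C^{ij}+q(\hat R^{-1})^{ij}_{kl}x^k\partial^l$; $\Delta=\partial^iC_{ij}\partial^j$ and $\mathcal S_k=\mathcal P_k\cap\ker\Delta$. *Integration.* For $R\in\mathcal P$ put $$\int_{\mathbb S^{m-1}_q}R=\sum_{k\ge0}\frac{2\,\Gamma_{q^2}(\frac12)^m}{\mu^{2k}[k]_{q^2}!\,\Gamma_{q^2}(k+\frac m2)}(\Delta^kR)(0),$$ and for $R_k\in\mathcal P_k$ and a power series $f$, $$\int_{\gamma\cdot\mathbb R^m_q}R_k(\mathbf x)f(\mathbf x^2)=\int_0^{\gamma\cdot\infty}d_qr\,r^{m+k-1}f(r^2)\int_{\mathbb S^{m-1}_q}R_k .$$ Equivalently, $\int_{\gamma\cdot\mathbb R^m_q}\sum_nF_n=\int_0^{\gamma\cdot\infty}d_qr\,r^{m-1}\sum_nr^n\int_{\mathbb S^{m-1}_q}F_n$ for $F_n\in\mathcal P_n$. *Fourier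 transform.* Let $\mathbf y$ be a second copy of the coordinates, written to the right of $\mathbf x$. The exponential $\exp_{\hat R}(\mathbf x|\mathbf y)$ is the unique series with $\exp_{\hat R}(0|\mathbf y)=1$ and $\partial_x^j\exp_{\hat R}(\mathbf x|\mathbf y)=\exp_{\hat R}(\mathbf x|\mathbf y)\,y^j$. Let $$\overline{\mathcal V}_\beta=\mathcal P\cdot E_{q^2}\Big(-\beta\frac{\mathbf x^2}\mu\Big),\qquad \mathcal V_\alpha=\mathcal P\cdot e_{q^2}\Big(-\alpha\frac{q^2\mathbf x^2}\mu\Big),\qquad \overline{\mathcal V}_{[\beta]}=\bigcup_{j\ge0}\overline{\mathcal V}_{q^{2j}\beta},\qquad \mathcal V_{[\alpha]}=\bigcup_{j\ge0}\mathcal V_{q^{-2j}\alpha}$$ as subspaces of $\mathcal O_q$. The first Fourier transform of $f\in\overline{\mathcal V}_{[\beta]}$ is the series in $\mathbf y$ $$\overline{\mathcal F}^{\pm}[f](\mathbf y)=\frac{1+q}{2\mu^{m/2}\,\Gamma_{q^2}(\frac12)^m}\int_{\gamma\cdot\mathbb R^m_q}f(\mathbf x)\exp_{\hat R}(\pm i\mathbf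 x|\mathbf y),\qquad \gamma=\sqrt{\frac{\mu}{(1-q^2)\beta}},$$ where the integral over $\mathbf x$ is taken in each degree in $\mathbf y$. The first $q$-Hankel transform is $$\overline{\mathcal H}^{q,\beta}_\nu[f](t)=\frac{1+q}\mu\int_0^{\sqrt{\frac{\mu}{(1-q^2)\beta}}}d_qr\,\frac{J^{(1)}_\nu\big(\frac{1+q}\mu rt\,|\,q^2\big)}{(rt)^\nu}\,r^{2\nu+1}f(r),$$ and $\overline{\mathcal F}^{q,\beta}_\nu[\psi](t^2)=\overline{\mathcal H}^{q,\beta}_\nu[r\mapsto\psi(r^2)](t)$. **Bochner's relations.** Let $S_k\in\mathcal S_k$ and let $\psi$ be a power series with $S_k(\mathbf x)\psi(\mathbf x^2)\in\mathcal P\cdot E_{q^2}(-\beta\mathbf x^2/\mu)\subset\overline{\mathcal V}_{[\beta]}$. Then $\overline{\mathcal F}^\pm[S_k(\mathbf x)\psi(\mathbf x^2)]\in\mathcal V_{[1/\beta]}$; if $S_k\ne0$, the function $\overline{\mathcal F}^{q,\beta}_{\frac m2+k-1}[\psi]$ is analytic at the origin; and $$\overline{\mathcal F}^\pm\big[S_k(\mathbf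 x)\psi(\mathbf x^2)\big](\mathbf y)=(\pm i)^kS_k(\mathbf y)\,\overline{\mathcal F}^{q,\beta}_{\frac m2+k-1}[\psi](\mathbf y^2)$$ $$=(\pm i)^k\,\frac{1+q}\mu\left[\int_0^{\sqrt{\frac{\mu}{(1-q^2)\beta}}}d_qr\;r^{m+2k-1}\psi(r^2)\,\frac{J^{(1)}_{\frac m2+k-1}\big(\frac{1+q}\mu rt\,|\,q^2\big)}{(rt)^{\frac m2+k-1}}\right]_{t^2=\mathbf y^2}S_k(\mathbf y),$$ with $r$ and $t$ real commuting variables. -/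

import Mathlib

open scoped TensorProduct PowerSeries Topology BigOperators

noncomputable section

namespace QEuclid

/-! ### q-calculus -/

/-- The `q`-number `[u]_q = (q^u - 1) / (q - 1)`. -/
def qNum (q u : ℝ) : ℝ := (q ^ u - 1) / (q - 1)

/-- The `q`-factorial `[n]_q! = [1]_q [2]_q ⋯ [n]_q`. -/
def qFactorial (q : ℝ) (n : ℕ) : ℝ := ∏ i ∈ Finset.range n, qNum q ((i : ℝ) + 1)

/-- The infinite `q`-shifted factorial `(u; q)_∞ = ∏_{k ≥ 0} (1 - u q^k)`. -/
def qPochInf (u q : ℝ) : ℝ := ∏' k : ℕ, (1 - u * q ^ k)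

/-- The `q`-Gamma function `Γ_q(t) = (q; q)_∞ / (q^t; q)_∞ (1 - q)^(1 - t)`. -/
def qGamma (q t : ℝ) : ℝ := qPochInf q q / qPochInf (q ^ t) q * (1 - q) ^ (1 - t)

/-- The Taylor series of `e_q(t) = ∑ t^j / [j]_q!`. -/
def qexpSeries (q : ℝ) : ℂ⟦X⟧ := PowerSeries.mk fun j => (((qFactorial q j)⁻¹ : ℝ) : ℂ)

/-- The Taylor series of `E_q(t) = ∑ q^(j(j-1)/2) t^j / [j]_q!`. -/
def qExpSeries (q : ℝ) : ℂ⟦X⟧ :=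
  PowerSeries.mk fun j => ((q ^ (j.choose 2) / qFactorial q j : ℝ) : ℂ)

/-- The entire function `E_q(t) = ∑ q^(j(j-1)/2) t^j / [j]_q!`, for real `t`. -/
def qExp (q t : ℝ) : ℝ := ∑' j : ℕ, q ^ (j.choose 2) * t ^ j / qFactorial q j

/-- The Jackson integral `∫_0^a f(t) d_q t`. -/
def jackson (q a : ℝ) (f : ℝ → ℂ) : ℂ :=
  ((1 - q) * a : ℝ) * ∑' k : ℕ, f (q ^ k * a) * (q : ℂ) ^ k

/-- The infinite Jackson integral `∫_0^{γ·∞} f(t) d_q t`. -/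
def jacksonInfty (q γ : ℝ) (f : ℝ → ℂ) : ℂ :=
  ((1 - q) * γ : ℝ) * ∑' k : ℤ, f (q ^ k * γ) * (q : ℂ) ^ k

/-- The second `q`-Bessel function `J_ν^{(2)}(x | q²)`. -/
def qBessel2 (q ν x : ℝ) : ℝ :=
  q ^ (ν ^ 2) * (x / (1 + q)) ^ ν *
    ∑' i : ℕ, q ^ (2 * (i : ℝ) * ((i : ℝ) + ν)) * (-1) ^ i /
      (qFactorial (q ^ 2) i * qGamma (q ^ 2) ((i : ℝ) + ν + 1)) * (x / (1 + q)) ^ (2 * i)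

/-- The first `q`-Bessel function `J_ν^{(1)}(x | q²)`: its power series for `|x| < 1/(1-q)`, and the
analytic continuation `q^(-ν²) e_{q²}(-(1-q)/(1+q) x²) J_ν^{(2)}(x | q²)` beyond, where `e_{q²}` is
itself continued by `e_{q²}(-t) = 1 / E_{q²}(t)`. -/
def qBessel1 (q ν x : ℝ) : ℝ :=
  if |x| < 1 / (1 - q) then
    (x / (1 + q)) ^ ν *
      ∑' i : ℕ, (-1) ^ i / (qFactorial (q ^ 2) i * qGamma (q ^ 2) ((i : ℝ) + ν + 1)) *
        (x / (1 + q)) ^ (2 * i)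
  else
    1 / q ^ (ν ^ 2) * (1 / qExp (q ^ 2) ((1 - q) / (1 + q) * x ^ 2)) * qBessel2 q ν x

/-! ### The braid matrix of `O_q(m)` and the metric

The indices `1, …, m` are `Fin m`, and `i' = m + 1 - i` is `Fin.rev i`. -/

/-- `μ = 1 + q^(2 - m)`. -/
def mu (m : ℕ) (q : ℝ) : ℝ := 1 + q ^ (2 - (m : ℤ))

/-- `ρ = (m/2 - 1, m/2 - 2, …, 1 - m/2)`, antisymmetric under `i ↦ i'`: for the 1-based index `i`,
`ρ_i = m/2 - i` if `i < i'`, `ρ_i = 0` if `i = i'` and `ρ_i = -ρ_{i'}` if `i > i'`. -/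
def rho (m : ℕ) (i : Fin m) : ℝ :=
  if i < i.rev then (m : ℝ) / 2 - ((i : ℕ) + 1)
  else if i = i.rev then 0
  else -((m : ℝ) / 2 - ((i.rev : ℕ) + 1))

/-- The metric `C_{ij} = C^{ij} = q^(-ρ_i) δ_{i j'}`. -/
def metric (m : ℕ) (q : ℝ) (i j : Fin m) : ℝ := if i = j.rev then q ^ (-rho m i) else 0

/-- The braid matrix `R̂^{ij}_{kl}` of `O_q(m)`; rows are indexed by `(i, j)`, columns by `(k, l)`. -/
def Rhat (m : ℕ) (q : ℝ) : Matrix (Fin m × Fin m) (Fin m × Fin m) ℝ := fun a b =>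
  (if a.1 = b.2 ∧ a.2 = b.1 then
      q ^ ((if a.1 = a.2 then 1 else 0) - (if a.1 = a.2.rev then 1 else 0) : ℤ) else 0) +
    (q - q⁻¹) * (if b.1 < a.2 then
      (if a = b then 1 else 0) - metric m q a.1 a.2 * metric m q b.1 b.2 else 0)

/-- The singlet projection `(P_1)^{ij}_{kl} = C^{ij} C_{kl} / C` with `C = C^{ij} C_{ij}`. -/
def projSinglet (m : ℕ) (q : ℝ) : Matrix (Fin m × Fin m) (Fin m × Fin m) ℝ := fun a b =>
  metric m q a.1 a.2 * metric m q b.1 b.2 / ∑ i, ∑ j, metric m q i j * metric m q i j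

/-- The antisymmetric projection: `R̂ = q P_S - q⁻¹ P_A + q^(1-m) P_1` and `P_S + P_A + P_1 = 1`,
solved for `P_A`. -/
def projAntisym (m : ℕ) (q : ℝ) : Matrix (Fin m × Fin m) (Fin m × Fin m) ℝ :=
  (q + q⁻¹)⁻¹ • (q • (1 : Matrix (Fin m × Fin m) (Fin m × Fin m) ℝ) - Rhat m q
    - (q - q ^ (1 - (m : ℤ))) • projSinglet m q)

/-! ### The algebra of polynomials -/

/-- The relations `(P_A)^{ij}_{kl} x^k x^l = 0`. -/
inductive Rel (m : ℕ) (q : ℝ) : FreeAlgebra ℂ (Fin m) → FreeAlgebra ℂ (Fin m) → Prop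
  | comm (i j : Fin m) : Rel m q
      (∑ k, ∑ l, ((projAntisym m q (i, j) (k, l) : ℝ) : ℂ) •
        (FreeAlgebra.ι ℂ k * FreeAlgebra.ι ℂ l)) 0

/-- The algebra `𝒫` of polynomials on the quantum Euclidean space `ℝ^m_q`. -/
abbrev Poly (m : ℕ) (q : ℝ) : Type := RingQuot (Rel m q)

/-- The coordinates `x^i`. -/
def coord (m : ℕ) (q : ℝ) (i : Fin m) : Poly m q :=
  RingQuot.mkAlgHom ℂ (Rel m q) (FreeAlgebra.ι ℂ i)

/-- The norm squared `𝐱² = x^i C_{ij} x^j`. -/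
def normSq (m : ℕ) (q : ℝ) : Poly m q :=
  ∑ i, ∑ j, (metric m q i j : ℂ) • (coord m q i * coord m q j)

/-- The space `𝒫_k` of homogeneous polynomials of degree `k`, spanned by the products of `k`
coordinates. -/
def homog (m : ℕ) (q : ℝ) (k : ℕ) : Submodule ℂ (Poly m q) :=
  (Submodule.span ℂ (Set.range (coord m q))) ^ k

/-- Evaluation at the origin, `R ↦ R(0)`. -/
def evalZero (m : ℕ) (q : ℝ) : Poly m q →ₐ[ℂ] ℂ :=
  RingQuot.liftAlgHom ℂ ⟨FreeAlgebra.lift ℂ (fun _ : Fin m => (0 : ℂ)), by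
    rintro _ _ ⟨i, j⟩
    simp only [map_sum, map_smul, map_mul, FreeAlgebra.lift_ι_apply, mul_zero, smul_zero,
      Finset.sum_const_zero, map_zero]⟩

/-! ### Differential calculus -/

/-- The rules for the action of the partial derivatives on `𝒫`: `∂^i(1) = 0` and
`∂^i x^j = C^{ij} + q (R̂⁻¹)^{ij}_{kl} x^k ∂^l`. At most one family of linear maps obeys them, since
the coordinates generate `𝒫`. -/
def IsPartial (m : ℕ) (q : ℝ) (D : Fin m → Poly m q →ₗ[ℂ] Poly m q) : Prop :=
  (∀ i, D i 1 = 0) ∧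
  ∀ i j p, D i (coord m q j * p) = (metric m q i j : ℂ) • p +
    ∑ k, ∑ l, ((q * (Rhat m q)⁻¹ (i, j) (k, l) : ℝ) : ℂ) • (coord m q k * D l p)

/-- The partial derivatives `∂^i`: the family of operators on `𝒫` determined by `IsPartial`. -/
def partialD (m : ℕ) (q : ℝ) : Fin m → Poly m q →ₗ[ℂ] Poly m q :=
  Classical.epsilon (IsPartial m q)

/-- The Laplace operator `Δ = ∂^i C_{ij} ∂^j`. -/
def laplace (m : ℕ) (q : ℝ) : Poly m q →ₗ[ℂ] Poly m q :=
  ∑ i, ∑ j, (metric m q i j : ℂ) • (partialD m q i ∘ₗ partialD m q j)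

/-- The spherical harmonics `𝒮_k = 𝒫_k ∩ ker Δ`. -/
def sphHarm (m : ℕ) (q : ℝ) (k : ℕ) : Submodule ℂ (Poly m q) :=
  homog m q k ⊓ LinearMap.ker (laplace m q)

/-! ### Formal power series

A formal power series on `ℝ^m_q` is the sum of its homogeneous components. It is encoded as the
power series over `𝒫` whose `n`-th coefficient is the component of degree `n`; the product of
`𝒫⟦X⟧` is then the product of formal power series. -/

/-- The algebra `𝒪_q` of formal power series on `ℝ^m_q`, inside `𝒫⟦X⟧`. -/
def formalSeries (m : ℕ) (q : ℝ) : Set (Poly m q)⟦X⟧ :=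
  {F | ∀ n, PowerSeries.coeff n F ∈ homog m q n}

/-- The polynomials as elements of `𝒪_q`: the finite sums of homogeneous components. -/
def polySeries (m : ℕ) (q : ℝ) : Set (Poly m q)⟦X⟧ :=
  {F | F ∈ formalSeries m q ∧ ∃ N, ∀ n, N < n → PowerSeries.coeff n F = 0}

/-- The element `φ(𝐱²) = ∑ φ_n 𝐱^{2n}` of `𝒪_q`, for a power series `φ`. -/
def radial (m : ℕ) (q : ℝ) (φ : ℂ⟦X⟧) : (Poly m q)⟦X⟧ :=
  PowerSeries.mk fun n => if Even n then PowerSeries.coeff (n / 2) φ • normSq m q ^ (n / 2) else 0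

/-- `φ` is the Taylor series at the origin of the function `G` of `u = t²`, which is looked at for
`u > 0` only, since `t` is a real variable. -/
def IsTaylor (G : ℝ → ℂ) (φ : ℂ⟦X⟧) : Prop :=
  ∀ᶠ u : ℝ in 𝓝[>] 0, HasSum (fun n : ℕ => PowerSeries.coeff n φ * (u : ℂ) ^ n) (G u)

/-- The element `G(𝐱²)` of `𝒪_q`, defined by the (unique) Taylor series of `G` at the origin. -/
def radialFun (m : ℕ) (q : ℝ) (G : ℝ → ℂ) : (Poly m q)⟦X⟧ :=
  radial m q (Classical.epsilon (IsTaylor G))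

/-- The value `φ(u)` of a power series. -/
def evalSeries (φ : ℂ⟦X⟧) (u : ℝ) : ℂ := ∑' n : ℕ, PowerSeries.coeff n φ * (u : ℂ) ^ n

/-- The space `V̄_β = 𝒫 ⊗ E_{q²}(-β 𝐱²/μ)`. -/
def Vbar (m : ℕ) (q β : ℝ) : Set (Poly m q)⟦X⟧ :=
  {F | ∃ P ∈ polySeries m q,
    F = P * radial m q (PowerSeries.rescale ((-(β / mu m q) : ℝ) : ℂ) (qExpSeries (q ^ 2)))}

/-- The space `V_α = 𝒫 ⊗ e_{q²}(-α q² 𝐱²/μ)`. -/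
def V (m : ℕ) (q α : ℝ) : Set (Poly m q)⟦X⟧ :=
  {F | ∃ P ∈ polySeries m q,
    F = P * radial m q (PowerSeries.rescale ((-(α * q ^ 2 / mu m q) : ℝ) : ℂ) (qexpSeries (q ^ 2)))}

/-- The space `V_[α] = ⋃_j V_{q^(-2j) α}`. -/
def VClass (m : ℕ) (q α : ℝ) : Set (Poly m q)⟦X⟧ := ⋃ j : ℕ, V m q (q ^ (-2 * (j : ℤ)) * α)

/-! ### Integration -/

/-- Integration over the quantum sphere, by the Pizzetti formula. -/
def sphereInt (m : ℕ) (q : ℝ) (R : Poly m q) : ℂ :=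
  ∑ᶠ k : ℕ, ((2 * qGamma (q ^ 2) (1 / 2) ^ m /
    (mu m q ^ (2 * k) * qFactorial (q ^ 2) k * qGamma (q ^ 2) ((k : ℝ) + (m : ℝ) / 2)) : ℝ) : ℂ) *
      evalZero m q ((laplace m q ^ k) R)

/-- The integral of a series `F = ∑ F_n` over `γ·ℝ^m_q`: the function `r ↦ ∑ r^n ∫_{S} F_n`
integrated against `r^(m-1) d_q r` over `(0, γ·∞)`. If `F = R_k(𝐱) f(𝐱²)` with `R_k ∈ 𝒫_k`, then
`F_{k+2n} = f_n R_k 𝐱^{2n}`, and as `∫_S 𝐱² R = ∫_S R`, this is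
`∫_0^{γ·∞} d_q r r^(m+k-1) f(r²) ∫_S R_k`. -/
def spaceInt (m : ℕ) (q γ : ℝ) (F : (Poly m q)⟦X⟧) : ℂ :=
  jacksonInfty q γ fun r =>
    (r : ℂ) ^ (m - 1) * ∑' n : ℕ, (r : ℂ) ^ n * sphereInt m q (PowerSeries.coeff n F)

/-! ### The Fourier kernel and the first Fourier transform

The kernel is a series in the two sets of coordinates `x` and `y`, which is written with the `x` on
the left and the `y` on the right, as an element of `𝒫 ⊗ 𝒫` in each degree. The `x` only ever act
from the left and the `y` from the right, so that no `y` has to be moved past an `x`. -/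

/-- `e` is the family of the components, by degree in `x`, of the exponential `exp(x|y)`:
`exp(0|y) = 1` and `∂_x^j exp(x|y) = exp(x|y) y^j`. -/
def IsKernel (m : ℕ) (q : ℝ) (e : ℕ → Poly m q ⊗[ℂ] Poly m q) : Prop :=
  e 0 = 1 ⊗ₜ[ℂ] 1 ∧
  (∀ l, e l ∈ LinearMap.range ((homog m q l).subtype.rTensor (Poly m q))) ∧
  ∀ l j, (partialD m q j).rTensor (Poly m q) (e (l + 1)) =
    (LinearMap.mulRight ℂ (coord m q j)).lTensor (Poly m q) (e l)

/-- The exponential `exp(x|y)`, determined by `IsKernel`: its component of degree `l` in `x`. -/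
def kernel (m : ℕ) (q : ℝ) : ℕ → Poly m q ⊗[ℂ] Poly m q := Classical.epsilon (IsKernel m q)

/-- The `x`-polynomial which is the coefficient in `exp(x|y)`, in degree `l`, of a member `b_a` of a
basis of the polynomials in `y`. -/
def kernelCoeff (m : ℕ) (q : ℝ) (l : ℕ) (a : Module.Basis.ofVectorSpaceIndex ℂ (Poly m q)) :
    Poly m q :=
  TensorProduct.rid ℂ (Poly m q)
    (((Module.Basis.ofVectorSpace ℂ (Poly m q)).coord a).lTensor (Poly m q) (kernel m q l))

/-- The first Fourier transform on `V̄_[β]`,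
`(1+q) / (2 μ^(m/2) Γ_{q²}(1/2)^m) ∫_{γ·ℝ^m_q} f(x) exp(± i x|y)` with `γ = √(μ / ((1-q²) β))`.
The sign is `s`. The integral over `x` is taken in each degree `l` and for each coefficient with
respect to a basis of the polynomials in `y`. -/
def fourier1 (m : ℕ) (q β : ℝ) (s : ℤˣ) (F : (Poly m q)⟦X⟧) : (Poly m q)⟦X⟧ :=
  PowerSeries.mk fun l =>
    (((1 + q) / (2 * mu m q ^ ((m : ℝ) / 2) * qGamma (q ^ 2) (1 / 2) ^ m) : ℝ) *
        (((s : ℤ) : ℂ) * Complex.I) ^ l) •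
      ∑ᶠ a, spaceInt m q (√(mu m q / ((1 - q ^ 2) * β)))
        (F * PowerSeries.monomial l (kernelCoeff m q l a)) •
          Module.Basis.ofVectorSpace ℂ (Poly m q) a

/-! ### The first q-Hankel transform -/

/-- The first `q`-Hankel transform `H̄_ν^{q,β}[f(r)](t)`, for `t > 0`. -/
def hankel1 (m : ℕ) (q β ν : ℝ) (f : ℝ → ℂ) (t : ℝ) : ℂ :=
  ((1 + q) / mu m q : ℝ) * jackson q (√(mu m q / ((1 - q ^ 2) * β))) fun r =>
    ((qBessel1 q ν ((1 + q) / mu m q * r * t) / (r * t) ^ ν * r ^ (2 * ν + 1) : ℝ) : ℂ) * f r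

/-- The transform `F̄_ν^{q,β}[ψ](t²) = H̄_ν^{q,β}[ψ ∘ Υ](t)` with `Υ(u) = u²`, as a function of
`u = t² > 0`. -/
def hankelF1 (m : ℕ) (q β ν : ℝ) (ψ : ℝ → ℂ) (u : ℝ) : ℂ :=
  hankel1 m q β ν (fun r => ψ (r ^ 2)) (√u)

end QEuclid

end

/-! Expand the kernel by degree in x and integrate degree by degree. Multiplication by 𝐱² does not
change the integral over the quantum sphere (`sphereInt_normSq_mul`), so against a kernel component
K of degree l the integral of S_k(𝐱) ψ(𝐱²) K splits into a one-dimensional moment of ψ and the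
spherical integral of S_k K (`spaceInt_monomial_mul_radial_mul_monomial`). By the Pizzetti formula
the latter is a multiple of (Δⁿ(S_k K))(0). For these functionals multiplication by a coordinate is
adjoint to differentiation, and for harmonic S_k the factors can be moved over one after the other.
Hence the value is a multiple of (Δⁱ S_k(∂) K)(0) if l = k + 2i, and zero for every other l
(`sphereInt_sphHarm_mul`, `sphereInt_sphHarm_mul_eq_zero`). Since Q(∂) exp(x|y) = exp(x|y) Q(y), at
x = 0 there remains 𝐲²ⁱ S_k(𝐲). This gives `fourier1_eq`: the transform is (±i)ᵏ S_k(𝐲) times a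
series in 𝐲² whose coefficients are explicit constants times moments of ψ.

The constants are the Taylor coefficients of J⁽¹⁾. For S_k ≠ 0, ψ is a polynomial times E_{q²}
(`exists_polynomial_mul`), and γ places the integration grid on the zeros of E_{q²}, so the integral
over (0, γ·∞) stops at γ. For small t the double series over moments and degrees converges
absolutely; exchanging the sums produces the Hankel transform (`hasSum_bochnerSeries`), and Taylor
series are unique (`IsTaylor.unique`). Membership in the target space comes from the functional
equation of E_{q²}: it makes the moments satisfy a first-order recursion (`gridGen_mul`), which
e_{q²} solves up to a polynomial factor (`gridGen_mem_expClass`).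

The derivatives and the kernel are picked by `Classical.epsilon`, so they mean something only once
existence is shown. For the derivatives this rests on the skein relation (`braid_braid`), on the
compatibility of R̂ with the metric and on the Yang–Baxter equation (`braid_yang_baxter`); the skein
relation and the Yang–Baxter equation are proved by induction from m to m + 2, with O_q(m) as the
inner block of O_q(m + 2). The kernel is built from the recursion that the Euler operator forces on
it (`kernelSeq`). -/

noncomputable section

namespace QEuclid

/-! ### The weights of the metric -/

/-- The nonzero entry `q^(-ρ_i)` of the metric in row `i`. -/
def weight (m : ℕ) (q : ℝ) (i : Fin m) : ℝ := q ^ (-rho m i)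

theorem metric_eq (m : ℕ) (q : ℝ) (i j : Fin m) :
    metric m q i j = if i = j.rev then weight m q i else 0 := rfl

theorem rho_rev (m : ℕ) (i : Fin m) : rho m i.rev = -rho m i := by
  unfold rho
  rcases lt_trichotomy i i.rev with h | h | h
  · have h1 : ¬ i.rev < i := h.le.not_gt
    have h2 : ¬ i.rev = i := h.ne'
    simp [h, h1, h2]
  · simp [← h]
  · have h1 : ¬ i < i.rev := h.le.not_gt
    have h2 : ¬ i = i.rev := h.ne'
    simp [h, h1, h2]

theorem weight_pos {m : ℕ} {q : ℝ} (hq : 0 < q) (i : Fin m) : 0 < weight m q i :=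
  Real.rpow_pos_of_pos hq _

theorem weight_mul_weight_rev {m : ℕ} {q : ℝ} (hq : 0 < q) (i : Fin m) :
    weight m q i * weight m q i.rev = 1 := by
  rw [weight, weight, ← Real.rpow_add hq, rho_rev]
  simp

theorem sum_metric_mul {m : ℕ} {q : ℝ} (k : Fin m) (X : Fin m → ℝ) :
    ∑ b, metric m q k b * X b = weight m q k * X k.rev := by
  rw [Finset.sum_eq_single k.rev]
  · simp [metric_eq]
  · intro b _ hb
    have : ¬ k = b.rev := fun h => hb (by rw [h, Fin.rev_rev])
    simp [metric_eq, this]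
  · simp

/-! ### The braid matrix acting on row vectors -/

/-- The action of the braid matrix on row vectors. -/
def braid (m : ℕ) (q : ℝ) (τ : Fin m → Fin m → ℝ) (d e : Fin m) : ℝ :=
  ∑ a, ∑ b, τ a b * Rhat m q (a, b) (d, e)

/-- The contraction of a row vector with the metric. -/
def trace2 (m : ℕ) (q : ℝ) (τ : Fin m → Fin m → ℝ) : ℝ := ∑ j : Fin m, weight m q j.rev * τ j.rev j

/-- The permutation part and the identity part of R̂ have one entry per column, so only the metric
part leaves a sum, a trace truncated to the indices above `d`. The explicit computations with R̂
below start from this formula. -/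
theorem braid_apply {m : ℕ} {q : ℝ} (τ : Fin m → Fin m → ℝ) (d e : Fin m) :
    braid m q τ d e =
      q ^ ((if d = e then 1 else 0) - (if d = e.rev then 1 else 0) : ℤ) * τ e d
      + (q - q⁻¹) * (if d < e then τ d e else 0)
      - (q - q⁻¹) * (if d = e.rev then
          weight m q d * ∑ j, (if d < j then weight m q j.rev * τ j.rev j else 0) else 0) := by
  have h1 : ∀ a b, τ a b * Rhat m q (a, b) (d, e) =
      (if a = e then if b = d then
        q ^ ((if d = e then 1 else 0) - (if d = e.rev then 1 else 0) : ℤ) * τ e d else 0 else 0)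
      + (if a = d then if b = e then (q - q⁻¹) * (if d < e then τ d e else 0) else 0 else 0)
      - (q - q⁻¹) * (if a = b.rev then if d = e.rev then
          weight m q d * (if d < b then weight m q b.rev * τ b.rev b else 0) else 0 else 0) := by
    intro a b
    simp only [Rhat, metric_eq, Prod.mk.injEq]
    have e1 : (if a = e ∧ b = d then
        q ^ ((if a = b then 1 else 0) - (if a = b.rev then 1 else 0) : ℤ) else 0) * τ a b =
        (if a = e then if b = d then
        q ^ ((if d = e then 1 else 0) - (if d = e.rev then 1 else 0) : ℤ) * τ e d else 0 else 0) := by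
      by_cases h1 : a = e
      · by_cases h2 : b = d
        · subst h1 h2
          have : (a = b.rev) = (b = a.rev) := by
            apply propext; constructor <;> (rintro h; rw [h, Fin.rev_rev])
          simp [eq_comm, this]
        · simp [h1, h2]
      · simp [h1]
    rw [mul_add, mul_comm (τ a b) (ite _ _ _), e1, add_sub_assoc]
    congr 1
    have e2 : τ a b * ((q - q⁻¹) * if d < b then (if a = d ∧ b = e then 1 else 0) else 0) =
        (if a = d then if b = e then (q - q⁻¹) * (if d < e then τ d e else 0) else 0 else 0) := by
      by_cases h1 : a = d
      · by_cases h2 : b = e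
        · rw [h1, h2]; simp only [and_self, if_true]; split_ifs <;> ring
        · simp [h2]
      · simp [h1]
    have e3 : τ a b * ((q - q⁻¹) * if d < b then (if a = b.rev then weight m q a else 0) *
        (if d = e.rev then weight m q d else 0) else 0) =
        (q - q⁻¹) * (if a = b.rev then if d = e.rev then
          weight m q d * (if d < b then weight m q b.rev * τ b.rev b else 0) else 0 else 0) := by
      by_cases h3 : a = b.rev
      · rw [h3]; simp only [if_true]; split_ifs <;> ring
      · simp [h3]
    rw [← e2, ← e3]
    split_ifs <;> ring
  simp only [braid, h1, Finset.sum_add_distrib, Finset.sum_sub_distrib]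
  congr 1
  · congr 1
    · simp
    · simp
  · rw [Finset.sum_comm]
    simp only [← Finset.mul_sum]
    congr 1
    by_cases h4 : d = e.rev
    · simp [h4, Finset.mul_sum]
    · simp [h4]

/-! ### The inner indices of `Fin (m + 2)` -/

/-- The inclusion of the index set of `O_q(m)` into that of `O_q(m + 2)`. -/
def inner {m : ℕ} (v : Fin m) : Fin (m + 2) := v.castSucc.succ

theorem inner_val {m : ℕ} (v : Fin m) : (inner v : ℕ) = v + 1 := by simp [inner]

theorem rev_inner {m : ℕ} (v : Fin m) : (inner v).rev = inner v.rev := by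
  rw [inner, inner, Fin.rev_succ, Fin.rev_castSucc, Fin.castSucc_succ]

theorem inner_inj {m : ℕ} {v u : Fin m} : inner v = inner u ↔ v = u := by
  simp [inner]

theorem inner_lt {m : ℕ} {v u : Fin m} : inner v < inner u ↔ v < u := by
  simp [inner]

theorem zero_lt_inner {m : ℕ} (v : Fin m) : 0 < inner v := by simp [inner]

theorem inner_lt_last {m : ℕ} (v : Fin m) : inner v < Fin.last (m + 1) := by
  rw [Fin.lt_def, inner_val]; simp

theorem inner_ne_zero {m : ℕ} (v : Fin m) : inner v ≠ 0 := (zero_lt_inner v).ne'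
theorem inner_ne_last {m : ℕ} (v : Fin m) : inner v ≠ Fin.last (m + 1) := (inner_lt_last v).ne

theorem sum_fin_add_two {M : Type*} [AddCommMonoid M] {m : ℕ} (f : Fin (m + 2) → M) :
    ∑ i, f i = f 0 + (∑ v, f (inner v) + f (Fin.last (m + 1))) := by
  rw [Fin.sum_univ_succ, Fin.sum_univ_castSucc]; rfl

theorem fin_add_two_cases {m : ℕ} {P : Fin (m + 2) → Prop} (h0 : P 0) (hi : ∀ v, P (inner v))
    (hl : P (Fin.last (m + 1))) (i : Fin (m + 2)) : P i := by
  refine Fin.cases h0 (fun j => ?_) i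
  refine Fin.lastCases ?_ (fun v => hi v) j
  simpa using hl

/-- Both m/2 and the position of the index grow by one. Thus the metric of O_q(m) is a block of that
of O_q(m + 2), which the inductions in steps of two exploit. -/
theorem rho_inner {m : ℕ} (v : Fin m) : rho (m + 2) (inner v) = rho m v := by
  unfold rho
  simp only [rev_inner, inner_lt, inner_inj, inner_val]
  push_cast
  split_ifs <;> ring

theorem weight_inner {m : ℕ} (q : ℝ) (v : Fin m) : weight (m + 2) q (inner v) = weight m q v := by
  rw [weight, rho_inner, weight]

theorem weight_zero {m : ℕ} (q : ℝ) : weight (m + 2) q 0 = q ^ (-((m : ℝ) / 2)) := by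
  rw [weight, rho, Fin.rev_zero, if_pos (Fin.last_pos)]
  push_cast
  congr 1
  simp; ring

/-! ### The braid matrix of O_q(m + 2) in blocks -/

section step
variable {m : ℕ} {q : ℝ} (τ : Fin (m + 2) → Fin (m + 2) → ℝ)

theorem zero_ne_last' : (0 : Fin (m + 2)) ≠ Fin.last (m + 1) := Fin.last_pos.ne

theorem braid_zero_zero : braid (m + 2) q τ 0 0 = q * τ 0 0 := by
  rw [braid_apply]; simp [zero_ne_last']

theorem braid_last_last : braid (m + 2) q τ (Fin.last _) (Fin.last _) =
    q * τ (Fin.last _) (Fin.last _) := by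
  rw [braid_apply]; simp

theorem braid_zero_inner (v : Fin m) :
    braid (m + 2) q τ 0 (inner v) = τ (inner v) 0 + (q - q⁻¹) * τ 0 (inner v) := by
  rw [braid_apply, rev_inner]
  simp [(inner_ne_zero _).symm, zero_lt_inner]

theorem braid_inner_zero (v : Fin m) :
    braid (m + 2) q τ (inner v) 0 = τ 0 (inner v) := by
  rw [braid_apply]
  simp [inner_ne_zero, inner_ne_last]

theorem braid_inner_last (v : Fin m) :
    braid (m + 2) q τ (inner v) (Fin.last _) =
      τ (Fin.last _) (inner v) + (q - q⁻¹) * τ (inner v) (Fin.last _) := by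
  rw [braid_apply]
  simp [inner_ne_zero, inner_ne_last, inner_lt_last]

theorem braid_last_inner (v : Fin m) :
    braid (m + 2) q τ (Fin.last _) (inner v) = τ (inner v) (Fin.last _) := by
  rw [braid_apply, rev_inner]
  simp [(inner_ne_last _).symm, (inner_lt_last v).le]

theorem braid_last_zero :
    braid (m + 2) q τ (Fin.last _) 0 = q⁻¹ * τ 0 (Fin.last _) := by
  rw [braid_apply]
  simp [zero_ne_last'.symm, (Fin.le_last _).not_gt]

/-- The trace over the indices above the first one is the full trace of the inner block plus the
term of the last index; the latter joins the identity part in the factor `1 - weight ^ 2`. -/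
theorem braid_zero_last :
    braid (m + 2) q τ 0 (Fin.last _) = q⁻¹ * τ (Fin.last _) 0
      + (q - q⁻¹) * (1 - weight (m + 2) q 0 * weight (m + 2) q 0) * τ 0 (Fin.last _)
      - (q - q⁻¹) * weight (m + 2) q 0 * trace2 m q (fun a b => τ (inner a) (inner b)) := by
  rw [braid_apply]
  simp only [zero_ne_last', Fin.rev_last, if_true, Fin.last_pos, if_false, sum_fin_add_two, trace2,
    zero_lt_inner, rev_inner, weight_inner, Fin.rev_zero, lt_irrefl]
  norm_num
  ring

/-- The truncated trace keeps the last index and drops the first one, so the inner block sees the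
outer indices only through `τ 0 (Fin.last _)`. -/
theorem braid_inner_inner (v u : Fin m) :
    braid (m + 2) q τ (inner v) (inner u) = braid m q (fun a b => τ (inner a) (inner b)) v u
      - (q - q⁻¹) * weight (m + 2) q 0 * metric m q v u * τ 0 (Fin.last _) := by
  rw [braid_apply, braid_apply]
  simp only [rev_inner, inner_inj, inner_lt, sum_fin_add_two, weight_inner, inner_lt_last, Fin.rev_last,
    if_true, (zero_lt_inner v).not_gt, if_false, metric_eq]
  split_ifs <;> ring
end step
end QEuclid

namespace QEuclid

/-! ### The eigenvalue of the singlet and the quadratic relation -/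

/-- The number `C^{ij} C_{ij}`. -/
def metricSq (m : ℕ) (q : ℝ) : ℝ := ∑ i, ∑ j, metric m q i j * metric m q i j

theorem metricSq_eq_sum (m : ℕ) (q : ℝ) : metricSq m q = ∑ i, weight m q i * weight m q i := by
  refine Finset.sum_congr rfl fun i _ => ?_
  rw [sum_metric_mul, metric_eq]
  simp

theorem trace2_metric (m : ℕ) (q : ℝ) : trace2 m q (metric m q) = metricSq m q := by
  rw [metricSq_eq_sum, trace2]
  rw [← Equiv.sum_comp Fin.revPerm]
  simp [metric_eq]

theorem weight_zero_mul_self {q : ℝ} (hq : 0 < q) (m : ℕ) :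
    weight (m + 2) q 0 * weight (m + 2) q 0 = (q ^ m)⁻¹ := by
  rw [weight_zero, ← Real.rpow_add hq, ← Real.rpow_natCast, ← Real.rpow_neg hq.le]
  congr 1; ring

theorem weight_last_eq {q : ℝ} (hq : 0 < q) (m : ℕ) :
    weight (m + 2) q (Fin.last (m + 1)) = (weight (m + 2) q 0)⁻¹ := by
  have := weight_mul_weight_rev hq (0 : Fin (m + 2))
  rw [Fin.rev_zero] at this
  exact eq_inv_of_mul_eq_one_right this

theorem metricSq_add_two {q : ℝ} (hq : 0 < q) (m : ℕ) :
    metricSq (m + 2) q = (q ^ m)⁻¹ + (metricSq m q + q ^ m) := by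
  rw [metricSq_eq_sum, sum_fin_add_two, metricSq_eq_sum, weight_zero_mul_self hq, weight_last_eq hq,
    ← mul_inv, weight_zero_mul_self hq, inv_inv]
  simp only [weight_inner]

/-- The sum of the squared weights is essentially geometric. The first factor on the right is μ, so
the trace of the metric is μ [m/2]_{q²}. -/
theorem metricSq_mul {q : ℝ} (hq : 0 < q) (m : ℕ) :
    metricSq m q * (1 - q ^ 2) = (1 + q ^ 2 * (q ^ m)⁻¹) * (1 - q ^ m) := by
  induction m using Nat.twoStepInduction with
  | zero => simp [metricSq]
  | one => simp [metricSq, metric, rho]; field_simp; ring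
  | more m ih _ =>
    rw [metricSq_add_two hq, pow_add]
    have : (q ^ m) ≠ 0 := by positivity
    field_simp at ih ⊢
    linear_combination ih

section linear
variable {m : ℕ} {q : ℝ}

theorem braid_add (f g : Fin m → Fin m → ℝ) (d e : Fin m) :
    braid m q (fun a b => f a b + g a b) d e = braid m q f d e + braid m q g d e := by
  simp only [braid, add_mul, Finset.sum_add_distrib]

theorem braid_sub (f g : Fin m → Fin m → ℝ) (d e : Fin m) :
    braid m q (fun a b => f a b - g a b) d e = braid m q f d e - braid m q g d e := by
  simp only [braid, sub_mul, Finset.sum_sub_distrib]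

theorem braid_mul (c : ℝ) (f : Fin m → Fin m → ℝ) (d e : Fin m) :
    braid m q (fun a b => c * f a b) d e = c * braid m q f d e := by
  simp only [braid, mul_assoc, Finset.mul_sum]

theorem trace2_add (f g : Fin m → Fin m → ℝ) :
    trace2 m q (fun a b => f a b + g a b) = trace2 m q f + trace2 m q g := by
  simp only [trace2, mul_add, Finset.sum_add_distrib]

theorem trace2_sub (f g : Fin m → Fin m → ℝ) :
    trace2 m q (fun a b => f a b - g a b) = trace2 m q f - trace2 m q g := by
  simp only [trace2, mul_sub, Finset.sum_sub_distrib]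

theorem trace2_mul (c : ℝ) (f : Fin m → Fin m → ℝ) :
    trace2 m q (fun a b => c * f a b) = c * trace2 m q f := by
  simp only [trace2, mul_left_comm _ c, Finset.mul_sum]

theorem trace2_add_two (τ : Fin (m + 2) → Fin (m + 2) → ℝ) :
    trace2 (m + 2) q τ = weight (m + 2) q (Fin.last _) * τ (Fin.last _) 0 +
      (trace2 m q (fun a b => τ (inner a) (inner b)) +
        weight (m + 2) q 0 * τ 0 (Fin.last _)) := by
  simp only [trace2, sum_fin_add_two, rev_inner, weight_inner, Fin.rev_zero, Fin.rev_last]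

theorem metric_inner (v u : Fin m) :
    metric (m + 2) q (inner v) (inner u) = metric m q v u := by
  simp only [metric_eq, rev_inner, inner_inj, weight_inner]

theorem metric_zero_last :
    metric (m + 2) q 0 (Fin.last _) = weight (m + 2) q 0 := by
  simp [metric_eq]

theorem metric_last_zero :
    metric (m + 2) q (Fin.last _) 0 = weight (m + 2) q (Fin.last _) := by
  simp [metric_eq]

theorem metric_zero_zero : metric (m + 2) q 0 0 = 0 := by simp [metric_eq, zero_ne_last']
theorem metric_last_last : metric (m + 2) q (Fin.last _) (Fin.last _) = 0 := by
  simp [metric_eq]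
theorem metric_zero_inner (v : Fin m) : metric (m + 2) q 0 (inner v) = 0 := by
  simp [metric_eq, rev_inner, (inner_ne_zero _).symm]
theorem metric_inner_zero (v : Fin m) : metric (m + 2) q (inner v) 0 = 0 := by
  simp [metric_eq, inner_ne_last]
theorem metric_last_inner (v : Fin m) : metric (m + 2) q (Fin.last _) (inner v) = 0 := by
  simp [metric_eq, rev_inner, (inner_ne_last _).symm]
theorem metric_inner_last (v : Fin m) : metric (m + 2) q (inner v) (Fin.last _) = 0 := by
  simp [metric_eq, inner_ne_zero]

end linear

theorem metric_one (q : ℝ) (i j : Fin 1) : metric 1 q i j = 1 := by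
  fin_cases i; fin_cases j; simp [metric, rho]

theorem braid_one {q : ℝ} (τ : Fin 1 → Fin 1 → ℝ) (i j : Fin 1) : braid 1 q τ i j = τ i j := by
  fin_cases i; fin_cases j; rw [braid_apply]; simp

theorem trace2_one {q : ℝ} (τ : Fin 1 → Fin 1 → ℝ) : trace2 1 q τ = τ 0 0 := by
  simp [trace2, weight, rho]

/-- The singlet eigenvalue q^(1-m), in dual form. In the induction the correction of the inner block
contributes the trace of the smaller metric, which is why its closed form is needed. -/
theorem trace2_braid {q : ℝ} (hq : 0 < q) (hq1 : q < 1) (m : ℕ) (τ : Fin m → Fin m → ℝ) :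
    trace2 m q (braid m q τ) = q / q ^ m * trace2 m q τ := by
  induction m using Nat.twoStepInduction with
  | zero => simp [trace2]
  | one => simp [trace2_one, braid_one, hq.ne']
  | more m ih _ =>
    have hm := metricSq_mul hq m
    have hw := weight_zero_mul_self hq m
    have hw0 := (weight_pos hq (0 : Fin (m + 2))).ne'
    rw [trace2_add_two, trace2_add_two, weight_last_eq hq]
    simp only [braid_last_zero, braid_zero_last, braid_inner_inner, trace2_sub, mul_assoc,
      trace2_mul, mul_comm (metric m q _ _), trace2_metric, pow_add]
    rw [ih]
    have hp : q ^ m ≠ 0 := by positivity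
    have hq2 : 1 - q ^ 2 ≠ 0 := by nlinarith
    generalize weight (m + 2) q 0 = w at *
    generalize trace2 m q (fun a b => τ (inner a) (inner b)) = T
    have hQ : metricSq m q = (1 + q ^ 2 * (q ^ m)⁻¹) * (1 - q ^ m) / (1 - q ^ 2) := by
      rw [eq_div_iff hq2, hm]
    rw [hQ]
    -- Eliminating `q ^ m` in favour of the outer weight leaves a rational identity in two
    -- variables.
    have hpw : q ^ m = (w * w)⁻¹ := by rw [hw, inv_inv]
    rw [hpw]
    field_simp
    ring

theorem braid_metric {q : ℝ} (hq : 0 < q) (hq1 : q < 1) (m : ℕ) (d e : Fin m) :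
    braid m q (metric m q) d e = q / q ^ m * metric m q d e := by
  induction m using Nat.twoStepInduction with
  | zero => exact d.elim0
  | one => simp [braid_one, hq.ne']
  | more m ih _ =>
    have hm := metricSq_mul hq m
    have hw := weight_zero_mul_self hq m
    have hw0 := (weight_pos hq (0 : Fin (m + 2))).ne'
    have hp : q ^ m ≠ 0 := by positivity
    have hq2 : 1 - q ^ 2 ≠ 0 := by nlinarith
    have hQ : metricSq m q = (1 + q ^ 2 * (q ^ m)⁻¹) * (1 - q ^ m) / (1 - q ^ 2) := by
      rw [eq_div_iff hq2, hm]
    have hpw : q ^ m = (weight (m + 2) q 0 * weight (m + 2) q 0)⁻¹ := by rw [hw, inv_inv]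
    have hT : trace2 m q (fun a b => metric m q a b) = metricSq m q := trace2_metric m q
    have hB : ∀ v u, braid m q (fun a b => metric m q a b) v u = q / q ^ m * metric m q v u := ih
    induction d using fin_add_two_cases <;> induction e using fin_add_two_cases <;>
    simp only [braid_zero_zero, braid_last_last, braid_zero_inner, braid_inner_zero, braid_inner_last,
      braid_last_inner, braid_last_zero, braid_zero_last, braid_inner_inner, metric_inner,
      metric_zero_last, metric_last_zero, metric_zero_zero, metric_last_last, metric_zero_inner,
      metric_inner_zero, metric_last_inner, metric_inner_last, hT, hB, mul_zero, add_zero,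
      pow_add, hQ, weight_last_eq hq, sub_zero]
    all_goals
      generalize weight (m + 2) q 0 = w at *
      try rw [hpw]
      field_simp
      try ring

/-- The skein relation: the Hecke relation of R̂ fails only by a rank-one term along the metric. It
is checked block by block, the induction hypothesis covering the inner braiding. -/
theorem braid_braid {q : ℝ} (hq : 0 < q) (hq1 : q < 1) (m : ℕ) (τ : Fin m → Fin m → ℝ)
    (d e : Fin m) :
    braid m q (braid m q τ) d e = τ d e + (q - q⁻¹) * braid m q τ d e
      - (q - q⁻¹) * (q / q ^ m) * metric m q d e * trace2 m q τ := by
  induction m using Nat.twoStepInduction with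
  | zero => exact d.elim0
  | one =>
    fin_cases d; fin_cases e
    simp [braid_one, trace2_one, metric_one, hq.ne']
  | more m ih _ =>
    have hm := metricSq_mul hq m
    have hw := weight_zero_mul_self hq m
    have hw0 := (weight_pos hq (0 : Fin (m + 2))).ne'
    have hp : q ^ m ≠ 0 := by positivity
    have hq2 : 1 - q ^ 2 ≠ 0 := by nlinarith
    have hQ : metricSq m q = (1 + q ^ 2 * (q ^ m)⁻¹) * (1 - q ^ m) / (1 - q ^ 2) := by
      rw [eq_div_iff hq2, hm]
    have hpw : q ^ m = (weight (m + 2) q 0 * weight (m + 2) q 0)⁻¹ := by rw [hw, inv_inv]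
    have hT : trace2 m q (fun a b => metric m q a b) = metricSq m q := trace2_metric m q
    have hB : ∀ v u, braid m q (fun a b => metric m q a b) v u = q / q ^ m * metric m q v u :=
      braid_metric hq hq1 m
    have ih' : ∀ τ v u, braid m q (fun a b => braid m q τ a b) v u = _ := ih
    have hTB : ∀ τ, trace2 m q (fun a b => braid m q τ a b) = _ := trace2_braid hq hq1 m
    induction d using fin_add_two_cases <;> induction e using fin_add_two_cases <;>
    simp only [braid_zero_zero, braid_last_last, braid_zero_inner, braid_inner_zero, braid_inner_last,
      braid_last_inner, braid_last_zero, braid_zero_last, braid_inner_inner, metric_inner,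
      metric_zero_last, metric_last_zero, metric_zero_zero, metric_last_last, metric_zero_inner,
      metric_inner_zero, metric_last_inner, metric_inner_last, hT, hB, mul_zero, add_zero,
      pow_add, hQ, weight_last_eq hq, sub_zero, braid_sub, mul_assoc, braid_mul, trace2_sub,
      trace2_mul, mul_comm (metric m q _ _), ih', hTB, trace2_add_two, zero_mul]
    all_goals
      generalize weight (m + 2) q 0 = w at *
      try rw [hpw]
      field_simp
      try ring
end QEuclid

namespace QEuclid

/-! ### Compatibility of the braid matrix with the metric -/

theorem rev_eq_comm {m : ℕ} {i j : Fin m} : i.rev = j ↔ i = j.rev := by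
  constructor <;> (rintro rfl; rw [Fin.rev_rev])

theorem ite_lt_add_ite_gt {m : ℕ} (i j : Fin m) (x : ℝ) :
    (if i < j then x else 0) + (if j < i then x else 0) = x - if i = j then x else 0 := by
  rcases lt_trichotomy i j with h | h | h
  · simp [h, h.not_gt, h.ne]
  · simp [h]
  · simp [h, h.not_gt, h.ne']

/-- The exponents are opposite and lie in {-1, 0, 1}, where `q ^ e - q ^ (-e)` is linear in `e`.
These diagonal terms compensate those left over by `ite_lt_add_ite_gt` when two complementary
truncations are added. -/
theorem zpow_sub_zpow (m : ℕ) (q : ℝ) (i j : Fin m) :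
    q ^ ((if i = j then 1 else 0) - (if i = j.rev then 1 else 0) : ℤ)
      - q ^ ((if i = j.rev then 1 else 0) - (if i = j then 1 else 0) : ℤ)
      = (q - q⁻¹) * ((if i = j then 1 else 0) - (if i = j.rev then 1 else 0)) := by
  split_ifs <;> simp

/-- The metric can be pulled through a strand, which turns R̂ on one pair of indices into R̂⁻¹ on
the neighbouring pair. The right side is that inverse, written out with the skein relation. -/
theorem braid_metric_right {m : ℕ} {q : ℝ} (hq : 0 < q) (X : Fin m → ℝ) (v u t : Fin m) :
    braid m q (fun a b => metric m q b t * X a) v u =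
      braid m q (fun b c => metric m q v b * X c) u t
      + (q - q⁻¹) * (metric m q u t * X v - metric m q v u * X t) := by
  rw [braid_apply, braid_apply]
  have s1 : ∑ j, (if v < j then weight m q j.rev * (metric m q j t * X j.rev) else 0) =
      if v < t.rev then X t else 0 := by
    rw [Finset.sum_eq_single t.rev]
    · rw [metric_eq, if_pos rfl, Fin.rev_rev, ← mul_assoc, weight_mul_weight_rev hq, one_mul]
    · intro j _ hj
      simp [metric_eq, hj]
    · simp
  have s2 : ∑ j, (if u < j then weight m q j.rev * (metric m q v j.rev * X j) else 0) =
      if u < v then X v else 0 := by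
    rw [Finset.sum_eq_single v]
    · rw [metric_eq, Fin.rev_rev, if_pos rfl, ← mul_assoc, mul_comm (weight m q v.rev),
        weight_mul_weight_rev hq, one_mul]
    · intro j _ hj
      simp [metric_eq, hj.symm]
    · simp
  rw [s1, s2]
  have k1 := ite_lt_add_ite_gt v u (metric m q u t * X v)
  have k2 := ite_lt_add_ite_gt v t.rev (metric m q v u * X t)
  have c1 : (if u = t.rev then weight m q u * if u < v then X v else 0 else 0) =
      if u < v then metric m q u t * X v else 0 := by
    rw [metric_eq]; split_ifs <;> simp
  have c2 : (if v = u.rev then weight m q v * if v < t.rev then X t else 0 else 0) =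
      if v < t.rev then metric m q v u * X t else 0 := by
    rw [metric_eq]; split_ifs <;> simp
  have c3 : (if u < t then metric m q v u * X t else 0) =
      if t.rev < v then metric m q v u * X t else 0 := by
    by_cases h : v = u.rev
    · subst h; simp [Fin.rev_lt_rev]
    · simp [metric_eq, h]
  rw [c1, c2, c3]
  have z : q ^ ((if v = u then 1 else 0) - (if v = u.rev then 1 else 0) : ℤ) *
        (metric m q v t * X u)
      = q ^ ((if u = t then 1 else 0) - (if u = t.rev then 1 else 0) : ℤ) * (metric m q v t * X u)
      + (q - q⁻¹) * ((if v = u then metric m q u t * X v else 0) -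
        (if v = t.rev then metric m q v u * X t else 0)) := by
    by_cases h : v = t.rev
    · subst h
      have := zpow_sub_zpow m q t.rev u
      have r1 : (t.rev = u.rev) = (u = t) := by simp [eq_comm]
      have r2 : (t.rev = u) = (u = t.rev) := by simp [eq_comm]
      simp only [r1, r2] at this ⊢
      simp only [metric_eq, if_true, r1]
      split_ifs at this ⊢ with h1 h2 h2
      · rw [h2, show t.rev = t from h1.symm.trans h2]; ring
      · rw [h1]; linear_combination (weight m q t.rev * X t.rev) * this
      · rw [h2]; linear_combination (weight m q t.rev * X t) * this
      · linear_combination (weight m q t.rev * X u) * this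
    · have h' : metric m q v t = 0 := by rw [metric_eq, if_neg h]
      by_cases h2 : v = u
      · rw [← h2, h']; simp [h]
      · rw [h']; simp [h, h2]
  rw [z]
  linear_combination (q - q⁻¹) * k1 - (q - q⁻¹) * k2

/-- The dual move: a contraction is pulled through a strand, again with R̂⁻¹ written out. The
truncated traces on the two sides are complementary. -/
theorem trace2_braid_right {m : ℕ} {q : ℝ} (hq : 0 < q) (τ : Fin m → Fin m → Fin m → ℝ) (v : Fin m) :
    trace2 m q (fun a b => braid m q (fun b' c => τ a b' c) b v) =
      trace2 m q (fun b c => braid m q (fun a b' => τ a b' c) v b)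
      - (q - q⁻¹) * trace2 m q (fun b c => τ v b c) + (q - q⁻¹) * trace2 m q (fun a b => τ a b v) := by
  simp only [trace2, braid_apply, mul_add, mul_sub, Finset.sum_add_distrib, Finset.sum_sub_distrib]
  have s1 : ∑ j, weight m q j.rev * ((q - q⁻¹) * (if j = v.rev then weight m q j *
      ∑ i, (if j < i then weight m q i.rev * τ j.rev i.rev i else 0) else 0)) =
      (q - q⁻¹) * ∑ i, (if v.rev < i then weight m q i.rev * τ v i.rev i else 0) := by
    rw [Finset.sum_eq_single v.rev]
    · rw [if_pos rfl, Fin.rev_rev, mul_left_comm, ← mul_assoc (weight m q v), weight_mul_weight_rev hq,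
        one_mul]
    · intro j _ hj
      simp [hj]
    · simp
  have s2 : ∑ j, weight m q j.rev * ((q - q⁻¹) * (if v = j.rev.rev then weight m q v *
      ∑ i, (if v < i then weight m q i.rev * τ i.rev i j else 0) else 0)) =
      (q - q⁻¹) * ∑ i, (if v < i then weight m q i.rev * τ i.rev i v else 0) := by
    rw [Finset.sum_eq_single v]
    · rw [Fin.rev_rev, if_pos rfl, mul_left_comm, ← mul_assoc (weight m q v.rev),
        mul_comm (weight m q v.rev), weight_mul_weight_rev hq, one_mul]
    · intro j _ hj
      simp [hj.symm]
    · simp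
  rw [s1, s2]
  have t1 := Finset.sum_congr rfl fun (i : Fin m) (_ : i ∈ Finset.univ) =>
    ite_lt_add_ite_gt v i (weight m q i.rev * τ i.rev i v)
  have t2 := Finset.sum_congr rfl fun (i : Fin m) (_ : i ∈ Finset.univ) =>
    ite_lt_add_ite_gt v.rev i (weight m q i.rev * τ v i.rev i)
  simp only [Finset.sum_add_distrib, Finset.sum_sub_distrib, Finset.sum_ite_eq, Finset.mem_univ,
    if_true, Fin.rev_rev] at t1 t2
  have r2 : ∀ j : Fin m, (v = j.rev) = (j = v.rev) := fun j => by
    rw [← rev_eq_comm, eq_comm (a := v.rev)]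
  have r3 : ∀ j : Fin m, (v = j) = (j = v) := fun j => propext eq_comm
  have g1 : ∑ j, weight m q j.rev * (q ^ ((if j = v then 1 else 0) - (if j = v.rev then 1 else 0) : ℤ) *
      τ j.rev v j) = ∑ j, weight m q j.rev * (q ^ ((if v = j.rev then 1 else 0) -
      (if v = j.rev.rev then 1 else 0) : ℤ) * τ j.rev v j) +
      (q - q⁻¹) * (weight m q v.rev * τ v.rev v v - weight m q v * τ v v v.rev) := by
    rw [← sub_eq_iff_eq_add', ← Finset.sum_sub_distrib]
    have : ∀ j, weight m q j.rev * (q ^ ((if j = v then 1 else 0) - (if j = v.rev then 1 else 0) : ℤ) *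
      τ j.rev v j) - weight m q j.rev * (q ^ ((if v = j.rev then 1 else 0) -
      (if v = j.rev.rev then 1 else 0) : ℤ) * τ j.rev v j) =
      (q - q⁻¹) * ((if j = v then weight m q j.rev * τ j.rev v j else 0) -
      (if j = v.rev then weight m q j.rev * τ j.rev v j else 0)) := by
      intro j
      have := zpow_sub_zpow m q j v
      simp only [Fin.rev_rev, r2, r3]
      split_ifs at this ⊢ <;> linear_combination (weight m q j.rev * τ j.rev v j) * this
    rw [Finset.sum_congr rfl fun j _ => this j]
    simp only [← Finset.mul_sum, Finset.sum_sub_distrib, Finset.sum_ite_eq', Finset.mem_univ,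
      if_true, Fin.rev_rev]
  have g2 : ∑ j, weight m q j.rev * ((q - q⁻¹) * (if j < v then τ j.rev j v else 0)) =
      (q - q⁻¹) * ∑ j, (if j < v then weight m q j.rev * τ j.rev j v else 0) := by
    rw [Finset.mul_sum]
    exact Finset.sum_congr rfl fun j _ => by split_ifs <;> ring
  have g3 : ∑ j, weight m q j.rev * ((q - q⁻¹) * (if v < j.rev then τ v j.rev j else 0)) =
      (q - q⁻¹) * ∑ j, (if j < v.rev then weight m q j.rev * τ v j.rev j else 0) := by
    rw [Finset.mul_sum]
    refine Finset.sum_congr rfl fun j _ => ?_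
    simp only [Fin.lt_rev_iff (i := v)]
    split_ifs <;> ring
  rw [g1, g2, g3]
  linear_combination (q - q⁻¹) * t1 - (q - q⁻¹) * t2

/-- The action of the braid matrix on the first two factors. -/
def braid12 (m : ℕ) (q : ℝ) (τ : Fin m → Fin m → Fin m → ℝ) : Fin m → Fin m → Fin m → ℝ :=
  fun d e f => braid m q (fun a b => τ a b f) d e

/-- The action of the braid matrix on the last two factors. -/
def braid23 (m : ℕ) (q : ℝ) (τ : Fin m → Fin m → Fin m → ℝ) : Fin m → Fin m → Fin m → ℝ :=
  fun d e f => braid m q (fun b c => τ d b c) e f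

theorem trace2_metric_mul {m : ℕ} {q : ℝ} (hq : 0 < q) (X : Fin m → ℝ) (v : Fin m) :
    trace2 m q (fun a b => metric m q b v * X a) = X v := by
  rw [trace2, Finset.sum_eq_single v.rev]
  · rw [Fin.rev_rev, metric_eq, if_pos rfl, ← mul_assoc, weight_mul_weight_rev hq, one_mul]
  · intro j _ hj
    simp [metric_eq, hj]
  · simp

theorem trace2_metric_mul' {m : ℕ} {q : ℝ} (hq : 0 < q) (X : Fin m → ℝ) (v : Fin m) :
    trace2 m q (fun b c => metric m q v b * X c) = X v := by
  rw [trace2, Finset.sum_eq_single v]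
  · rw [metric_eq, Fin.rev_rev, if_pos rfl, ← mul_assoc, mul_comm (weight m q v.rev),
      weight_mul_weight_rev hq, one_mul]
  · intro j _ hj
    simp [metric_eq, hj.symm]
  · simp

end QEuclid

/-! ### The Yang–Baxter equation -/

namespace QEuclid
-- The contraction is slid through the outer braiding of the already braided tensor; the skein
-- relation and the singlet eigenvalue then cancel all but one term.
theorem trace2_braid_braid {m : ℕ} {q : ℝ} (hq : 0 < q) (hq1 : q < 1)
    (τ : Fin m → Fin m → Fin m → ℝ) (v : Fin m) :
    trace2 m q (fun a b => braid m q (fun a' b' => braid m q (fun c d => τ a' c d) b' b) v a) =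
      trace2 m q (fun a b => τ a b v) := by
  have h := trace2_braid_right hq (braid23 m q τ) v
  have h1 : ∀ a b, braid m q (fun b' c => braid23 m q τ a b' c) b v = _ :=
    fun a b => braid_braid hq hq1 m (τ a) b v
  have h2 : trace2 m q (fun b c => braid23 m q τ v b c) = _ := trace2_braid hq hq1 m (τ v)
  rw [h2] at h
  simp only [h1, trace2_add, trace2_sub, trace2_mul, mul_assoc, trace2_metric_mul hq] at h
  simp only [braid23] at h
  linear_combination -h

theorem braid_braid_metric {m : ℕ} {q : ℝ} (hq : 0 < q) (hq1 : q < 1) (X : Fin m → ℝ)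
    (v u t : Fin m) :
    braid m q (fun a b => braid m q (fun b' c => metric m q a b' * X c) b t) v u =
      metric m q u t * X v := by
  have h : ∀ a b, braid m q (fun b' c => metric m q a b' * X c) b t =
      braid m q (fun a b => metric m q b t * X a) a b
        - (q - q⁻¹) * (metric m q b t * X a - X t * metric m q a b) := fun a b => by
    rw [braid_metric_right hq]; ring
  have h1 : braid m q (fun a b => metric m q a b) v u = _ := braid_metric hq hq1 m v u
  have h2 : braid m q (fun a b => braid m q (fun a b => metric m q b t * X a) a b) v u = _ :=
    braid_braid hq hq1 m _ v u
  simp only [h, braid_sub, braid_mul, h1, h2, trace2_metric_mul hq]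
  ring

/-- This is what lets the antisymmetric projection pass a double braiding, so that the Leibniz rule
respects the relations of the coordinates. -/
theorem braid_yang_baxter {q : ℝ} (hq : 0 < q) (hq1 : q < 1) (m : ℕ)
    (τ : Fin m → Fin m → Fin m → ℝ) (d e f : Fin m) :
    braid12 m q (braid23 m q (braid12 m q τ)) d e f =
      braid23 m q (braid12 m q (braid23 m q τ)) d e f := by
  induction m using Nat.twoStepInduction with
  | zero => exact d.elim0
  | one => simp only [braid12, braid23, braid_one]
  | more m ih _ =>
    simp only [braid12, braid23] at ih ⊢
    have hm := metricSq_mul hq m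
    have hw := weight_zero_mul_self hq m
    have hw0 := (weight_pos hq (0 : Fin (m + 2))).ne'
    have hp : q ^ m ≠ 0 := by positivity
    have hq2 : 1 - q ^ 2 ≠ 0 := by nlinarith
    have hQ : metricSq m q = (1 + q ^ 2 * (q ^ m)⁻¹) * (1 - q ^ m) / (1 - q ^ 2) := by
      rw [eq_div_iff hq2, hm]
    have hpw : q ^ m = (weight (m + 2) q 0 * weight (m + 2) q 0)⁻¹ := by rw [hw, inv_inv]
    have hT : trace2 m q (fun a b => metric m q a b) = metricSq m q := trace2_metric m q
    have hB : ∀ v u, braid m q (fun a b => metric m q a b) v u = q / q ^ m * metric m q v u :=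
      braid_metric hq hq1 m
    have hBc : ∀ c v u, braid m q (fun a b => metric m q a b * c) v u = q / q ^ m * metric m q v u * c := by
      intro c v u
      have := braid_mul (q := q) c (fun a b => metric m q a b) v u
      rw [hB] at this
      simp only [mul_comm _ c, this]
    have hTc : ∀ c, trace2 m q (fun a b => metric m q a b * c) = metricSq m q * c := by
      intro c
      have := trace2_mul (q := q) c (fun a b => metric m q a b)
      rw [hT] at this
      simp only [mul_comm _ c, this]
    have hBB : ∀ (τ : Fin m → Fin m → ℝ) v u, braid m q (fun a b => braid m q (fun a b => τ a b) a b) v u = _ :=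
      braid_braid hq hq1 m
    have hTB : ∀ τ : Fin m → Fin m → ℝ, trace2 m q (fun a b => braid m q (fun a b => τ a b) a b) = _ :=
      trace2_braid hq hq1 m
    have hT1 := trace2_metric_mul (m := m) hq
    have hT2 := trace2_metric_mul' (m := m) hq
    have hM := braid_metric_right (m := m) hq
    have hTR := trace2_braid_right (m := m) hq
    have hRR := trace2_braid_braid (m := m) hq hq1
    have hMM := braid_braid_metric (m := m) hq hq1
    -- Each index is first, inner or last, which makes 27 cases. The induction hypothesis serves the
    -- case of three inner indices; the metric and trace terms are collected by the skein relation
    -- and the compatibility rules above.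
    induction d using fin_add_two_cases <;> induction e using fin_add_two_cases <;>
    induction f using fin_add_two_cases <;>
    simp only [braid_zero_zero, braid_last_last, braid_zero_inner, braid_inner_zero, braid_inner_last,
      braid_last_inner, braid_last_zero, braid_zero_last, braid_inner_inner, 
      braid_add, braid_sub, mul_assoc, braid_mul, trace2_add, trace2_sub, trace2_mul, hMM, hRR, hTR, hT, hB, hBc, hTc, hT1, hT2, hBB, hTB, ih]
    all_goals try simp only [hM, braid_add, braid_sub, mul_assoc, braid_mul, trace2_add, trace2_sub,
      trace2_mul, hB, hBc, hTc, hT1, hT2, hBB, hTB, hT]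
    all_goals try ring1
    all_goals
      try (generalize weight (m + 2) q 0 = w at *
           try rw [hQ]
           try rw [hpw]
           field_simp
           try ring1)
end QEuclid

namespace QEuclid

/-! ### The inverse of the braid matrix -/

theorem Rhat_symm (m : ℕ) (q : ℝ) (a b : Fin m × Fin m) : Rhat m q a b = Rhat m q b a := by
  obtain ⟨i, j⟩ := a
  obtain ⟨k, l⟩ := b
  simp only [Rhat, Prod.mk.injEq]
  congr 1
  · by_cases h : i = l ∧ j = k
    · obtain ⟨rfl, rfl⟩ := h
      have h1 : (i = j.rev) = (j = i.rev) := propext (rev_eq_comm.symm.trans eq_comm)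
      simp only [h1, eq_comm (a := i) (b := j), and_self, if_true]
    · have h' : ¬ (k = j ∧ l = i) := fun hh => h ⟨hh.2.symm, hh.1.symm⟩
      rw [if_neg h, if_neg h']
  · congr 1
    by_cases h : i = k ∧ j = l
    · obtain ⟨rfl, rfl⟩ := h; rfl
    · have h' : ¬ (k = i ∧ l = j) := fun hh => h ⟨hh.1.symm, hh.2.symm⟩
      rw [if_neg h, if_neg h', zero_sub, zero_sub, mul_comm (metric m q k l)]
      by_cases h1 : i = j.rev
      · by_cases h2 : k = l.rev
        · subst h1 h2
          congr 1
          exact propext Fin.rev_lt_iff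
        · simp [metric_eq, h2]
      · simp [metric_eq, h1]

/-- The matrix `C^{ij} C_{kl}`. -/
def singlet (m : ℕ) (q : ℝ) : Matrix (Fin m × Fin m) (Fin m × Fin m) ℝ :=
  fun a b => metric m q a.1 a.2 * metric m q b.1 b.2

theorem trace2_eq (m : ℕ) (q : ℝ) (τ : Fin m → Fin m → ℝ) :
    trace2 m q τ = ∑ i, ∑ j, metric m q i j * τ i j := by
  rw [trace2, ← Equiv.sum_comp Fin.revPerm]
  refine Finset.sum_congr rfl fun i _ => ?_
  rw [sum_metric_mul]
  simp

theorem braid_delta (m : ℕ) (q : ℝ) (a : Fin m × Fin m) (d e : Fin m) :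
    braid m q (fun c c' => if a = (c, c') then 1 else 0) d e = Rhat m q a (d, e) := by
  rw [braid, ← Fintype.sum_prod_type' (fun c c' => (if a = (c, c') then 1 else 0) *
    Rhat m q (c, c') (d, e))]
  simp

theorem trace2_delta (m : ℕ) (q : ℝ) (a : Fin m × Fin m) :
    trace2 m q (fun c c' => if a = (c, c') then 1 else 0) = metric m q a.1 a.2 := by
  rw [trace2_eq, ← Fintype.sum_prod_type' (fun i j => metric m q i j *
    if a = (i, j) then (1 : ℝ) else 0)]
  simp

theorem Rhat_mul_self {m : ℕ} {q : ℝ} (hq : 0 < q) (hq1 : q < 1) :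
    Rhat m q * Rhat m q = 1 + (q - q⁻¹) • Rhat m q - ((q - q⁻¹) * (q / q ^ m)) • singlet m q := by
  ext a b
  obtain ⟨d, e⟩ := b
  have h := braid_braid hq hq1 m (fun c c' => if a = (c, c') then 1 else 0) d e
  have h1 : ∀ c c', braid m q (fun c c' => if a = (c, c') then 1 else 0) c c' =
    Rhat m q a (c, c') := braid_delta m q a
  rw [trace2_delta, h1, braid] at h
  simp only [h1] at h
  rw [Matrix.mul_apply, Fintype.sum_prod_type, h]
  simp only [Matrix.sub_apply, Matrix.add_apply, Matrix.smul_apply, Matrix.one_apply, singlet,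
    smul_eq_mul]
  ring

theorem singlet_mul_Rhat {m : ℕ} {q : ℝ} (hq : 0 < q) (hq1 : q < 1) :
    singlet m q * Rhat m q = (q / q ^ m) • singlet m q := by
  ext a b
  obtain ⟨d, e⟩ := b
  have h := braid_metric hq hq1 m d e
  rw [Matrix.mul_apply, Fintype.sum_prod_type]
  simp only [singlet, mul_assoc, ← Finset.mul_sum, Matrix.smul_apply, smul_eq_mul]
  rw [braid] at h
  rw [h]
  ring

theorem Rhat_transpose (m : ℕ) (q : ℝ) : (Rhat m q).transpose = Rhat m q := by
  ext a b; exact Rhat_symm m q b a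

theorem singlet_transpose (m : ℕ) (q : ℝ) : (singlet m q).transpose = singlet m q := by
  ext a b; simp [singlet, mul_comm]

theorem Rhat_mul_singlet {m : ℕ} {q : ℝ} (hq : 0 < q) (hq1 : q < 1) :
    Rhat m q * singlet m q = (q / q ^ m) • singlet m q := by
  have := congrArg Matrix.transpose (singlet_mul_Rhat (m := m) hq hq1)
  rwa [Matrix.transpose_mul, Rhat_transpose, singlet_transpose, Matrix.transpose_smul,
    singlet_transpose] at this

/-- The skein relation of the braid matrix, solved for its inverse. -/
theorem Rhat_inv {m : ℕ} {q : ℝ} (hq : 0 < q) (hq1 : q < 1) :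
    (Rhat m q)⁻¹ = Rhat m q - (q - q⁻¹) • (1 - singlet m q) := by
  refine Matrix.inv_eq_right_inv ?_
  rw [mul_sub, Rhat_mul_self hq hq1, mul_smul_comm, mul_sub, Rhat_mul_singlet hq hq1, mul_one,
    smul_sub, smul_smul]
  abel

theorem Rhat_mul_inv {m : ℕ} {q : ℝ} (hq : 0 < q) (hq1 : q < 1) :
    Rhat m q * (Rhat m q)⁻¹ = 1 := by
  rw [Rhat_inv hq hq1]
  rw [mul_sub, Rhat_mul_self hq hq1, mul_smul_comm, mul_sub, Rhat_mul_singlet hq hq1, mul_one,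
    smul_sub, smul_smul]
  abel

theorem Rhat_inv_mul {m : ℕ} {q : ℝ} (hq : 0 < q) (hq1 : q < 1) :
    (Rhat m q)⁻¹ * Rhat m q = 1 := mul_eq_one_comm.mp (Rhat_mul_inv hq hq1)

theorem metricSq_pos {m : ℕ} (hm : 1 ≤ m) {q : ℝ} (hq : 0 < q) : 0 < metricSq m q := by
  rw [metricSq_eq_sum]
  have : Nonempty (Fin m) := ⟨⟨0, hm⟩⟩
  exact Finset.sum_pos (fun i _ => mul_pos (weight_pos hq i) (weight_pos hq i)) Finset.univ_nonempty

/-- The coefficient `κ` in `R̂ (x ⊗ x) = q x ⊗ x + κ 𝐱² C`. -/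
def kappa (m : ℕ) (q : ℝ) : ℝ := (q / q ^ m - q) / metricSq m q

theorem projAntisym_eq {m : ℕ} {q : ℝ} (hq : 0 < q) :
    projAntisym m q = (q + q⁻¹)⁻¹ • (q • (1 : Matrix (Fin m × Fin m) (Fin m × Fin m) ℝ) - Rhat m q
      + kappa m q • singlet m q) := by
  have h : projSinglet m q = (metricSq m q)⁻¹ • singlet m q := by
    ext a b
    simp [projSinglet, singlet, metricSq]
    ring
  rw [projAntisym, h, smul_smul, kappa, sub_eq_add_neg _ (_ • singlet m q), ← neg_smul]
  congr 4
  rw [zpow_sub₀ hq.ne', zpow_one, zpow_natCast]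
  ring

/-- R̂ equals -q⁻¹ on the image of P_A. The factor `1 + q • Rhat m q` is the one in which the
lower-order terms of a derivative of x^j x^k p, or of a second derivative of x^k p, combine. -/
theorem projAntisym_mul {m : ℕ} (hm : 1 ≤ m) {q : ℝ} (hq : 0 < q) (hq1 : q < 1) :
    projAntisym m q * (1 + q • Rhat m q) = 0 := by
  have hQ := metricSq_mul hq m
  have hQ0 := metricSq_pos hm hq
  rw [projAntisym_eq hq, smul_mul_assoc, add_mul, sub_mul, mul_add, mul_add, mul_add,
    smul_mul_assoc, smul_mul_assoc, smul_mul_assoc, mul_smul_comm, mul_smul_comm, mul_smul_comm,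
    smul_mul_assoc, Rhat_mul_self hq hq1, singlet_mul_Rhat hq hq1, one_mul, one_mul, mul_one, mul_one]
  -- The total coefficient of the singlet; it vanishes by the closed form of the trace of the
  -- metric.
  have : kappa m q * (1 + q * (q / q ^ m)) + q * ((q - q⁻¹) * (q / q ^ m)) = 0 := by
    rw [kappa]
    have hp : q ^ m ≠ 0 := by positivity
    field_simp at hQ ⊢
    linear_combination -q * hQ
  have e : q * (q - q⁻¹) = q * q - 1 := by field_simp
  have : q • (1 : Matrix (Fin m × Fin m) (Fin m × Fin m) ℝ) + q • q • Rhat m q -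
      (Rhat m q + q • (1 + (q - q⁻¹) • Rhat m q - ((q - q⁻¹) * (q / q ^ m)) • singlet m q)) +
      (kappa m q • singlet m q + q • kappa m q • (q / q ^ m) • singlet m q) =
      (kappa m q * (1 + q * (q / q ^ m)) + q * ((q - q⁻¹) * (q / q ^ m))) • singlet m q := by
    ext a b
    simp only [Matrix.sub_apply, Matrix.add_apply, Matrix.smul_apply, smul_eq_mul]
    linear_combination - (Rhat m q a b) * e
  rw [this, ‹kappa m q * _ + _ = 0›, zero_smul, smul_zero]
end QEuclid

namespace QEuclid

/-! ### Matrices acting on tensors with entries in a module -/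

section act
variable {m : ℕ} {K : Type*} [CommRing K] {M N : Type*} [AddCommGroup M] [Module K M]
  [AddCommGroup N] [Module K N]

/-- The action of a matrix on tensors with two indices. -/
def act (A : Matrix (Fin m × Fin m) (Fin m × Fin m) K) (t : Fin m → Fin m → M) (i j : Fin m) : M :=
  ∑ a, ∑ b, A (i, j) (a, b) • t a b

/-- The action on the first two of three indices. -/
def act12 (A : Matrix (Fin m × Fin m) (Fin m × Fin m) K) (t : Fin m → Fin m → Fin m → M) :
    Fin m → Fin m → Fin m → M := fun i j k => act A (fun a b => t a b k) i j

/-- The action on the last two of three indices. -/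
def act23 (A : Matrix (Fin m × Fin m) (Fin m × Fin m) K) (t : Fin m → Fin m → Fin m → M) :
    Fin m → Fin m → Fin m → M := fun i j k => act A (fun a b => t i a b) j k

variable (A B : Matrix (Fin m × Fin m) (Fin m × Fin m) K)

theorem act_mul (t : Fin m → Fin m → M) (i j : Fin m) :
    act (A * B) t i j = act A (fun a b => act B t a b) i j := by
  simp only [act, Matrix.mul_apply, Fintype.sum_prod_type, Finset.sum_smul, Finset.smul_sum, mul_smul]
  have h : ∀ F : Fin m → Fin m → Fin m → Fin m → M, ∑ a, ∑ b, ∑ c, ∑ d, F a b c d =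
      ∑ c, ∑ d, ∑ a, ∑ b, F a b c d := by
    intro F
    rw [← Fintype.sum_prod_type' (f := fun a b => ∑ c, ∑ d, F a b c d),
      ← Fintype.sum_prod_type' (f := fun c d => ∑ a, ∑ b, F a b c d)]
    have e1 : ∀ p : Fin m × Fin m, ∑ c, ∑ d, F p.1 p.2 c d = ∑ r : Fin m × Fin m, F p.1 p.2 r.1 r.2 :=
      fun p => (Fintype.sum_prod_type' (f := fun c d => F p.1 p.2 c d)).symm
    have e2 : ∀ r : Fin m × Fin m, ∑ a, ∑ b, F a b r.1 r.2 = ∑ p : Fin m × Fin m, F p.1 p.2 r.1 r.2 :=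
      fun r => (Fintype.sum_prod_type' (f := fun a b => F a b r.1 r.2)).symm
    simp only [e1, e2]
    exact Finset.sum_comm
  exact h _

theorem act_one (t : Fin m → Fin m → M) (i j : Fin m) :
    act (1 : Matrix (Fin m × Fin m) (Fin m × Fin m) K) t i j = t i j := by
  rw [act, ← Fintype.sum_prod_type' (f := fun a b =>
    (1 : Matrix (Fin m × Fin m) (Fin m × Fin m) K) (i, j) (a, b) • t a b)]
  simp [Matrix.one_apply]

theorem act_add_left (t : Fin m → Fin m → M) (i j : Fin m) :
    act (A + B) t i j = act A t i j + act B t i j := by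
  simp only [act, Matrix.add_apply, add_smul, Finset.sum_add_distrib]

theorem act_sub_left (t : Fin m → Fin m → M) (i j : Fin m) :
    act (A - B) t i j = act A t i j - act B t i j := by
  simp only [act, Matrix.sub_apply, sub_smul, Finset.sum_sub_distrib]

theorem act_smul_left (c : K) (t : Fin m → Fin m → M) (i j : Fin m) :
    act (c • A) t i j = c • act A t i j := by
  simp only [act, Matrix.smul_apply, smul_assoc, Finset.smul_sum]

theorem act_add (t u : Fin m → Fin m → M) (i j : Fin m) :
    act A (fun a b => t a b + u a b) i j = act A t i j + act A u i j := by
  simp only [act, smul_add, Finset.sum_add_distrib]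

theorem act_sub (t u : Fin m → Fin m → M) (i j : Fin m) :
    act A (fun a b => t a b - u a b) i j = act A t i j - act A u i j := by
  simp only [act, smul_sub, Finset.sum_sub_distrib]

theorem act_smul (c : K) (t : Fin m → Fin m → M) (i j : Fin m) :
    act A (fun a b => c • t a b) i j = c • act A t i j := by
  simp only [act, Finset.smul_sum, smul_comm c]

theorem act_zero (i j : Fin m) : act A (fun _ _ => (0 : M)) i j = 0 := by
  simp [act]

theorem map_act (f : M →ₗ[K] N) (t : Fin m → Fin m → M) (i j : Fin m) :
    f (act A t i j) = act A (fun a b => f (t a b)) i j := by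
  simp only [act, map_sum, map_smul]

end act

/-- A real matrix as a complex one. -/
def toC {ι : Type*} (A : Matrix ι ι ℝ) : Matrix ι ι ℂ := A.map Complex.ofRealHom

theorem toC_apply {ι : Type*} (A : Matrix ι ι ℝ) (i j : ι) : toC A i j = (A i j : ℂ) := rfl

theorem toC_mul {ι : Type*} [Fintype ι] (A B : Matrix ι ι ℝ) :
    toC (A * B) = toC A * toC B := Matrix.map_mul

theorem toC_one {ι : Type*} [DecidableEq ι] : toC (1 : Matrix ι ι ℝ) = 1 :=
  Matrix.map_one _ (map_zero _) (map_one _)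

theorem toC_add {ι : Type*} (A B : Matrix ι ι ℝ) : toC (A + B) = toC A + toC B := by
  ext; simp [toC_apply]

theorem toC_sub {ι : Type*} (A B : Matrix ι ι ℝ) : toC (A - B) = toC A - toC B := by
  ext; simp [toC_apply]

theorem toC_smul {ι : Type*} (c : ℝ) (A : Matrix ι ι ℝ) : toC (c • A) = (c : ℂ) • toC A := by
  ext; simp [toC_apply]

/-! ### Contractions and braidings of tensors with complex entries -/

section complex
variable {m : ℕ} {q : ℝ} {M N : Type*} [AddCommGroup M] [Module ℂ M] [AddCommGroup N] [Module ℂ N]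

/-- The contraction of a tensor with the metric. -/
def contr (m : ℕ) (q : ℝ) (t : Fin m → Fin m → M) : M := ∑ i, ∑ j, (metric m q i j : ℂ) • t i j

theorem contr_add (t u : Fin m → Fin m → M) :
    contr m q (fun a b => t a b + u a b) = contr m q t + contr m q u := by
  simp only [contr, smul_add, Finset.sum_add_distrib]

theorem contr_smul (c : ℂ) (t : Fin m → Fin m → M) :
    contr m q (fun a b => c • t a b) = c • contr m q t := by
  simp only [contr, Finset.smul_sum, smul_comm c]

theorem contr_zero : contr m q (fun _ _ => (0 : M)) = 0 := by simp [contr]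

theorem map_contr (f : M →ₗ[ℂ] N) (t : Fin m → Fin m → M) :
    f (contr m q t) = contr m q (fun a b => f (t a b)) := by
  simp only [contr, map_sum, map_smul]

/-- Vectors of a complex vector space are separated by the real linear functionals. -/
theorem eq_of_forall_functional {u v : M}
    (h : ∀ g : M →+ ℝ, (∀ (r : ℝ) (x : M), g ((r : ℂ) • x) = r * g x) → g u = g v) : u = v := by
  rw [← sub_eq_zero, ← Module.forall_dual_apply_eq_zero_iff ℂ]
  intro f
  rw [map_sub, sub_eq_zero]
  apply Complex.ext
  · exact h (Complex.reAddGroupHom.comp f.toAddMonoidHom) fun r x => by simp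
  · exact h (Complex.imAddGroupHom.comp f.toAddMonoidHom) fun r x => by simp

section functional
variable (g : M →+ ℝ) (hg : ∀ (r : ℝ) (x : M), g ((r : ℂ) • x) = r * g x)
include hg

theorem functional_act (A : Matrix (Fin m × Fin m) (Fin m × Fin m) ℝ) (t : Fin m → Fin m → M)
    (i j : Fin m) : g (act (toC A) t i j) = act A (fun a b => g (t a b)) i j := by
  simp only [act, map_sum, toC_apply, hg, smul_eq_mul]

theorem functional_contr (t : Fin m → Fin m → M) :
    g (contr m q t) = trace2 m q (fun a b => g (t a b)) := by
  simp only [contr, map_sum, hg, trace2_eq]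

end functional

theorem act_Rhat_eq_braid (t : Fin m → Fin m → ℝ) (i j : Fin m) :
    act (Rhat m q) t i j = braid m q t i j := by
  simp only [act, braid, smul_eq_mul]
  exact Finset.sum_congr rfl fun a _ => Finset.sum_congr rfl fun b _ => by
    rw [Rhat_symm, mul_comm]

theorem act_singlet_real (t : Fin m → Fin m → ℝ) (i j : Fin m) :
    act (singlet m q) t i j = metric m q i j * trace2 m q t := by
  simp only [act, singlet, trace2_eq, Finset.mul_sum, smul_eq_mul, mul_assoc]

theorem act_singlet (t : Fin m → Fin m → M) (i j : Fin m) :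
    act (toC (singlet m q)) t i j = (metric m q i j : ℂ) • contr m q t := by
  simp only [act, singlet, toC_apply, contr, Finset.smul_sum, Complex.ofReal_mul, mul_smul]

variable (hq : 0 < q) (hq1 : q < 1)
include hq hq1

theorem act_inv_real (t : Fin m → Fin m → ℝ) (i j : Fin m) :
    act (Rhat m q)⁻¹ t i j =
      braid m q t i j - (q - q⁻¹) * (t i j - metric m q i j * trace2 m q t) := by
  rw [Rhat_inv hq hq1, act_sub_left, act_smul_left, act_sub_left, act_one, act_singlet_real,
    act_Rhat_eq_braid, smul_eq_mul]

/-- The braid matrix moves through the metric. -/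
theorem act_inv_metric_right (v : Fin m → M) (i j k : Fin m) :
    act (toC (Rhat m q)⁻¹) (fun a b => (metric m q b k : ℂ) • v a) i j =
      act (toC (Rhat m q)) (fun a b => (metric m q i a : ℂ) • v b) j k := by
  refine eq_of_forall_functional fun g hg => ?_
  simp only [functional_act g hg, hg, act_inv_real hq hq1, act_Rhat_eq_braid,
    trace2_metric_mul hq, braid_metric_right hq]
  ring

theorem act_metric_right (v : Fin m → M) (i j k : Fin m) :
    act (toC (Rhat m q)) (fun a b => (metric m q b k : ℂ) • v a) i j =
      act (toC (Rhat m q)⁻¹) (fun a b => (metric m q i a : ℂ) • v b) j k := by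
  refine eq_of_forall_functional fun g hg => ?_
  simp only [functional_act g hg, hg, act_inv_real hq hq1, act_Rhat_eq_braid,
    trace2_metric_mul' hq, braid_metric_right hq]
  ring

/-- Sliding a contraction across the free index `k` exchanges R̂ on one side with R̂⁻¹ on the other.
Most computations with ∂, Δ and the Euler operator use this move to cancel an inverse braiding. -/
theorem contr_act_right (t : Fin m → Fin m → Fin m → M) (k : Fin m) :
    contr m q (fun a b => act (toC (Rhat m q)) (fun b' c => t a b' c) b k) =
      contr m q (fun b c => act (toC (Rhat m q)⁻¹) (fun a b' => t a b' c) k b) := by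
  refine eq_of_forall_functional fun g hg => ?_
  simp only [functional_contr g hg, functional_act g hg, act_inv_real hq hq1, act_Rhat_eq_braid,
    trace2_braid_right hq, trace2_sub, trace2_mul, trace2_metric_mul' hq]
  ring

theorem contr_act_inv_right (t : Fin m → Fin m → Fin m → M) (k : Fin m) :
    contr m q (fun a b => act (toC (Rhat m q)⁻¹) (fun b' c => t a b' c) b k) =
      contr m q (fun b c => act (toC (Rhat m q)) (fun a b' => t a b' c) k b) := by
  refine eq_of_forall_functional fun g hg => ?_
  simp only [functional_contr g hg, functional_act g hg, act_inv_real hq hq1, act_Rhat_eq_braid,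
    trace2_braid_right hq, trace2_sub, trace2_mul, trace2_metric_mul hq]
  ring

theorem act_yang_baxter (t : Fin m → Fin m → Fin m → M) :
    act12 (toC (Rhat m q)) (act23 (toC (Rhat m q)) (act12 (toC (Rhat m q)) t)) =
      act23 (toC (Rhat m q)) (act12 (toC (Rhat m q)) (act23 (toC (Rhat m q)) t)) := by
  funext i j k
  refine eq_of_forall_functional fun g hg => ?_
  have := braid_yang_baxter hq hq1 m (fun a b c => g (t a b c)) i j k
  simp only [braid12, braid23] at this
  simp only [act12, act23, functional_act g hg, act_Rhat_eq_braid, this]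

omit hq1 in
theorem contr_metric_mul (v : Fin m → M) (k : Fin m) :
    contr m q (fun a b => (metric m q b k : ℂ) • v a) = v k := by
  refine eq_of_forall_functional fun g hg => ?_
  simp only [functional_contr g hg, hg, trace2_metric_mul hq]

omit hq1 in
theorem contr_metric_mul' (v : Fin m → M) (k : Fin m) :
    contr m q (fun a b => (metric m q k a : ℂ) • v b) = v k := by
  refine eq_of_forall_functional fun g hg => ?_
  simp only [functional_contr g hg, hg, trace2_metric_mul' hq]

omit hq hq1 in
theorem contr_metric (x : M) :
    contr m q (fun a b => (metric m q a b : ℂ) • x) = (metricSq m q : ℂ) • x := by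
  simp only [contr, smul_smul, ← Finset.sum_smul, metricSq]
  push_cast
  rfl

theorem contr_act (t : Fin m → Fin m → M) :
    contr m q (fun a b => act (toC (Rhat m q)) t a b) = ((q / q ^ m : ℝ) : ℂ) • contr m q t := by
  refine eq_of_forall_functional fun g hg => ?_
  have h : ∀ τ : Fin m → Fin m → ℝ, trace2 m q (fun a b => braid m q τ a b) = _ := trace2_braid hq hq1 m
  simp only [functional_contr g hg, hg, functional_act g hg, act_Rhat_eq_braid, h]

theorem act_metric (x : M) (i j : Fin m) :
    act (toC (Rhat m q)) (fun a b => (metric m q a b : ℂ) • x) i j =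
      ((q / q ^ m : ℝ) : ℂ) • (metric m q i j : ℂ) • x := by
  refine eq_of_forall_functional fun g hg => ?_
  have h : braid m q (fun a b => metric m q a b) i j = _ := braid_metric hq hq1 m i j
  have h2 : braid m q (fun a b => metric m q a b * g x) i j =
      g x * (q / q ^ m * metric m q i j) := by
    rw [← h, ← braid_mul]; simp only [mul_comm]
  simp only [hg, functional_act g hg, act_Rhat_eq_braid, h2]
  ring

theorem act_act_inv (t : Fin m → Fin m → M) (i j : Fin m) :
    act (toC (Rhat m q)) (fun a b => act (toC (Rhat m q)⁻¹) t a b) i j = t i j := by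
  rw [← act_mul, ← toC_mul, Rhat_mul_inv hq hq1, toC_one, act_one]

theorem act_inv_act (t : Fin m → Fin m → M) (i j : Fin m) :
    act (toC (Rhat m q)⁻¹) (fun a b => act (toC (Rhat m q)) t a b) i j = t i j := by
  rw [← act_mul, ← toC_mul, Rhat_inv_mul hq hq1, toC_one, act_one]

theorem act_inv_eq (t : Fin m → Fin m → M) (i j : Fin m) :
    act (toC (Rhat m q)⁻¹) t i j = act (toC (Rhat m q)) t i j
      - ((q - q⁻¹ : ℝ) : ℂ) • (t i j - (metric m q i j : ℂ) • contr m q t) := by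
  rw [Rhat_inv hq hq1, toC_sub, act_sub_left, toC_smul, act_smul_left, toC_sub, act_sub_left, toC_one,
    act_one, act_singlet]

omit hq1 in
theorem act_projAntisym (t : Fin m → Fin m → M) (i j : Fin m) :
    act (toC (projAntisym m q)) t i j = (((q + q⁻¹)⁻¹ : ℝ) : ℂ) • ((q : ℂ) • t i j
      - act (toC (Rhat m q)) t i j + (kappa m q : ℂ) • (metric m q i j : ℂ) • contr m q t) := by
  rw [projAntisym_eq hq, toC_smul, act_smul_left, toC_add, act_add_left, toC_sub, act_sub_left,
    toC_smul, act_smul_left, toC_one, act_one, toC_smul, act_smul_left, act_singlet]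

theorem act_projAntisym_eq_zero (hm : 1 ≤ m) (t : Fin m → Fin m → M) (i j : Fin m) :
    act (toC (projAntisym m q)) (fun a b => t a b + (q : ℂ) • act (toC (Rhat m q)) t a b) i j = 0 := by
  have h := congrArg (fun A => act (toC A) t i j) (projAntisym_mul hm hq hq1)
  simp only [toC_mul, act_mul, toC_add, act_add_left, toC_smul, act_smul_left, toC_one, act_one] at h
  rw [h]
  simp [act, toC_apply]

/-- The antisymmetric projection moves through a double braiding. -/
theorem act23_projAntisym (t : Fin m → Fin m → Fin m → M) :
    act23 (toC (projAntisym m q)) (act12 (toC (Rhat m q)⁻¹) (act23 (toC (Rhat m q)⁻¹) t)) =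
      act12 (toC (Rhat m q)⁻¹) (act23 (toC (Rhat m q)⁻¹) (act12 (toC (projAntisym m q)) t)) := by
  -- The Yang–Baxter equation with two factors carried to the other side as inverses.
  have hy : act23 (toC (Rhat m q)) (act12 (toC (Rhat m q)⁻¹) (act23 (toC (Rhat m q)⁻¹) t)) =
      act12 (toC (Rhat m q)⁻¹) (act23 (toC (Rhat m q)⁻¹) (act12 (toC (Rhat m q)) t)) := by
    set u := act12 (toC (Rhat m q)⁻¹) (act23 (toC (Rhat m q)⁻¹) t) with hu
    have ht : t = act23 (toC (Rhat m q)) (act12 (toC (Rhat m q)) u) := by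
      funext i j k
      simp only [hu, act12, act23, act_act_inv hq hq1]
    conv_rhs => rw [ht, act_yang_baxter hq hq1]
    funext i j k
    simp only [act12, act23, act_inv_act hq hq1]
  funext i j k
  have hy' := congrFun (congrFun (congrFun hy i) j) k
  simp only [act12, act23] at hy' ⊢
  -- P_A is a combination of 1, R̂ and the singlet. R̂ passes by `hy`; the contraction and the
  -- metric that make up the singlet pass by `hc` and `hr`.
  have hc : ∀ i, contr m q (fun a b => act (toC (Rhat m q)⁻¹)
      (fun a b' => act (toC (Rhat m q)⁻¹) (fun b' c => t a b' c) b' b) i a) =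
      contr m q (fun a b => t a b i) := by
    intro i
    have := contr_act_right hq hq1 (fun a b c => act (toC (Rhat m q)⁻¹) (fun b' c => t a b' c) b c) i
    simp only [act_act_inv hq hq1] at this
    exact this.symm
  have hr : ∀ v : Fin m → M, act (toC (Rhat m q)⁻¹) (fun a b => act (toC (Rhat m q)⁻¹)
      (fun b' c => (metric m q a b' : ℂ) • v c) b k) i j = (metric m q j k : ℂ) • v i := by
    intro v
    simp only [← act_metric_right hq hq1 v, act_inv_act hq hq1]
  simp only [act_projAntisym hq, hc, hy', act_smul, act_add, act_sub, hr]

theorem act12_projAntisym (t : Fin m → Fin m → Fin m → M) :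
    act12 (toC (projAntisym m q)) (act23 (toC (Rhat m q)⁻¹) (act12 (toC (Rhat m q)⁻¹) t)) =
      act23 (toC (Rhat m q)⁻¹) (act12 (toC (Rhat m q)⁻¹) (act23 (toC (projAntisym m q)) t)) := by
  have hy : act12 (toC (Rhat m q)) (act23 (toC (Rhat m q)⁻¹) (act12 (toC (Rhat m q)⁻¹) t)) =
      act23 (toC (Rhat m q)⁻¹) (act12 (toC (Rhat m q)⁻¹) (act23 (toC (Rhat m q)) t)) := by
    set u := act23 (toC (Rhat m q)⁻¹) (act12 (toC (Rhat m q)⁻¹) t) with hu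
    have ht : t = act12 (toC (Rhat m q)) (act23 (toC (Rhat m q)) u) := by
      funext i j k
      simp only [hu, act12, act23, act_act_inv hq hq1]
    conv_rhs => rw [ht, ← act_yang_baxter hq hq1]
    funext i j k
    simp only [act12, act23, act_inv_act hq hq1]
  funext i j k
  have hy' := congrFun (congrFun (congrFun hy i) j) k
  simp only [act12, act23] at hy' ⊢
  have hc : contr m q (fun a b => act (toC (Rhat m q)⁻¹)
      (fun b' c => act (toC (Rhat m q)⁻¹) (fun a b' => t a b' c) a b') b k) =
      contr m q (fun b c => t k b c) := by
    rw [contr_act_inv_right hq hq1 (fun a b c => act (toC (Rhat m q)⁻¹) (fun a b' => t a b' c) a b) k]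
    simp only [act_act_inv hq hq1]
  have hr : ∀ v : Fin m → M, act (toC (Rhat m q)⁻¹) (fun b c => act (toC (Rhat m q)⁻¹)
      (fun a b' => (metric m q b' c : ℂ) • v a) i b) j k = (metric m q i j : ℂ) • v k := by
    intro v
    simp only [act_inv_metric_right hq hq1 v, act_inv_act hq hq1]
  simp only [act_projAntisym hq, hc, hy', act_smul, act_add, act_sub, hr]

end complex
end QEuclid

namespace QEuclid

/-! ### The quantum Euclidean space and its derivatives -/

section poly
variable {m : ℕ} {q : ℝ}

theorem act_coord_rel (i j : Fin m) :
    act (toC (projAntisym m q)) (fun a b => coord m q a * coord m q b) i j = 0 := by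
  have h := RingQuot.mkAlgHom_rel ℂ (Rel.comm (m := m) (q := q) i j)
  simp only [map_sum, map_smul, map_mul, map_zero] at h
  exact h

theorem poly_induction {S : Submodule ℂ (Poly m q)} (h1 : (1 : Poly m q) ∈ S)
    (hx : ∀ i, ∀ p ∈ S, coord m q i * p ∈ S) (p : Poly m q) : p ∈ S := by
  have key : ∀ (a : FreeAlgebra ℂ (Fin m)), ∀ p ∈ S, RingQuot.mkAlgHom ℂ (Rel m q) a * p ∈ S := by
    intro a
    induction a using FreeAlgebra.induction with
    | grade0 r => intro p hp; rw [AlgHom.commutes, ← Algebra.smul_def]; exact S.smul_mem r hp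
    | grade1 i => exact hx i
    | mul a b ha hb => intro p hp; rw [map_mul, mul_assoc]; exact ha _ (hb _ hp)
    | add a b ha hb => intro p hp; rw [map_add, add_mul]; exact S.add_mem (ha _ hp) (hb _ hp)
  obtain ⟨a, rfl⟩ := RingQuot.mkAlgHom_surjective ℂ (Rel m q) p
  simpa using key a 1 h1

/-- The operator by which a coordinate acts on the jets `(p, ∂p)`. -/
def jetMul (m : ℕ) (q : ℝ) (j : Fin m) :
    Module.End ℂ (Poly m q × (Fin m → Poly m q)) where
  toFun p := (coord m q j * p.1, fun i => (metric m q i j : ℂ) • p.1 +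
    (q : ℂ) • act (toC (Rhat m q)⁻¹) (fun k l => coord m q k * p.2 l) i j)
  map_add' p r := by
    refine Prod.ext (mul_add _ _ _) (funext fun i => ?_)
    simp only [Prod.fst_add, Prod.snd_add, Pi.add_apply, mul_add, act_add, smul_add]
    abel
  map_smul' c p := by
    refine Prod.ext (mul_smul_comm _ _ _) (funext fun i => ?_)
    simp only [Prod.smul_fst, Prod.smul_snd, Pi.smul_apply, mul_smul_comm, act_smul, smul_add,
      RingHom.id_apply]
    rw [smul_comm c, smul_comm c]

variable (hm : 1 ≤ m) (hq : 0 < q) (hq1 : q < 1)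
include hm hq hq1

/-- The tensor of the second order terms of `∂^i (x^j x^k p)` is killed by the relations. -/
theorem act_projAntisym_jet (p : Poly m q) (d : Fin m → Poly m q) (i a b : Fin m) :
    act (toC (projAntisym m q)) (fun j k => (metric m q i j : ℂ) • (coord m q k * p) +
      (q : ℂ) • act (toC (Rhat m q)⁻¹) (fun c e => coord m q c * ((metric m q e k : ℂ) • p +
        (q : ℂ) • act (toC (Rhat m q)⁻¹) (fun k l => coord m q k * d l) e k)) i j) a b = 0 := by
  -- Pulling the metric through turns the two first-order terms into (1 + q R̂) applied to one
  -- tensor, which P_A kills in `h4`.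
  have h1 : ∀ j k, act (toC (Rhat m q)⁻¹) (fun c e => (metric m q e k : ℂ) • (coord m q c * p)) i j =
      act (toC (Rhat m q)) (fun a b => (metric m q i a : ℂ) • (coord m q b * p)) j k :=
    fun j k => act_inv_metric_right hq hq1 (fun c => coord m q c * p) i j k
  have h2 : ∀ j k c, act (toC (Rhat m q)⁻¹) (fun a b => coord m q c * (coord m q a * d b)) j k =
      coord m q c * act (toC (Rhat m q)⁻¹) (fun a b => coord m q a * d b) j k := fun j k c =>
    (map_act _ (LinearMap.mulLeft ℂ (coord m q c)) (fun a b => coord m q a * d b) j k).symm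
  -- In the second-order term P_A passes the two inverse braidings and lands on a product of two
  -- coordinates, where it is a defining relation.
  have h3 : act (toC (projAntisym m q)) (fun j k => act (toC (Rhat m q)⁻¹) (fun c e =>
      act (toC (Rhat m q)⁻¹) (fun k l => coord m q c * (coord m q k * d l)) e k) i j) a b = 0 := by
    have := congrFun (congrFun (congrFun (act23_projAntisym hq hq1
      (fun c k l => coord m q c * (coord m q k * d l))) i) a) b
    simp only [act12, act23] at this
    rw [this]
    have h0 : ∀ c k l, act (toC (projAntisym m q)) (fun a b => coord m q a * (coord m q b * d l)) c k =
        0 := by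
      intro c k l
      have := (map_act (toC (projAntisym m q)) (LinearMap.mulRight ℂ (d l))
        (fun a b => coord m q a * coord m q b) c k).symm
      simp only [LinearMap.mulRight_apply, act_coord_rel, zero_mul, mul_assoc] at this
      exact this
    simp only [h0, act_zero]
  have h4 := act_projAntisym_eq_zero hq hq1 hm
    (fun j k => (metric m q i j : ℂ) • (coord m q k * p)) a b
  simp only [mul_add, mul_smul_comm, act_add, act_smul, smul_add, h1, ← h2] at h4 ⊢
  rw [h3, smul_zero, smul_zero, add_zero]
  exact h4

/-- The Leibniz rule says how a coordinate acts on pairs (p, ∂p). These operators obey the relations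
of the coordinates, hence extend to a representation of the whole algebra, and applying p to (1, 0)
must give (p, ∂p). -/
theorem exists_isPartial : ∃ D, IsPartial m q D := by
  let Θ : Poly m q →ₐ[ℂ] Module.End ℂ (Poly m q × (Fin m → Poly m q)) :=
    RingQuot.liftAlgHom ℂ ⟨FreeAlgebra.lift ℂ (jetMul m q), by
      rintro _ _ ⟨i, j⟩
      simp only [map_sum, map_smul, map_mul, FreeAlgebra.lift_ι_apply, map_zero]
      refine LinearMap.ext fun p => ?_
      simp only [LinearMap.sum_apply, LinearMap.smul_apply, Module.End.mul_apply,
        LinearMap.zero_apply]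
      refine Prod.ext ?_ (funext fun n => ?_)
      · simp only [Prod.fst_sum, Prod.smul_fst, Prod.fst_zero]
        have := (map_act (toC (projAntisym m q)) (LinearMap.mulRight ℂ p.1)
          (fun a b => coord m q a * coord m q b) i j).symm
        simp only [LinearMap.mulRight_apply, act_coord_rel, zero_mul, mul_assoc] at this
        exact this
      · simp only [Prod.snd_sum, Prod.smul_snd, Prod.snd_zero, Finset.sum_apply, Pi.smul_apply]
        exact act_projAntisym_jet hm hq hq1 p.1 p.2 n i j⟩
  have hΘ : ∀ j, Θ (coord m q j) = jetMul m q j := fun j => by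
    simp only [Θ, coord]
    rw [RingQuot.liftAlgHom_mkAlgHom_apply, FreeAlgebra.lift_ι_apply]
  -- The first slot recovers the polynomial itself, so the recursion for the second slot is the
  -- Leibniz rule with the right `p` in its metric term.
  have hfst : ∀ p, (Θ p (1, 0)).1 = p := by
    intro p
    have : p ∈ LinearMap.ker (((LinearMap.fst ℂ _ _ ∘ₗ LinearMap.applyₗ
      ((1, 0) : Poly m q × (Fin m → Poly m q))) ∘ₗ Θ.toLinearMap) - LinearMap.id) := by
      refine poly_induction ?_ ?_ p
      · simp [LinearMap.mem_ker]
      · intro i p hp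
        rw [LinearMap.mem_ker] at hp ⊢
        simp only [LinearMap.sub_apply, LinearMap.comp_apply, AlgHom.toLinearMap_apply,
          LinearMap.applyₗ_apply_apply, LinearMap.fst_apply, LinearMap.id_apply, sub_eq_zero,
          map_mul, hΘ, Module.End.mul_apply] at hp ⊢
        simp [jetMul, hp]
    rw [LinearMap.mem_ker] at this
    simpa [sub_eq_zero] using this
  refine ⟨fun i => (LinearMap.proj i ∘ₗ LinearMap.snd ℂ _ _ ∘ₗ LinearMap.applyₗ
      ((1, 0) : Poly m q × (Fin m → Poly m q))) ∘ₗ Θ.toLinearMap, fun i => ?_, fun i j p => ?_⟩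
  · simp
  · simp only [LinearMap.comp_apply, AlgHom.toLinearMap_apply, LinearMap.applyₗ_apply_apply,
      LinearMap.snd_apply, LinearMap.proj_apply, map_mul, hΘ, Module.End.mul_apply]
    simp only [jetMul, LinearMap.coe_mk, AddHom.coe_mk, hfst, act, toC_apply, Finset.smul_sum,
      Complex.ofReal_mul, mul_smul]

theorem isPartial_partialD : IsPartial m q (partialD m q) :=
  Classical.epsilon_spec (exists_isPartial hm hq hq1)

theorem partialD_one (i : Fin m) : partialD m q i 1 = 0 := (isPartial_partialD hm hq hq1).1 i

theorem partialD_coord_mul (i j : Fin m) (p : Poly m q) :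
    partialD m q i (coord m q j * p) = (metric m q i j : ℂ) • p +
      (q : ℂ) • act (toC (Rhat m q)⁻¹) (fun k l => coord m q k * partialD m q l p) i j := by
  rw [(isPartial_partialD hm hq hq1).2 i j p]
  simp only [act, toC_apply, Finset.smul_sum, Complex.ofReal_mul, mul_smul]

end poly
end QEuclid

namespace QEuclid

/-! ### Symmetric tensors -/

section closed
variable {m : ℕ} {q : ℝ} {M : Type*} [AddCommGroup M] [Module ℂ M]

/-- On a symmetric tensor, one killed by P_A, the braiding is the scalar q up to a trace term with
coefficient κ. If the trace vanishes, only the scalar is left. -/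
theorem act_of_closed (hq : 0 < q) {t : Fin m → Fin m → M} {i j : Fin m}
    (ht : act (toC (projAntisym m q)) t i j = 0) :
    act (toC (Rhat m q)) t i j =
      (q : ℂ) • t i j + (kappa m q : ℂ) • (metric m q i j : ℂ) • contr m q t := by
  rw [act_projAntisym hq, smul_eq_zero] at ht
  have h0 : (((q + q⁻¹)⁻¹ : ℝ) : ℂ) ≠ 0 := by
    rw [Complex.ofReal_ne_zero]; positivity
  linear_combination (norm := module) (-1 : ℂ) • ht.resolve_left h0

theorem act_inv_of_closed (hq : 0 < q) (hq1 : q < 1) {t : Fin m → Fin m → M} {i j : Fin m}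
    (ht : act (toC (projAntisym m q)) t i j = 0) :
    act (toC (Rhat m q)⁻¹) t i j = ((q⁻¹ : ℝ) : ℂ) • t i j +
      ((kappa m q + (q - q⁻¹) : ℝ) : ℂ) • (metric m q i j : ℂ) • contr m q t := by
  rw [act_inv_eq hq hq1, act_of_closed hq ht]
  push_cast
  module

/-- Keeps `q⁻¹ - kappa m q` invertible; this factor has to be cancelled in comparing the two traces
of a symmetric tensor. -/
theorem kappa_lt {q : ℝ} (hm : 1 ≤ m) (hq : 0 < q) (hq1 : q < 1) : kappa m q < q⁻¹ := by
  have hQ := metricSq_mul hq m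
  have hQ0 := metricSq_pos hm hq
  have hp : 0 < q ^ m := by positivity
  have hp1 : q ^ m < 1 := pow_lt_one₀ hq.le hq1 (by omega)
  have hq2 : 0 < 1 - q ^ 2 := by nlinarith
  rw [kappa, div_lt_iff₀ hQ0, ← mul_lt_mul_iff_left₀ hq2, mul_assoc, hQ]
  field_simp
  have : 0 < q ^ m + q ^ 2 - q ^ 2 * (1 - q ^ 2) := by nlinarith [sq_nonneg q, sq_nonneg (q ^ 2)]
  nlinarith [mul_pos (sub_pos.2 hp1) this]

/-- The two traces of a totally symmetric tensor with three indices agree. -/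
theorem contr_left_eq_contr_right (hm : 1 ≤ m) (hq : 0 < q) (hq1 : q < 1)
    {t : Fin m → Fin m → Fin m → M}
    (h12 : ∀ i j k, act (toC (projAntisym m q)) (fun a b => t a b k) i j = 0)
    (h23 : ∀ i j k, act (toC (projAntisym m q)) (fun a b => t i a b) j k = 0) (k : Fin m) :
    contr m q (fun a b => t a b k) = contr m q (fun a b => t k a b) := by
  have h := contr_act_right hq hq1 t k
  have e1 : ∀ a b, act (toC (Rhat m q)) (fun b' c => t a b' c) b k = _ :=
    fun a b => act_of_closed hq (h23 a b k)
  have e2 : ∀ b c, act (toC (Rhat m q)⁻¹) (fun a b' => t a b' c) k b = _ :=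
    fun b c => act_inv_of_closed hq hq1 (h12 k b c)
  simp only [e1, e2, contr_add, contr_smul,
    contr_metric_mul hq (fun a => contr m q fun b c => t a b c),
    contr_metric_mul' hq (fun c => contr m q fun a b => t a b c)] at h
  -- With L and R the left and right traces, the slid contraction reads q L + κ R = q⁻¹ R + (κ + q -
  -- q⁻¹) L.
  have h3 : ((q⁻¹ - kappa m q : ℝ) : ℂ) • (contr m q (fun a b => t a b k) -
      contr m q (fun a b => t k a b)) = 0 := by
    push_cast at h ⊢
    linear_combination (norm := module) h
  rw [smul_eq_zero, Complex.ofReal_eq_zero] at h3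
  exact sub_eq_zero.1 (h3.resolve_left (sub_pos.2 (kappa_lt hm hq hq1)).ne')

end closed
end QEuclid

namespace QEuclid

/-! ### Relations between the norm squared, the derivatives and the Laplacian -/

section relations
variable {m : ℕ} {q : ℝ}

theorem normSq_eq_contr : normSq m q = contr m q (fun a b => coord m q a * coord m q b) := rfl

theorem normSq_mul (p : Poly m q) :
    normSq m q * p = contr m q (fun a b => coord m q a * (coord m q b * p)) := by
  have := map_contr (m := m) (q := q) (LinearMap.mulRight ℂ p) (fun a b => coord m q a * coord m q b)
  simp only [LinearMap.mulRight_apply, mul_assoc] at this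
  exact this

theorem laplace_apply (p : Poly m q) :
    laplace m q p = contr m q (fun a b => partialD m q a (partialD m q b p)) := by
  simp only [laplace, contr, LinearMap.sum_apply, LinearMap.smul_apply, LinearMap.comp_apply]

theorem act_coord_mul_coord_mul (p : Poly m q) (i j : Fin m) :
    act (toC (projAntisym m q)) (fun a b => coord m q a * (coord m q b * p)) i j = 0 := by
  have := (map_act (toC (projAntisym m q)) (LinearMap.mulRight ℂ p)
    (fun a b => coord m q a * coord m q b) i j).symm
  simp only [LinearMap.mulRight_apply, act_coord_rel, zero_mul, mul_assoc] at this
  exact this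

theorem mul_act (A : Matrix (Fin m × Fin m) (Fin m × Fin m) ℂ) (x : Poly m q)
    (t : Fin m → Fin m → Poly m q) (i j : Fin m) :
    x * act A t i j = act A (fun a b => x * t a b) i j :=
  map_act A (LinearMap.mulLeft ℂ x) t i j

theorem mul_contr (x : Poly m q) (t : Fin m → Fin m → Poly m q) :
    x * contr m q t = contr m q (fun a b => x * t a b) :=
  map_contr (LinearMap.mulLeft ℂ x) t

theorem mu_eq (hq : 0 < q) : mu m q = 1 + q * (q / q ^ m) := by
  rw [mu, zpow_sub₀ hq.ne', zpow_natCast]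
  norm_cast
  ring

theorem mu_pos (hq : 0 < q) : 0 < mu m q := by
  rw [mu_eq hq]; positivity

variable (hm : 1 ≤ m) (hq : 0 < q) (hq1 : q < 1)
include hm hq hq1

/-- The tensor x ⊗ x ⊗ x is symmetric in both neighbouring pairs, and its two traces are 𝐱² x and x
𝐱². -/
theorem coord_mul_normSq (i : Fin m) :
    coord m q i * normSq m q = normSq m q * coord m q i := by
  have h := contr_left_eq_contr_right hm hq hq1
    (t := fun a b c => coord m q a * (coord m q b * coord m q c))
    (fun i j k => act_coord_mul_coord_mul _ i j)
    (fun i j k => by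
      have := mul_act (toC (projAntisym m q)) (coord m q i)
        (fun b c => coord m q b * coord m q c) j k
      rw [act_coord_rel, mul_zero] at this
      exact this.symm) i
  rw [normSq_mul, h, normSq_eq_contr, mul_contr]

theorem mul_normSq (p : Poly m q) : p * normSq m q = normSq m q * p := by
  have : p ∈ LinearMap.ker (LinearMap.mulRight ℂ (normSq m q) - LinearMap.mulLeft ℂ (normSq m q)) := by
    refine poly_induction ?_ ?_ p
    · simp [LinearMap.mem_ker]
    · intro i p hp
      simp only [LinearMap.mem_ker, LinearMap.sub_apply, LinearMap.mulRight_apply,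
        LinearMap.mulLeft_apply, sub_eq_zero] at hp ⊢
      rw [mul_assoc, hp, ← mul_assoc, coord_mul_normSq hm hq hq1, mul_assoc]
  simpa only [LinearMap.mem_ker, LinearMap.sub_apply, LinearMap.mulRight_apply,
        LinearMap.mulLeft_apply, sub_eq_zero] using this

theorem commute_normSq (p : Poly m q) : Commute (normSq m q) p := (mul_normSq hm hq hq1 p).symm

/-- The two first-order terms contribute 1 and q · q^(1-m), whose sum is μ. In the second-order term
the contraction slides the outer R̂⁻¹ into an R̂ that undoes the inner R̂⁻¹, leaving q². -/
theorem partialD_normSq_mul (i : Fin m) (p : Poly m q) :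
    partialD m q i (normSq m q * p) = (mu m q : ℂ) • (coord m q i * p) +
      (q : ℂ) ^ 2 • (normSq m q * partialD m q i p) := by
  rw [normSq_mul, map_contr]
  simp only [partialD_coord_mul hm hq hq1, contr_add, contr_smul, mul_add, mul_smul_comm, act_add,
    act_smul, mul_act]
  rw [contr_metric_mul' hq (fun b => coord m q b * p),
    ← contr_act_right hq hq1 (fun a b c => (metric m q b c : ℂ) • (coord m q a * p)),
    ← contr_act_right hq hq1 (fun a b c => act (toC (Rhat m q)⁻¹)
      (fun k l => coord m q a * (coord m q k * partialD m q l p)) b c)]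
  simp only [act_act_inv hq hq1, act_metric hq hq1, contr_smul]
  rw [contr_metric_mul hq (fun a => coord m q a * p), ← normSq_mul, mu_eq hq]
  push_cast
  module

theorem partialD_partialD_coord_mul (i j k : Fin m) (p : Poly m q) :
    partialD m q i (partialD m q j (coord m q k * p)) =
      ((metric m q j k : ℂ) • partialD m q i p + (q : ℂ) •
        act (toC (Rhat m q)⁻¹) (fun a b => (metric m q i a : ℂ) • partialD m q b p) j k) +
      (q : ℂ) ^ 2 • act (toC (Rhat m q)⁻¹) (fun a b => act (toC (Rhat m q)⁻¹)
        (fun c d => coord m q c * partialD m q d (partialD m q b p)) i a) j k := by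
  simp only [partialD_coord_mul hm hq hq1, map_add, map_smul, map_act, act_add, act_smul]
  module

/-- The derivatives satisfy the relations of the coordinates. -/
theorem act_partialD_partialD (p : Poly m q) (i j : Fin m) :
    act (toC (projAntisym m q)) (fun a b => partialD m q a (partialD m q b p)) i j = 0 := by
  have : p ∈ ⨅ i, ⨅ j, LinearMap.ker (act (M := Poly m q →ₗ[ℂ] Poly m q) (toC (projAntisym m q))
      (fun a b => partialD m q a ∘ₗ partialD m q b) i j) := by
    refine poly_induction ?_ ?_ p
    · simp only [Submodule.mem_iInf, LinearMap.mem_ker, act, LinearMap.sum_apply,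
        LinearMap.smul_apply, LinearMap.comp_apply, partialD_one hm hq hq1, map_zero, smul_zero,
        Finset.sum_const_zero, implies_true]
    · intro k p hp
      simp only [Submodule.mem_iInf, LinearMap.mem_ker, act, LinearMap.sum_apply,
        LinearMap.smul_apply, LinearMap.comp_apply] at hp ⊢
      intro i j
      change ∀ i j, act (toC (projAntisym m q)) (fun a b => partialD m q a (partialD m q b p)) i j =
        0 at hp
      change act (toC (projAntisym m q)) (fun a b => partialD m q a (partialD m q b
        (coord m q k * p))) i j = 0
      -- As for the coordinates: the first-order terms take the form (1 + q R̂), and in the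
      -- second-order term P_A passes the double braiding and meets the induction hypothesis (`e2`).
      have e1 := fun i j => act_metric_right hq hq1 (fun a => partialD m q a p) i j k
      have e2 := congrFun (congrFun (congrFun (act12_projAntisym hq hq1
        (fun c d b => coord m q c * partialD m q d (partialD m q b p))) i) j) k
      simp only [act12, act23, ← mul_act, hp, mul_zero, act_zero] at e2
      simp only [partialD_partialD_coord_mul hm hq hq1, act_add, act_smul, ← e1] at e2 ⊢
      have e3 := act_projAntisym_eq_zero hq hq1 hm
        (fun a b => (metric m q b k : ℂ) • partialD m q a p) i j
      simp only [act_add, act_smul] at e3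
      rw [e2, smul_zero, add_zero]
      exact e3
  simp only [Submodule.mem_iInf, LinearMap.mem_ker, act, LinearMap.sum_apply,
        LinearMap.smul_apply, LinearMap.comp_apply] at this
  exact this i j

theorem laplace_coord_mul (i : Fin m) (p : Poly m q) :
    laplace m q (coord m q i * p) = (mu m q : ℂ) • partialD m q i p +
      (q : ℂ) ^ 2 • (coord m q i * laplace m q p) := by
  rw [laplace_apply, laplace_apply]
  simp only [partialD_partialD_coord_mul hm hq hq1, contr_add, contr_smul]
  rw [contr_metric_mul hq (fun a => partialD m q a p),
    contr_act_inv_right hq hq1 (fun a b c => (metric m q a b : ℂ) • partialD m q c p),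
    contr_act_inv_right hq hq1 (fun a b c => act (toC (Rhat m q)⁻¹)
      (fun d e => coord m q d * partialD m q e (partialD m q c p)) a b)]
  simp only [act_act_inv hq hq1, act_metric hq hq1, contr_smul]
  rw [contr_metric_mul' hq (fun a => partialD m q a p), mul_contr, mu_eq hq]
  push_cast
  module

theorem partialD_laplace (i : Fin m) (p : Poly m q) :
    partialD m q i (laplace m q p) = laplace m q (partialD m q i p) := by
  have h := contr_left_eq_contr_right hm hq hq1
    (t := fun a b c => partialD m q a (partialD m q b (partialD m q c p)))
    (fun i j k => act_partialD_partialD hm hq hq1 _ i j)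
    (fun i j k => by
      have := map_act (toC (projAntisym m q)) (partialD m q i)
        (fun b c => partialD m q b (partialD m q c p)) j k
      rw [act_partialD_partialD hm hq hq1, map_zero] at this
      exact this.symm) i
  rw [laplace_apply, laplace_apply, map_contr, h]

/-! ### The Euler operator -/

omit hm hq hq1 in
variable (m q) in
/-- The Euler operator `x^a C_{ab} ∂^b`. -/
def euler : Poly m q →ₗ[ℂ] Poly m q :=
  contr m q (fun a b => LinearMap.mulLeft ℂ (coord m q a) ∘ₗ partialD m q b)

omit hm hq hq1 in
theorem euler_apply (p : Poly m q) :
    euler m q p = contr m q (fun a b => coord m q a * partialD m q b p) := by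
  simp only [euler, contr, LinearMap.sum_apply, LinearMap.smul_apply, LinearMap.comp_apply,
    LinearMap.mulLeft_apply]

theorem euler_coord_mul (i : Fin m) (p : Poly m q) :
    euler m q (coord m q i * p) = coord m q i * p + (q : ℂ) ^ 2 • (coord m q i * euler m q p) +
      ((q * kappa m q : ℝ) : ℂ) • (normSq m q * partialD m q i p) := by
  rw [euler_apply]
  simp only [partialD_coord_mul hm hq hq1, contr_add, contr_smul, mul_add, mul_smul_comm, mul_act]
  rw [contr_metric_mul hq (fun a => coord m q a * p),
    contr_act_inv_right hq hq1 (fun a b c => coord m q a * (coord m q b * partialD m q c p))]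
  simp only [fun c j => act_of_closed hq (act_coord_mul_coord_mul (partialD m q c p) i j),
    contr_add, contr_smul, ← normSq_mul]
  rw [contr_metric_mul' hq (fun c => normSq m q * partialD m q c p), euler_apply, mul_contr]
  push_cast
  module

/-- The operator `1 + (q² - 1) E + c 𝐱² Δ` which multiplies the coordinates by `q²`. -/
theorem dilation (k : ℕ) {p : Poly m q} (hp : p ∈ homog m q k) :
    p + ((q : ℂ) ^ 2 - 1) • euler m q p + (((1 - q ^ 2) * (q * kappa m q) / mu m q : ℝ) : ℂ) •
      (normSq m q * laplace m q p) = (q : ℂ) ^ (2 * k) • p := by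
  set c : ℂ := (((1 - q ^ 2) * (q * kappa m q) / mu m q : ℝ) : ℂ) with hc
  -- `c` is the value at which the terms 𝐱² ∂ produced by the Euler operator and by the Laplacian
  -- cancel.
  have hcm : c * (mu m q : ℂ) = (1 - (q : ℂ) ^ 2) * ((q * kappa m q : ℝ) : ℂ) := by
    have := (mu_pos (m := m) hq).ne'
    rw [hc]; push_cast
    have h : (mu m q : ℂ) ≠ 0 := by exact_mod_cast this
    field_simp
  induction k generalizing p with
  | zero =>
    rw [homog, pow_zero, Submodule.mem_one] at hp
    obtain ⟨r, rfl⟩ := hp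
    have h1 : ∀ i, partialD m q i (algebraMap ℂ _ r) = 0 := fun i => by
      rw [Algebra.algebraMap_eq_smul_one, map_smul, partialD_one hm hq hq1, smul_zero]
    rw [euler_apply, laplace_apply]
    simp [h1, contr_zero]
  | succ k ih =>
    have : homog m q (k + 1) ≤ LinearMap.ker (LinearMap.id + ((q : ℂ) ^ 2 - 1) • euler m q +
        c • (LinearMap.mulLeft ℂ (normSq m q) ∘ₗ laplace m q) -
        (q : ℂ) ^ (2 * (k + 1)) • LinearMap.id) := by
      rw [homog, pow_succ', Submodule.mul_le]
      intro x hx p hp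
      induction hx using Submodule.span_induction with
      | mem x hx =>
        obtain ⟨i, rfl⟩ := hx
        have h := ih hp
        rw [LinearMap.mem_ker]
        simp only [LinearMap.sub_apply, LinearMap.add_apply, LinearMap.smul_apply, LinearMap.id_apply,
          LinearMap.comp_apply, LinearMap.mulLeft_apply, euler_coord_mul hm hq hq1,
          laplace_coord_mul hm hq hq1]
        have h' := congrArg (fun y => (q : ℂ) ^ 2 • (coord m q i * y)) h
        simp only [mul_add, mul_smul_comm, ← mul_assoc, coord_mul_normSq hm hq hq1] at h' ⊢
        have h2 := congrArg (fun z : ℂ => z • (normSq m q * partialD m q i p)) hcm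
        simp only [mul_smul, mul_assoc] at h' h2 ⊢
        linear_combination (norm := module) h' + h2
      | zero => simp
      | add x y _ _ hx hy => rw [add_mul]; exact Submodule.add_mem _ hx hy
      | smul r x _ hx => rw [smul_mul_assoc]; exact Submodule.smul_mem _ _ hx
    have := this hp
    simp only [LinearMap.mem_ker, LinearMap.sub_apply, LinearMap.add_apply, LinearMap.smul_apply,
      LinearMap.id_apply, LinearMap.comp_apply, LinearMap.mulLeft_apply, sub_eq_zero] at this
    exact this

end relations
end QEuclid

namespace QEuclid

/-! ### `q`-numbers -/

section qnum
variable {q : ℝ}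

theorem qNum_natCast (n : ℕ) : qNum q n = (q ^ n - 1) / (q - 1) := by
  rw [qNum, Real.rpow_natCast]

theorem qNum_zero : qNum q 0 = 0 := by simp [qNum]

theorem qNum_one (hq1 : q ≠ 1) : qNum q 1 = 1 := by
  rw [qNum, Real.rpow_one, div_self (sub_ne_zero.2 hq1)]

theorem qNum_add_one (hq : 0 < q) (hq1 : q ≠ 1) (u : ℝ) : qNum q (u + 1) = 1 + q * qNum q u := by
  have : q - 1 ≠ 0 := sub_ne_zero.2 hq1
  rw [qNum, qNum, Real.rpow_add hq, Real.rpow_one]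
  field_simp
  ring

theorem qNum_add_one' (hq : 0 < q) (hq1 : q ≠ 1) (u : ℝ) : qNum q (u + 1) = qNum q u + q ^ u := by
  have : q - 1 ≠ 0 := sub_ne_zero.2 hq1
  rw [qNum, qNum, Real.rpow_add hq, Real.rpow_one]
  field_simp
  ring

theorem qNum_pos (hq : 0 < q) (hq1 : q < 1) {u : ℝ} (hu : 0 < u) : 0 < qNum q u := by
  rw [qNum]
  exact div_pos_of_neg_of_neg (sub_neg.2 (Real.rpow_lt_one hq.le hq1 hu)) (sub_neg.2 hq1)

theorem qFactorial_succ (n : ℕ) : qFactorial q (n + 1) = qFactorial q n * qNum q (n + 1) := by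
  rw [qFactorial, Finset.prod_range_succ]; rfl

theorem qFactorial_zero : qFactorial q 0 = 1 := by simp [qFactorial]

theorem qFactorial_pos (hq : 0 < q) (hq1 : q < 1) (n : ℕ) : 0 < qFactorial q n :=
  Finset.prod_pos fun i _ => qNum_pos hq hq1 (by positivity)

end qnum

/-! ### Degrees -/

section degree
variable {m : ℕ} {q : ℝ}

theorem homog_succ_le {k : ℕ} {S : Submodule ℂ (Poly m q)}
    (h : ∀ i, ∀ p ∈ homog m q k, coord m q i * p ∈ S) : homog m q (k + 1) ≤ S := by
  rw [homog, pow_succ', Submodule.mul_le]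
  intro x hx p hp
  induction hx using Submodule.span_induction with
  | mem x hx => obtain ⟨i, rfl⟩ := hx; exact h i p hp
  | zero => simp
  | add x y _ _ hx hy => rw [add_mul]; exact Submodule.add_mem _ hx hy
  | smul r x _ hx => rw [smul_mul_assoc]; exact Submodule.smul_mem _ _ hx

theorem one_mem_homog : (1 : Poly m q) ∈ homog m q 0 := by
  rw [homog, pow_zero]; exact Submodule.one_le.1 le_rfl

theorem coord_mem_homog (i : Fin m) : coord m q i ∈ homog m q 1 := by
  rw [homog, pow_one]; exact Submodule.subset_span ⟨i, rfl⟩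

theorem mul_mem_homog {k l : ℕ} {p r : Poly m q} (hp : p ∈ homog m q k) (hr : r ∈ homog m q l) :
    p * r ∈ homog m q (k + l) := by
  rw [homog, pow_add]; exact Submodule.mul_mem_mul hp hr

theorem coord_mul_mem_homog {k : ℕ} (i : Fin m) {p : Poly m q} (hp : p ∈ homog m q k) :
    coord m q i * p ∈ homog m q (k + 1) := by
  rw [add_comm]; exact mul_mem_homog (coord_mem_homog i) hp

theorem mem_homog_zero {p : Poly m q} (hp : p ∈ homog m q 0) :
    ∃ r : ℂ, algebraMap ℂ (Poly m q) r = p := by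
  rwa [homog, pow_zero, Submodule.mem_one] at hp

theorem contr_mem {S : Submodule ℂ (Poly m q)} {t : Fin m → Fin m → Poly m q}
    (h : ∀ i j, t i j ∈ S) : contr m q t ∈ S :=
  S.sum_mem fun _ _ => S.sum_mem fun _ _ => S.smul_mem _ (h _ _)

theorem act_mem {S : Submodule ℂ (Poly m q)} {t : Fin m → Fin m → Poly m q}
    (A : Matrix (Fin m × Fin m) (Fin m × Fin m) ℂ) (h : ∀ i j, t i j ∈ S) (i j : Fin m) :
    act A t i j ∈ S :=
  S.sum_mem fun _ _ => S.sum_mem fun _ _ => S.smul_mem _ (h _ _)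

theorem normSq_mem_homog : normSq m q ∈ homog m q 2 :=
  contr_mem fun i j => mul_mem_homog (coord_mem_homog i) (coord_mem_homog j)

theorem normSq_pow_mem_homog (n : ℕ) : normSq m q ^ n ∈ homog m q (2 * n) := by
  rw [homog, pow_mul]; exact Submodule.pow_mem_pow _ normSq_mem_homog n

theorem evalZero_coord_mul (i : Fin m) (p : Poly m q) : evalZero m q (coord m q i * p) = 0 := by
  rw [map_mul, coord, evalZero, RingQuot.liftAlgHom_mkAlgHom_apply, FreeAlgebra.lift_ι_apply, zero_mul]

theorem evalZero_homog_succ {k : ℕ} {p : Poly m q} (hp : p ∈ homog m q (k + 1)) :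
    evalZero m q p = 0 := by
  have : homog m q (k + 1) ≤ LinearMap.ker (evalZero m q).toLinearMap :=
    homog_succ_le fun i p _ => evalZero_coord_mul i p
  exact this hp

variable (hm : 1 ≤ m) (hq : 0 < q) (hq1 : q < 1)
include hm hq hq1

theorem partialD_homog_zero {p : Poly m q} (hp : p ∈ homog m q 0) (i : Fin m) :
    partialD m q i p = 0 := by
  obtain ⟨r, rfl⟩ := mem_homog_zero hp
  rw [Algebra.algebraMap_eq_smul_one, map_smul, partialD_one hm hq hq1, smul_zero]

theorem partialD_mem_homog {k : ℕ} {p : Poly m q} (hp : p ∈ homog m q (k + 1)) (i : Fin m) :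
    partialD m q i p ∈ homog m q k := by
  induction k generalizing p i with
  | zero =>
    refine (homog_succ_le (S := (homog m q 0).comap (partialD m q i)) fun j p hp => ?_) hp
    rw [Submodule.mem_comap, partialD_coord_mul hm hq hq1]
    simp only [partialD_homog_zero hm hq hq1 hp, mul_zero, act_zero, smul_zero, add_zero]
    exact Submodule.smul_mem _ _ hp
  | succ k ih =>
    refine (homog_succ_le (S := (homog m q (k + 1)).comap (partialD m q i)) fun j p hp => ?_) hp
    rw [Submodule.mem_comap, partialD_coord_mul hm hq hq1]
    exact Submodule.add_mem _ (Submodule.smul_mem _ _ hp) (Submodule.smul_mem _ _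
      (act_mem _ (fun a b => coord_mul_mem_homog a (ih hp b)) _ _))

theorem laplace_mem_homog {k : ℕ} {p : Poly m q} (hp : p ∈ homog m q (k + 2)) :
    laplace m q p ∈ homog m q k := by
  rw [laplace_apply]
  exact contr_mem fun i j =>
    partialD_mem_homog hm hq hq1 (partialD_mem_homog hm hq hq1 hp j) i

theorem laplace_homog_lt_two {k : ℕ} (hk : k < 2) {p : Poly m q} (hp : p ∈ homog m q k) :
    laplace m q p = 0 := by
  rw [laplace_apply]
  interval_cases k
  · simp [partialD_homog_zero hm hq hq1 hp, contr_zero]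
  · simp [partialD_homog_zero hm hq hq1 (partialD_mem_homog hm hq hq1 hp _), contr_zero]

theorem laplace_pow_mem_homog (n : ℕ) {k : ℕ} {p : Poly m q} (hp : p ∈ homog m q (k + 2 * n)) :
    (laplace m q ^ n) p ∈ homog m q k := by
  induction n generalizing k with
  | zero => simpa using hp
  | succ n ih =>
    rw [pow_succ', Module.End.mul_apply]
    exact laplace_mem_homog hm hq hq1 (ih (by rwa [show k + 2 + 2 * n = k + 2 * (n + 1) by ring]))

theorem laplace_pow_homog_lt (n : ℕ) {k : ℕ} (hk : k < 2 * n) {p : Poly m q}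
    (hp : p ∈ homog m q k) : (laplace m q ^ n) p = 0 := by
  obtain ⟨j, b, hb, rfl⟩ : ∃ j b, b < 2 ∧ k = b + 2 * j :=
    ⟨k / 2, k % 2, Nat.mod_lt _ two_pos, (Nat.mod_add_div _ _).symm⟩
  obtain ⟨i, rfl⟩ : ∃ i, n = i + 1 + j := ⟨n - j - 1, by omega⟩
  rw [pow_add, Module.End.mul_apply, pow_succ, Module.End.mul_apply,
    laplace_homog_lt_two hm hq hq1 hb (laplace_pow_mem_homog hm hq hq1 j hp), map_zero]

/-- The values of the iterated Laplacian at the origin vanish except in one degree. -/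
theorem evalZero_laplace_pow (n : ℕ) {k : ℕ} (hk : k ≠ 2 * n) {p : Poly m q}
    (hp : p ∈ homog m q k) : evalZero m q ((laplace m q ^ n) p) = 0 := by
  rcases lt_or_gt_of_ne hk with h | h
  · rw [laplace_pow_homog_lt hm hq hq1 n h hp, map_zero]
  · obtain ⟨j, rfl⟩ : ∃ j, k = j + 1 + 2 * n := ⟨k - 2 * n - 1, by omega⟩
    exact evalZero_homog_succ (laplace_pow_mem_homog hm hq hq1 n hp)

/-- The dilation identity solved for the Euler operator. On harmonics it becomes an eigenvalue
equation; for the kernel it becomes a recursion in the degree. -/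
theorem euler_homog {k : ℕ} {p : Poly m q} (hp : p ∈ homog m q k) :
    euler m q p = (qNum (q ^ 2) k : ℂ) • p +
      ((q * kappa m q / mu m q : ℝ) : ℂ) • (normSq m q * laplace m q p) := by
  have h := dilation hm hq hq1 k hp
  have hq2 : ((q : ℂ) ^ 2 - 1) ≠ 0 := by
    have : q ^ 2 - 1 ≠ 0 := by nlinarith
    exact_mod_cast this
  have hm0 : (mu m q : ℂ) ≠ 0 := by exact_mod_cast (mu_pos (m := m) hq).ne'
  refine smul_right_injective _ hq2 ?_
  rw [qNum_natCast, ← pow_mul]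
  have e1 : ((q : ℂ) ^ 2 - 1) * (((q ^ (2 * k) - 1) / (q ^ 2 - 1) : ℝ) : ℂ) = (q : ℂ) ^ (2 * k) - 1 := by
    push_cast; field_simp
  have e2 : ((q : ℂ) ^ 2 - 1) * ((q * kappa m q / mu m q : ℝ) : ℂ) =
      - (((1 - q ^ 2) * (q * kappa m q) / mu m q : ℝ) : ℂ) := by
    push_cast; field_simp; ring
  simp only [smul_add, smul_smul, e1, e2]
  linear_combination (norm := module) h

theorem euler_sphHarm {k : ℕ} {S : Poly m q} (hS : S ∈ sphHarm m q k) :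
    euler m q S = (qNum (q ^ 2) k : ℂ) • S := by
  rw [euler_homog hm hq hq1 hS.1, (LinearMap.mem_ker.1 hS.2 : laplace m q S = 0), mul_zero, smul_zero,
    add_zero]

theorem partialD_mem_sphHarm {k : ℕ} {S : Poly m q} (hS : S ∈ sphHarm m q (k + 1)) (i : Fin m) :
    partialD m q i S ∈ sphHarm m q k := by
  refine ⟨partialD_mem_homog hm hq hq1 hS.1 i, LinearMap.mem_ker.2 ?_⟩
  rw [← partialD_laplace hm hq hq1, (LinearMap.mem_ker.1 hS.2 : laplace m q S = 0),
    map_zero]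

omit hm hq hq1 in
theorem laplace_pow_succ (n : ℕ) (p : Poly m q) :
    (laplace m q ^ (n + 1)) p = laplace m q ((laplace m q ^ n) p) := by
  rw [pow_succ', Module.End.mul_apply]

theorem laplace_pow_coord_mul (n : ℕ) (i : Fin m) (p : Poly m q) :
    (laplace m q ^ (n + 1)) (coord m q i * p) =
      ((mu m q * qNum (q ^ 2) (n + 1) : ℝ) : ℂ) • partialD m q i ((laplace m q ^ n) p) +
      (q : ℂ) ^ (2 * (n + 1)) • (coord m q i * (laplace m q ^ (n + 1)) p) := by
  have hq2 : q ^ 2 ≠ 1 := by nlinarith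
  induction n with
  | zero => simp [laplace_coord_mul hm hq hq1, qNum_one hq2]
  | succ n ih =>
    rw [laplace_pow_succ, ih, map_add, map_smul, map_smul, laplace_coord_mul hm hq hq1,
      ← partialD_laplace hm hq hq1, ← laplace_pow_succ, ← laplace_pow_succ]
    push_cast
    rw [qNum_add_one' (by positivity) hq2 ((n : ℝ) + 1),
      show ((q ^ 2 : ℝ) ^ ((n : ℝ) + 1)) = q ^ (2 * (n + 1)) by
        rw [← Nat.cast_succ, Real.rpow_natCast, ← pow_mul]]
    push_cast
    module

theorem partialD_laplace_pow (n : ℕ) (i : Fin m) (p : Poly m q) :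
    partialD m q i ((laplace m q ^ n) p) = (laplace m q ^ n) (partialD m q i p) := by
  induction n with
  | zero => simp
  | succ n ih =>
    rw [pow_succ', Module.End.mul_apply, partialD_laplace hm hq hq1, ih, Module.End.mul_apply]

/-- The basic adjointness between multiplication by a coordinate and differentiation: the other term
of `laplace_pow_coord_mul` has a coordinate in front and dies at the origin. -/
theorem evalZero_laplace_pow_coord_mul (n : ℕ) (i : Fin m) (p : Poly m q) :
    evalZero m q ((laplace m q ^ (n + 1)) (coord m q i * p)) =
      ((mu m q * qNum (q ^ 2) (n + 1) : ℝ) : ℂ) *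
        evalZero m q ((laplace m q ^ n) (partialD m q i p)) := by
  rw [laplace_pow_coord_mul hm hq hq1, map_add, map_smul, map_smul, evalZero_coord_mul, smul_zero,
    add_zero, smul_eq_mul, partialD_laplace_pow hm hq hq1]

theorem contr_act_inv (t : Fin m → Fin m → Poly m q) :
    contr m q (fun a b => act (toC (Rhat m q)⁻¹) t a b) = ((q ^ m / q : ℝ) : ℂ) • contr m q t := by
  have := contr_act hq hq1 (fun a b => act (toC (Rhat m q)⁻¹) t a b)
  simp only [act_act_inv hq hq1] at this
  rw [show contr m q t = contr m q (fun a b => t a b) from rfl, this, smul_smul, ← Complex.ofReal_mul]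
  have : q ^ m / q * (q / q ^ m) = 1 := by field_simp
  rw [this, Complex.ofReal_one, one_smul]

theorem laplace_normSq_mul (p : Poly m q) :
    laplace m q (normSq m q * p) = ((mu m q * metricSq m q : ℝ) : ℂ) • p +
      ((mu m q * (q ^ m + q ^ 2) : ℝ) : ℂ) • euler m q p +
      (q : ℂ) ^ 4 • (normSq m q * laplace m q p) := by
  rw [normSq_mul, map_contr]
  simp only [laplace_coord_mul hm hq hq1, partialD_coord_mul hm hq hq1, contr_add, contr_smul,
    smul_add, mul_add, mul_smul_comm]
  rw [contr_metric, contr_act_inv hm hq hq1, ← euler_apply, ← normSq_mul]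
  have e : (q : ℂ) * ((q ^ m / q : ℝ) : ℂ) = (q : ℂ) ^ m := by
    have : (q : ℂ) ≠ 0 := by exact_mod_cast hq.ne'
    push_cast; field_simp
  have e' := congrArg (fun z : ℂ => ((mu m q : ℂ) * z) • euler m q p) e
  push_cast at e' ⊢
  linear_combination (norm := module) e'

theorem euler_normSq_mul (p : Poly m q) :
    euler m q (normSq m q * p) = (mu m q : ℂ) • (normSq m q * p) +
      (q : ℂ) ^ 2 • (normSq m q * euler m q p) := by
  rw [euler_apply]
  simp only [partialD_normSq_mul hm hq hq1, contr_add, contr_smul, mul_add, mul_smul_comm]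
  rw [← normSq_mul, euler_apply, mul_contr]
  simp only [← mul_assoc, coord_mul_normSq hm hq hq1]

/-- The products of a spherical harmonic with powers of the norm squared do not vanish. -/
theorem normSq_pow_mul_sphHarm_ne_zero {k : ℕ} {S : Poly m q} (hS : S ∈ sphHarm m q k) (hS0 : S ≠ 0)
    (n : ℕ) : normSq m q ^ n * S ≠ 0 := by
  have hmu := mu_pos (m := m) hq
  have hQ := metricSq_pos hm hq
  -- Only positivity of the eigenvalue is needed: Δ takes 𝐱^(2n+2) S to a positive multiple of
  -- 𝐱^(2n) S. The exact constants are therefore left existential.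
  have key : ∀ n : ℕ, ∃ a e : ℝ, 0 ≤ a ∧ 0 ≤ e ∧ euler m q (normSq m q ^ n * S) = (e : ℂ) • (normSq m q ^ n * S)
      ∧ laplace m q (normSq m q ^ (n + 1) * S) =
        ((mu m q * metricSq m q + mu m q * (q ^ m + q ^ 2) * e + a : ℝ) : ℂ) •
          (normSq m q ^ n * S) := by
    intro n
    induction n with
    | zero =>
      refine ⟨0, qNum (q ^ 2) k, le_rfl, ?_, ?_, ?_⟩
      · rcases Nat.eq_zero_or_pos k with rfl | hk
        · simp [qNum_zero]
        · exact (qNum_pos (by positivity) (by nlinarith) (by exact_mod_cast hk)).le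
      · rw [pow_zero, one_mul, euler_sphHarm hm hq hq1 hS]
      · rw [zero_add, pow_one, pow_zero, one_mul, laplace_normSq_mul hm hq hq1,
          euler_sphHarm hm hq hq1 hS, (LinearMap.mem_ker.1 hS.2 : laplace m q S = 0), mul_zero]
        push_cast
        module
    | succ n ih =>
      obtain ⟨a, e, ha, he, h1, h2⟩ := ih
      refine ⟨q ^ 4 * (mu m q * metricSq m q + mu m q * (q ^ m + q ^ 2) * e + a), mu m q + q ^ 2 * e,
        by positivity, by positivity, ?_, ?_⟩
      · rw [pow_succ', mul_assoc, euler_normSq_mul hm hq hq1, h1, mul_smul_comm]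
        push_cast
        module
      · rw [pow_succ', mul_assoc, laplace_normSq_mul hm hq hq1, h2, pow_succ', mul_assoc,
          euler_normSq_mul hm hq hq1, h1, mul_smul_comm, mul_smul_comm]
        push_cast
        module
  induction n with
  | zero => rwa [pow_zero, one_mul]
  | succ n ih =>
    intro h0
    obtain ⟨a, e, ha, he, -, h2⟩ := key n
    rw [h0, map_zero, eq_comm, smul_eq_zero, Complex.ofReal_eq_zero] at h2
    refine h2.elim (fun h => ?_) ih
    have : 0 < mu m q * metricSq m q + mu m q * (q ^ m + q ^ 2) * e + a := by positivity
    exact this.ne' h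

end degree
end QEuclid

namespace QEuclid

/-! ### Differential operators with constant coefficients -/

section diffOp
variable {m : ℕ} {q : ℝ} (hm : 1 ≤ m) (hq : 0 < q) (hq1 : q < 1)

/-- The differential operator `R(∂)` of a polynomial `R`. -/
def diffOp : Poly m q →ₐ[ℂ] Module.End ℂ (Poly m q) :=
  RingQuot.liftAlgHom ℂ ⟨FreeAlgebra.lift ℂ (partialD m q), by
    rintro _ _ ⟨i, j⟩
    simp only [map_sum, map_smul, map_mul, FreeAlgebra.lift_ι_apply, map_zero]
    refine LinearMap.ext fun p => ?_
    simp only [LinearMap.sum_apply, LinearMap.smul_apply, Module.End.mul_apply,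
      LinearMap.zero_apply]
    exact act_partialD_partialD hm hq hq1 p i j⟩

theorem diffOp_coord (i : Fin m) : diffOp hm hq hq1 (coord m q i) = partialD m q i := by
  simp only [diffOp, coord]
  rw [RingQuot.liftAlgHom_mkAlgHom_apply, FreeAlgebra.lift_ι_apply]

theorem diffOp_coord_mul (i : Fin m) (p r : Poly m q) :
    diffOp hm hq hq1 (coord m q i * p) r = partialD m q i (diffOp hm hq hq1 p r) := by
  rw [map_mul, diffOp_coord, Module.End.mul_apply]

theorem diffOp_normSq : diffOp hm hq hq1 (normSq m q) = laplace m q := by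
  refine LinearMap.ext fun p => ?_
  have := map_contr (q := q) ((LinearMap.applyₗ p) ∘ₗ (diffOp hm hq hq1).toLinearMap)
    (fun a b => coord m q a * coord m q b)
  rw [← normSq_eq_contr] at this
  simp only [LinearMap.comp_apply, AlgHom.toLinearMap_apply, LinearMap.applyₗ_apply_apply,
    diffOp_coord_mul, diffOp_coord] at this
  rw [this, laplace_apply]

/-! ### Normal ordering of harmonic operators -/

/-- The polynomial `S(x, ∂) p`, where the first `a` factors of the homogeneous polynomial `S` of degree
`a + b` act by multiplication and the last `b` by differentiation. -/
def mixedOp (p : Poly m q) : ℕ → ℕ → Poly m q →ₗ[ℂ] Poly m q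
  | 0, 0 => (evalZero m q).toLinearMap.smulRight p
  | 0, b + 1 => contr m q fun i j => partialD m q i ∘ₗ mixedOp p 0 b ∘ₗ partialD m q j
  | a + 1, b => contr m q fun i j =>
      LinearMap.mulLeft ℂ (coord m q i) ∘ₗ mixedOp p a b ∘ₗ partialD m q j

theorem mixedOp_zero_zero (S p : Poly m q) : mixedOp p 0 0 S = evalZero m q S • p := by
  simp [mixedOp]

theorem mixedOp_zero_succ (b : ℕ) (S p : Poly m q) : mixedOp p 0 (b + 1) S =
    contr m q fun i j => partialD m q i (mixedOp p 0 b (partialD m q j S)) := by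
  simp only [mixedOp, contr, LinearMap.sum_apply, LinearMap.smul_apply, LinearMap.comp_apply]

theorem mixedOp_succ (a b : ℕ) (S p : Poly m q) : mixedOp p (a + 1) b S =
    contr m q fun i j => coord m q i * mixedOp p a b (partialD m q j S) := by
  simp only [mixedOp, contr, LinearMap.sum_apply, LinearMap.smul_apply, LinearMap.comp_apply,
    LinearMap.mulLeft_apply]

theorem contr_comm {M : Type*} [AddCommGroup M] [Module ℂ M] (t : Fin m → Fin m → Fin m → Fin m → M) :
    contr m q (fun i j => contr m q fun k l => t i j k l) =
      contr m q (fun k l => contr m q fun i j => t i j k l) := by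
  have h : ∀ u : Fin m → Fin m → M, contr m q u =
      ∑ p : Fin m × Fin m, ((metric m q p.1 p.2 : ℝ) : ℂ) • u p.1 p.2 := fun u =>
    (Fintype.sum_prod_type' (f := fun a b => ((metric m q a b : ℝ) : ℂ) • u a b)).symm
  simp only [h, Finset.smul_sum]
  rw [Finset.sum_comm]
  exact Finset.sum_congr rfl fun _ _ => Finset.sum_congr rfl fun _ _ => smul_comm _ _ _

include hm hq hq1

theorem map_partialD_partialD (f : Poly m q →ₗ[ℂ] Poly m q) (S : Poly m q) (i j : Fin m) :
    act (toC (projAntisym m q)) (fun a b => f (partialD m q a (partialD m q b S))) i j = 0 := by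
  rw [← map_act, act_partialD_partialD hm hq hq1, map_zero]

/-- A derivative moves to the right past the multiplications at no cost. The metric term of the
Leibniz rule produces ΔS = 0, and on the trace-free symmetric tensor ∂∂S the matrix R̂⁻¹ is the
scalar q⁻¹, which cancels the factor q of the rule. -/
theorem contr_partialD_mixedOp (a b : ℕ) {S : Poly m q} (hS : S ∈ sphHarm m q (a + b + 1))
    (p : Poly m q) :
    contr m q (fun i j => partialD m q i (mixedOp p a b (partialD m q j S))) =
      mixedOp p a (b + 1) S := by
  induction a generalizing S with
  | zero => exact (mixedOp_zero_succ b S p).symm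
  | succ a ih =>
    set s : Fin m → Fin m → Poly m q := fun l j => mixedOp p a b (partialD m q l (partialD m q j S))
      with hs
    have hsa : ∀ l j, mixedOp p a b (partialD m q l (partialD m q j S)) = s l j := fun _ _ => rfl
    have htr : contr m q (fun i j => s i j) = 0 := by
      rw [← map_contr, ← laplace_apply, (LinearMap.mem_ker.1 hS.2 : laplace m q S = 0), map_zero]
    have hcl : ∀ i j, act (toC (Rhat m q)⁻¹) (fun l j => s l j) i j = ((q⁻¹ : ℝ) : ℂ) • s i j :=
        fun i j => by
      rw [act_inv_of_closed hq hq1 (map_partialD_partialD hm hq hq1 _ S i j)]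
      rw [show contr m q s = 0 from htr, smul_zero, smul_zero, add_zero]
    have hind : ∀ k, contr m q (fun d b => partialD m q d (s b k)) =
        mixedOp p a (b + 1) (partialD m q k S) := fun k =>
      ih (partialD_mem_sphHarm hm hq hq1 (k := a + b + 1)
        (by rwa [show a + b + 1 + 1 = a + 1 + b + 1 by ring]) k)
    simp only [mixedOp_succ, hsa, map_contr, partialD_coord_mul hm hq hq1, contr_add, contr_smul]
    have e1 : ∀ i j, contr m q (fun k l => (metric m q i k : ℂ) • s l j) = s i j :=
      fun i j => contr_metric_mul' hq (fun l => s l j) i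
    have e2 : ∀ i j, contr m q (fun k l => act (toC (Rhat m q)⁻¹)
        (fun c d => coord m q c * partialD m q d (s l j)) i k) =
        contr m q fun c k => coord m q c * act (toC (Rhat m q)) (fun d l => partialD m q d (s l j)) k i :=
      fun i j => by
        rw [← contr_act_right hq hq1 (fun c d l => coord m q c * partialD m q d (s l j)) i]
        simp only [mul_act]
    have e3 : ∀ k, contr m q (fun i j => act (toC (Rhat m q)) (fun d l => partialD m q d (s l j)) k i) =
        ((q⁻¹ : ℝ) : ℂ) • mixedOp p a (b + 1) (partialD m q k S) := fun k => by
      rw [← contr_act_inv_right hq hq1 (fun d l j => partialD m q d (s l j)) k]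
      simp only [← map_act, hcl, map_smul, contr_smul, hind]
    simp only [e1, e2, htr, zero_add]
    rw [contr_comm]
    simp only [← mul_contr, e3, mul_smul_comm, contr_smul, smul_smul]
    rw [← Complex.ofReal_mul, mul_inv_cancel₀ hq.ne', Complex.ofReal_one, one_smul]

/-- Each contraction of x with ∂ is an Euler operator, with eigenvalue [k], then [k-1], and so on;
the factorial collects them. -/
theorem mixedOp_left (k : ℕ) {S : Poly m q} (hS : S ∈ sphHarm m q k) (p : Poly m q) :
    mixedOp p k 0 S = (qFactorial (q ^ 2) k : ℂ) • (S * p) := by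
  induction k generalizing S with
  | zero =>
    obtain ⟨r, rfl⟩ := mem_homog_zero hS.1
    rw [mixedOp_zero_zero, AlgHom.commutes, qFactorial_zero, ← Algebra.smul_def]
    simp
  | succ k ih =>
    have h := congrArg (· * p) (euler_sphHarm hm hq hq1 hS)
    have h2 := map_contr (q := q) (LinearMap.mulRight ℂ p) (fun i j => coord m q i * partialD m q j S)
    simp only [LinearMap.mulRight_apply, mul_assoc, ← euler_apply] at h2
    simp only [mixedOp_succ, fun j => ih (partialD_mem_sphHarm hm hq hq1 hS j), mul_smul_comm,
      contr_smul, ← h2]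
    rw [h, qFactorial_succ, smul_mul_assoc, smul_smul]
    push_cast
    rfl

theorem mixedOp_right (k : ℕ) {S : Poly m q} (hS : S ∈ sphHarm m q k) (p : Poly m q) :
    mixedOp p 0 k S = (qFactorial (q ^ 2) k : ℂ) • diffOp hm hq hq1 S p := by
  induction k generalizing S with
  | zero =>
    obtain ⟨r, rfl⟩ := mem_homog_zero hS.1
    rw [mixedOp_zero_zero, AlgHom.commutes, AlgHom.commutes, qFactorial_zero,
      Module.algebraMap_end_apply]
    simp
  | succ k ih =>
    have h := congrArg (fun r => diffOp hm hq hq1 r p) (euler_sphHarm hm hq hq1 hS)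
    have h2 := map_contr (q := q) ((LinearMap.applyₗ p) ∘ₗ (diffOp hm hq hq1).toLinearMap)
      (fun i j => coord m q i * partialD m q j S)
    rw [← euler_apply] at h2
    simp only [LinearMap.comp_apply, AlgHom.toLinearMap_apply, LinearMap.applyₗ_apply_apply,
      diffOp_coord_mul] at h2
    simp only [mixedOp_zero_succ, fun j => ih (partialD_mem_sphHarm hm hq hq1 hS j), map_smul,
      contr_smul, ← h2]
    rw [h, qFactorial_succ, map_smul, LinearMap.smul_apply, smul_smul]
    push_cast
    rfl

/-- Trades one multiplication for one derivative and one Laplacian: adjointness turns the leftmost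
coordinate into ∂, and normal ordering moves that ∂ to its place. -/
theorem evalZero_laplace_pow_mixedOp (n a b : ℕ) {S : Poly m q} (hS : S ∈ sphHarm m q (a + 1 + b))
    (p : Poly m q) :
    evalZero m q ((laplace m q ^ (n + 1)) (mixedOp p (a + 1) b S)) =
      ((mu m q * qNum (q ^ 2) (n + 1) : ℝ) : ℂ) *
        evalZero m q ((laplace m q ^ n) (mixedOp p a (b + 1) S)) := by
  rw [← contr_partialD_mixedOp hm hq hq1 a b (by rwa [add_right_comm] at hS) p, mixedOp_succ]
  have := fun (f : Poly m q →ₗ[ℂ] ℂ) (t : Fin m → Fin m → Poly m q) =>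
    map_contr (q := q) f t
  have h1 := this ((evalZero m q).toLinearMap ∘ₗ laplace m q ^ (n + 1))
  have h2 := this ((evalZero m q).toLinearMap ∘ₗ laplace m q ^ n)
  simp only [LinearMap.comp_apply, AlgHom.toLinearMap_apply] at h1 h2
  rw [h1, h2]
  simp only [evalZero_laplace_pow_coord_mul hm hq hq1]
  simp only [← smul_eq_mul, contr_smul]

/-- Once the Laplacians are used up, a coordinate still stands on the left and vanishes at the
origin. -/
theorem evalZero_laplace_pow_mixedOp_of_lt (n a b : ℕ) (hn : n < a) {S : Poly m q}
    (hS : S ∈ sphHarm m q (a + b)) (p : Poly m q) :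
    evalZero m q ((laplace m q ^ n) (mixedOp p a b S)) = 0 := by
  induction n generalizing a b with
  | zero =>
    obtain ⟨a, rfl⟩ := Nat.exists_eq_succ_of_ne_zero hn.ne'
    rw [pow_zero, Module.End.one_apply, mixedOp_succ]
    have := map_contr (q := q) (evalZero m q).toLinearMap
      (fun i j => coord m q i * mixedOp p a b (partialD m q j S))
    simp only [AlgHom.toLinearMap_apply, evalZero_coord_mul, contr_zero] at this
    exact this
  | succ n ih =>
    obtain ⟨a, rfl⟩ := Nat.exists_eq_succ_of_ne_zero (Nat.ne_zero_of_lt hn)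
    rw [evalZero_laplace_pow_mixedOp hm hq hq1 n a b hS, ih a (b + 1) (by omega)
      (by rwa [show a + (b + 1) = a.succ + b by rw [Nat.succ_eq_add_one]; ring]), mul_zero]

theorem evalZero_laplace_pow_mixedOp_add (n a b : ℕ) {S : Poly m q}
    (hS : S ∈ sphHarm m q (a + b)) (p : Poly m q) :
    (qFactorial (q ^ 2) n : ℂ) * evalZero m q ((laplace m q ^ (n + a)) (mixedOp p a b S)) =
      (mu m q : ℂ) ^ a * (qFactorial (q ^ 2) (n + a) : ℂ) *
        evalZero m q ((laplace m q ^ n) (mixedOp p 0 (a + b) S)) := by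
  induction a generalizing b with
  | zero => simp
  | succ a ih =>
    have h := ih (b + 1) (by rwa [show a + (b + 1) = a + 1 + b by ring])
    rw [← add_assoc, evalZero_laplace_pow_mixedOp hm hq hq1 (n + a) a b hS, mul_left_comm, h,
      qFactorial_succ, show a + (b + 1) = a + 1 + b by ring]
    push_cast
    ring

/-- The adjoint of the multiplication with a spherical harmonic. -/
theorem evalZero_laplace_pow_sphHarm_mul (n k : ℕ) {S : Poly m q} (hS : S ∈ sphHarm m q k)
    (p : Poly m q) :
    (qFactorial (q ^ 2) n : ℂ) * evalZero m q ((laplace m q ^ (n + k)) (S * p)) =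
      (mu m q : ℂ) ^ k * (qFactorial (q ^ 2) (n + k) : ℂ) *
        evalZero m q ((laplace m q ^ n) (diffOp hm hq hq1 S p)) := by
  have h := evalZero_laplace_pow_mixedOp_add hm hq hq1 n k 0 hS p
  rw [add_zero, mixedOp_left hm hq hq1 k hS, mixedOp_right hm hq hq1 k hS, map_smul, map_smul, map_smul,
    map_smul, smul_eq_mul, smul_eq_mul] at h
  have h0 : (qFactorial (q ^ 2) k : ℂ) ≠ 0 := by
    exact_mod_cast (qFactorial_pos (by positivity) (by nlinarith) k).ne'
  refine mul_left_cancel₀ h0 ?_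
  linear_combination h

theorem evalZero_laplace_pow_sphHarm_mul_of_lt (n k : ℕ) (hn : n < k) {S : Poly m q}
    (hS : S ∈ sphHarm m q k) (p : Poly m q) :
    evalZero m q ((laplace m q ^ n) (S * p)) = 0 := by
  have h := evalZero_laplace_pow_mixedOp_of_lt hm hq hq1 n k 0 hn hS p
  rw [mixedOp_left hm hq hq1 k hS, map_smul, map_smul, smul_eq_mul] at h
  have h0 : (qFactorial (q ^ 2) k : ℂ) ≠ 0 := by
    exact_mod_cast (qFactorial_pos (by positivity) (by nlinarith) k).ne'
  exact (mul_eq_zero.1 h).resolve_left h0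

end diffOp
end QEuclid

namespace QEuclid

/-! ### The Fourier kernel -/

section kernel
variable {m : ℕ} {q : ℝ}

/-- The action of operators in `x` on polynomials in `x` and `y`. -/
def leftAct (m : ℕ) (q : ℝ) :
    Poly m q ⊗[ℂ] Poly m q →ₗ[ℂ] Module.End ℂ (Poly m q) →ₗ[ℂ] Poly m q ⊗[ℂ] Poly m q :=
  (LinearMap.rTensorHom (Poly m q)).flip

/-- The right multiplication with polynomials in `y`. -/
def rightMul (m : ℕ) (q : ℝ) :
    Poly m q ⊗[ℂ] Poly m q →ₗ[ℂ] Poly m q →ₗ[ℂ] Poly m q ⊗[ℂ] Poly m q :=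
  (LinearMap.lTensorHom (Poly m q) ∘ₗ (LinearMap.mul ℂ (Poly m q)).flip).flip

theorem leftAct_apply (z : Poly m q ⊗[ℂ] Poly m q) (f : Module.End ℂ (Poly m q)) :
    leftAct m q z f = f.rTensor (Poly m q) z := rfl

theorem rightMul_apply (z : Poly m q ⊗[ℂ] Poly m q) (p : Poly m q) :
    rightMul m q z p = (LinearMap.mulRight ℂ p).lTensor (Poly m q) z := rfl

theorem leftAct_mul (z : Poly m q ⊗[ℂ] Poly m q) (f g : Module.End ℂ (Poly m q)) :
    leftAct m q z (f * g) = leftAct m q (leftAct m q z g) f := by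
  simp only [leftAct_apply, Module.End.mul_eq_comp, LinearMap.rTensor_comp_apply]

theorem leftAct_one (z : Poly m q ⊗[ℂ] Poly m q) : leftAct m q z 1 = z := by
  simp [leftAct_apply, Module.End.one_eq_id]

theorem rightMul_rightMul (z : Poly m q ⊗[ℂ] Poly m q) (p r : Poly m q) :
    rightMul m q (rightMul m q z p) r = rightMul m q z (p * r) := by
  simp only [rightMul_apply, ← LinearMap.lTensor_comp_apply, LinearMap.mulRight_mul]

theorem rightMul_one (z : Poly m q ⊗[ℂ] Poly m q) : rightMul m q z 1 = z := by
  simp [rightMul_apply]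

theorem rightMul_leftAct (z : Poly m q ⊗[ℂ] Poly m q) (f : Module.End ℂ (Poly m q)) (p : Poly m q) :
    rightMul m q (leftAct m q z f) p = leftAct m q (rightMul m q z p) f := by
  rw [rightMul_apply, rightMul_apply, leftAct_apply, leftAct_apply, ← LinearMap.comp_apply,
    ← LinearMap.comp_apply, LinearMap.lTensor_comp_rTensor, LinearMap.rTensor_comp_lTensor]

theorem map_contr_tensor (f : Poly m q ⊗[ℂ] Poly m q →ₗ[ℂ] Poly m q ⊗[ℂ] Poly m q)
    (t : Fin m → Fin m → Poly m q ⊗[ℂ] Poly m q) :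
    f (contr m q t) = contr m q fun a b => f (t a b) := by
  simp only [contr, map_sum, map_smul]

theorem leftAct_act (z : Poly m q ⊗[ℂ] Poly m q) (A : Matrix (Fin m × Fin m) (Fin m × Fin m) ℂ)
    (t : Fin m → Fin m → Module.End ℂ (Poly m q)) (i j : Fin m) :
    leftAct m q z (act A t i j) = act A (fun a b => leftAct m q z (t a b)) i j := by
  simp only [act, map_sum, map_smul]

theorem map_act_tensor (f : Poly m q ⊗[ℂ] Poly m q →ₗ[ℂ] Poly m q ⊗[ℂ] Poly m q)
    (A : Matrix (Fin m × Fin m) (Fin m × Fin m) ℂ)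
    (t : Fin m → Fin m → Poly m q ⊗[ℂ] Poly m q) (i j : Fin m) :
    f (act A t i j) = act A (fun a b => f (t a b)) i j := by
  simp only [act, map_sum, map_smul]

variable (m q) in
/-- The multiplication with `x^i` from the left. -/
def xmul (i : Fin m) : Module.End ℂ (Poly m q) := LinearMap.mulLeft ℂ (coord m q i)

variable (m q) in
/-- The components of the Fourier kernel, starting in degree `-2`. -/
def kernelSeq : ℕ → Poly m q ⊗[ℂ] Poly m q
  | 0 => 0
  | 1 => 0
  | 2 => 1 ⊗ₜ 1
  | n + 3 => (((qNum (q ^ 2) (n + 1))⁻¹ : ℝ) : ℂ) •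
      (contr m q (fun i j => rightMul m q (leftAct m q (kernelSeq (n + 2)) (xmul m q i)) (coord m q j)) +
        ((-(q * kappa m q / mu m q) : ℝ) : ℂ) •
          rightMul m q (leftAct m q (kernelSeq (n + 1)) (LinearMap.mulLeft ℂ (normSq m q))) (normSq m q))

variable (hm : 1 ≤ m) (hq : 0 < q) (hq1 : q < 1)

-- This is `euler_homog` applied to the kernel, whose Euler and Laplace images are dictated by ∂ exp
-- = exp y; so the recursion is forced. The offset by two zero components makes it hold in degrees 0
-- and 1 as well.
include hq hq1 in
theorem qNum_smul_kernelSeq (n : ℕ) : ((qNum (q ^ 2) n : ℝ) : ℂ) • kernelSeq m q (n + 2) =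
    contr m q (fun i j => rightMul m q (leftAct m q (kernelSeq m q (n + 1)) (xmul m q i)) (coord m q j)) +
      ((-(q * kappa m q / mu m q) : ℝ) : ℂ) •
        rightMul m q (leftAct m q (kernelSeq m q n) (LinearMap.mulLeft ℂ (normSq m q))) (normSq m q) := by
  cases n with
  | zero => simp [kernelSeq, qNum_zero, contr_zero]
  | succ n =>
    have h0 : qNum (q ^ 2) (n + 1) ≠ 0 :=
      (qNum_pos (by positivity) (by nlinarith) (by positivity)).ne'
    rw [kernelSeq, smul_smul, Nat.cast_succ, ← Complex.ofReal_mul, mul_inv_cancel₀ h0,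
      Complex.ofReal_one, one_smul]

include hm hq hq1

theorem partialD_mul_xmul (i j : Fin m) :
    (partialD m q i : Module.End ℂ (Poly m q)) * xmul m q j = (metric m q i j : ℂ) • 1 +
      (q : ℂ) • act (toC (Rhat m q)⁻¹) (fun k l => xmul m q k * partialD m q l) i j := by
  refine LinearMap.ext fun p => ?_
  have := map_act (toC (Rhat m q)⁻¹) (LinearMap.applyₗ (R := ℂ) (M₂ := Poly m q) p)
    (fun k l => (xmul m q k * partialD m q l : Module.End ℂ (Poly m q))) i j
  simp only [LinearMap.applyₗ_apply_apply, Module.End.mul_apply, xmul, LinearMap.mulLeft_apply] at this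
  simp only [Module.End.mul_apply, xmul, LinearMap.mulLeft_apply, partialD_coord_mul hm hq hq1,
    LinearMap.add_apply, LinearMap.smul_apply, Module.End.one_apply]
  rw [← this]

theorem partialD_mul_normSq (i : Fin m) :
    (partialD m q i : Module.End ℂ (Poly m q)) * LinearMap.mulLeft ℂ (normSq m q) =
      (mu m q : ℂ) • xmul m q i + (q : ℂ) ^ 2 • (LinearMap.mulLeft ℂ (normSq m q) * partialD m q i) :=
  LinearMap.ext fun p => partialD_normSq_mul hm hq hq1 i p

/-- Applying ∂ to the recursion for degree n + 1 and using the claim in lower degrees gives 1 + q²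
[n] times the expected value, where the [n] comes from the recursion one degree lower. Since [n + 1]
= 1 + q² [n], the factor cancels. -/
theorem leftAct_partialD_kernelSeq (n : ℕ) (i : Fin m) :
    leftAct m q (kernelSeq m q (n + 1)) (partialD m q i) = rightMul m q (kernelSeq m q n) (coord m q i) := by
  induction n using Nat.twoStepInduction generalizing i with
  | zero => simp [kernelSeq]
  | one => simp [kernelSeq, leftAct_apply, partialD_one hm hq hq1]
  | more n ih1 ih2 =>
    have hN0 : qNum (q ^ 2) (n + 1) ≠ 0 :=
      (qNum_pos (by positivity) (by nlinarith) (by positivity)).ne'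
    have hN : qNum (q ^ 2) (n + 1) = 1 + q ^ 2 * qNum (q ^ 2) n :=
      qNum_add_one (by positivity) (by nlinarith) _
    have hmu : (mu m q : ℂ) ≠ 0 := by exact_mod_cast (mu_pos hq).ne'
    have hrec := qNum_smul_kernelSeq (m := m) hq hq1 (n + 1)
    have hrec0 := congrArg (fun z => rightMul m q z (coord m q i))
      (qNum_smul_kernelSeq (m := m) hq hq1 n)
    have hrec' := congrArg (fun z => leftAct m q z (partialD m q i)) hrec
    have hD : ∀ z : Poly m q ⊗[ℂ] Poly m q, ∀ j, leftAct m q (leftAct m q z (xmul m q j)) (partialD m q i) =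
        (metric m q i j : ℂ) • z + (q : ℂ) • act (toC (Rhat m q)⁻¹) (fun k l =>
          leftAct m q (leftAct m q z (partialD m q l)) (xmul m q k)) i j := fun z j => by
      rw [← leftAct_mul, partialD_mul_xmul hm hq hq1, map_add, map_smul, map_smul, leftAct_act, leftAct_one]
      simp only [leftAct_mul]
    have hDN : ∀ z : Poly m q ⊗[ℂ] Poly m q,
        leftAct m q (leftAct m q z (LinearMap.mulLeft ℂ (normSq m q))) (partialD m q i) =
        (mu m q : ℂ) • leftAct m q z (xmul m q i) + (q : ℂ) ^ 2 •
          leftAct m q (leftAct m q z (partialD m q i)) (LinearMap.mulLeft ℂ (normSq m q)) := fun z => by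
      rw [← leftAct_mul, partialD_mul_normSq hm hq hq1, map_add, map_smul, map_smul, leftAct_mul]
    have hmc : ∀ (g : Poly m q ⊗[ℂ] Poly m q →ₗ[ℂ] Poly m q ⊗[ℂ] Poly m q)
        (t : Fin m → Fin m → Poly m q ⊗[ℂ] Poly m q), g (contr m q t) = contr m q fun a b => g (t a b) :=
      fun g t => map_contr_tensor g t
    -- After the contraction is slid across, the braiding acts on a product of two y, which is
    -- symmetric, so it reduces to q plus a κ-term with 𝐲².
    have hyy : ∀ z : Poly m q ⊗[ℂ] Poly m q, ∀ a, act (toC (Rhat m q)) (fun d b =>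
        rightMul m q z (coord m q d * coord m q b)) a i =
        (q : ℂ) • rightMul m q z (coord m q a * coord m q i) +
          (kappa m q : ℂ) • (metric m q a i : ℂ) • rightMul m q z (normSq m q) := fun z a => by
      rw [← map_act, act_of_closed hq (act_coord_rel a i), map_add, map_smul, map_smul, map_smul,
        normSq_eq_contr]
    have hleft : leftAct m q (contr m q (fun i j => rightMul m q (leftAct m q (kernelSeq m q (n + 2))
        (xmul m q i)) (coord m q j))) (partialD m q i) = rightMul m q (kernelSeq m q (n + 2)) (coord m q i) +
        (q : ℂ) ^ 2 • rightMul m q (contr m q fun c a => rightMul m q (leftAct m q (kernelSeq m q (n + 1))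
          (xmul m q c)) (coord m q a)) (coord m q i) + ((q * kappa m q : ℝ) : ℂ) •
          rightMul m q (leftAct m q (kernelSeq m q (n + 1)) (xmul m q i)) (normSq m q) := by
      have e1 := hmc ((leftAct m q).flip (partialD m q i)) (fun i j => rightMul m q (leftAct m q
        (kernelSeq m q (n + 2)) (xmul m q i)) (coord m q j))
      have e2 := hmc ((rightMul m q).flip (coord m q i)) (fun c a => rightMul m q (leftAct m q
        (kernelSeq m q (n + 1)) (xmul m q c)) (coord m q a))
      simp only [LinearMap.flip_apply] at e1 e2
      rw [e1, e2]
      have e3 : ∀ a b, leftAct m q (rightMul m q (leftAct m q (kernelSeq m q (n + 2)) (xmul m q a))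
          (coord m q b)) (partialD m q i) =
          (metric m q i a : ℂ) • rightMul m q (kernelSeq m q (n + 2)) (coord m q b) +
            (q : ℂ) • act (toC (Rhat m q)⁻¹) (fun c d => leftAct m q (rightMul m q (kernelSeq m q (n + 1))
              (coord m q d * coord m q b)) (xmul m q c)) i a := fun a b => by
        have := map_act_tensor ((rightMul m q).flip (coord m q b)) (toC (Rhat m q)⁻¹) (fun k l =>
          leftAct m q (rightMul m q (kernelSeq m q (n + 1)) (coord m q l)) (xmul m q k)) i a
        simp only [LinearMap.flip_apply, rightMul_leftAct, rightMul_rightMul] at this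
        rw [← rightMul_leftAct, hD]
        simp only [ih2, map_add, map_smul, LinearMap.add_apply, LinearMap.smul_apply, this]
      simp only [e3, contr_add, contr_smul]
      rw [contr_metric_mul' hq (fun b => rightMul m q (kernelSeq m q (n + 2)) (coord m q b)) i,
        ← contr_act_right hq hq1 (fun c d b => leftAct m q (rightMul m q (kernelSeq m q (n + 1))
              (coord m q d * coord m q b)) (xmul m q c)) i]
      have e4 : ∀ c a, act (toC (Rhat m q)) (fun d b => leftAct m q (rightMul m q (kernelSeq m q (n + 1))
              (coord m q d * coord m q b)) (xmul m q c)) a i =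
          (q : ℂ) • rightMul m q (rightMul m q (leftAct m q (kernelSeq m q (n + 1)) (xmul m q c))
            (coord m q a)) (coord m q i) + (kappa m q : ℂ) • (metric m q a i : ℂ) •
            rightMul m q (leftAct m q (kernelSeq m q (n + 1)) (xmul m q c)) (normSq m q) := fun c a => by
        simp only [← rightMul_leftAct]
        rw [hyy, rightMul_rightMul]
      simp only [e4, contr_add, contr_smul]
      rw [contr_metric_mul hq (fun c => rightMul m q (leftAct m q (kernelSeq m q (n + 1)) (xmul m q c))
        (normSq m q)) i]
      simp only [smul_add, smul_smul]
      push_cast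
      rw [add_assoc, pow_two]
    have hcomm : rightMul m q (rightMul m q (leftAct m q (kernelSeq m q n)
        (LinearMap.mulLeft ℂ (normSq m q))) (normSq m q)) (coord m q i) =
        rightMul m q (leftAct m q (rightMul m q (kernelSeq m q n) (coord m q i))
        (LinearMap.mulLeft ℂ (normSq m q))) (normSq m q) := by
      rw [rightMul_rightMul, ← rightMul_leftAct, rightMul_rightMul, coord_mul_normSq hm hq hq1]
    simp only [map_smul, LinearMap.smul_apply, map_add, LinearMap.add_apply, hleft, ← rightMul_leftAct,
      hDN, ih1, map_add, LinearMap.add_apply] at hrec'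
    simp only [map_smul, LinearMap.smul_apply, map_add, LinearMap.add_apply, hcomm] at hrec0
    -- The first-order part of ∂ 𝐱² cancels the κ-term from `hyy`.
    have hk : ((-(q * kappa m q / mu m q) : ℝ) : ℂ) * (mu m q : ℂ) = -((q * kappa m q : ℝ) : ℂ) := by
      push_cast; field_simp
    have hfin : ((qNum (q ^ 2) (n + 1) : ℝ) : ℂ) • leftAct m q (kernelSeq m q (n + 2 + 1)) (partialD m q i) =
        ((qNum (q ^ 2) (n + 1) : ℝ) : ℂ) • rightMul m q (kernelSeq m q (n + 2)) (coord m q i) := by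
      have hN' : ((qNum (q ^ 2) (n + 1) : ℝ) : ℂ) = 1 + (q : ℂ) ^ 2 * ((qNum (q ^ 2) n : ℝ) : ℂ) := by
        rw [hN]; push_cast; ring
      rw [Nat.cast_succ] at hrec'
      refine hrec'.trans ?_
      rw [hN', add_smul, one_smul, mul_smul, hrec0, smul_add, smul_smul _ (mu m q : ℂ), hk]
      simp only [rightMul_leftAct]
      module
    have h0 : ((qNum (q ^ 2) (n + 1) : ℝ) : ℂ) ≠ 0 := by exact_mod_cast hN0
    exact smul_right_injective _ h0 hfin

omit hm hq hq1 in
theorem leftAct_mem {k l : ℕ} {f : Module.End ℂ (Poly m q)} (hf : ∀ p ∈ homog m q k, f p ∈ homog m q l)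
    {z : Poly m q ⊗[ℂ] Poly m q} (hz : z ∈ LinearMap.range ((homog m q k).subtype.rTensor (Poly m q))) :
    leftAct m q z f ∈ LinearMap.range ((homog m q l).subtype.rTensor (Poly m q)) := by
  obtain ⟨w, rfl⟩ := hz
  refine ⟨(f.restrict hf).rTensor (Poly m q) w, ?_⟩
  rw [leftAct_apply, ← LinearMap.rTensor_comp_apply, ← LinearMap.rTensor_comp_apply]
  rfl

omit hm hq hq1 in
theorem rightMul_mem {k : ℕ} (p : Poly m q)
    {z : Poly m q ⊗[ℂ] Poly m q} (hz : z ∈ LinearMap.range ((homog m q k).subtype.rTensor (Poly m q))) :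
    rightMul m q z p ∈ LinearMap.range ((homog m q k).subtype.rTensor (Poly m q)) := by
  obtain ⟨w, rfl⟩ := hz
  refine ⟨(LinearMap.mulRight ℂ p).lTensor _ w, ?_⟩
  rw [rightMul_apply, ← LinearMap.comp_apply, ← LinearMap.comp_apply, LinearMap.lTensor_comp_rTensor,
    LinearMap.rTensor_comp_lTensor]

theorem kernelSeq_mem (n : ℕ) : kernelSeq m q (n + 2) ∈
    LinearMap.range ((homog m q n).subtype.rTensor (Poly m q)) := by
  have h0 : kernelSeq m q 2 ∈ LinearMap.range ((homog m q 0).subtype.rTensor (Poly m q)) :=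
    ⟨⟨1, one_mem_homog⟩ ⊗ₜ 1, by simp [kernelSeq]⟩
  have hx : ∀ {k : ℕ}, kernelSeq m q (k + 2) ∈ LinearMap.range ((homog m q k).subtype.rTensor (Poly m q)) →
      contr m q (fun i j => rightMul m q (leftAct m q (kernelSeq m q (k + 2)) (xmul m q i)) (coord m q j)) ∈
        LinearMap.range ((homog m q (k + 1)).subtype.rTensor (Poly m q)) := fun h =>
    Submodule.sum_mem _ fun _ _ => Submodule.sum_mem _ fun _ _ => Submodule.smul_mem _ _ <|
      rightMul_mem _ (leftAct_mem (fun p hp => coord_mul_mem_homog _ hp) h)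
  induction n using Nat.twoStepInduction with
  | zero => exact h0
  | one =>
    rw [kernelSeq]
    refine Submodule.smul_mem _ _ (Submodule.add_mem _ (hx h0) (Submodule.smul_mem _ _ ?_))
    rw [show kernelSeq m q (0 + 1) = 0 from rfl, map_zero, LinearMap.zero_apply, map_zero,
      LinearMap.zero_apply]
    exact zero_mem _
  | more n ih1 ih2 =>
    rw [kernelSeq]
    refine Submodule.smul_mem _ _ (Submodule.add_mem _ (hx ih2) (Submodule.smul_mem _ _ ?_))
    refine rightMul_mem _ (leftAct_mem (fun p hp => ?_) ih1)
    rw [add_comm]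
    exact mul_mem_homog normSq_mem_homog hp

theorem isKernel_kernel : IsKernel m q (kernel m q) :=
  Classical.epsilon_spec ⟨fun l => kernelSeq m q (l + 2), by simp [kernelSeq],
    fun l => kernelSeq_mem hm hq hq1 l, fun l j => leftAct_partialD_kernelSeq hm hq hq1 (l + 2) j⟩

/-- Q(∂) exp = exp Q(y), with no reversal of order: the derivative applied last acts on the kernel
itself, so its y stands to the left of those already present. -/
theorem leftAct_diffOp_kernel (d l : ℕ) {Q : Poly m q} (hQ : Q ∈ homog m q d) :
    leftAct m q (kernel m q (l + d)) (diffOp hm hq hq1 Q) = rightMul m q (kernel m q l) Q := by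
  induction d generalizing l Q with
  | zero =>
    obtain ⟨r, rfl⟩ := mem_homog_zero hQ
    rw [AlgHom.commutes, Algebra.algebraMap_eq_smul_one, Algebra.algebraMap_eq_smul_one, map_smul, map_smul,
      leftAct_one, rightMul_one, add_zero]
  | succ d ih =>
    refine (homog_succ_le (S := LinearMap.eqLocus (leftAct m q (kernel m q (l + (d + 1))) ∘ₗ
      (diffOp hm hq hq1).toLinearMap) (rightMul m q (kernel m q l))) fun i p hp => ?_) hQ
    rw [LinearMap.mem_eqLocus, LinearMap.comp_apply,
      AlgHom.toLinearMap_apply, map_mul, leftAct_mul, show l + (d + 1) = l + 1 + d by ring, ih (l + 1) hp,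
      diffOp_coord, ← rightMul_leftAct, ← rightMul_rightMul]
    exact congrArg (fun z => rightMul m q z p) ((isKernel_kernel hm hq hq1).2.2 l i)

theorem kernelCoeff_mem (l : ℕ) (a : Module.Basis.ofVectorSpaceIndex ℂ (Poly m q)) :
    kernelCoeff m q l a ∈ homog m q l := by
  obtain ⟨w, hw⟩ := (isKernel_kernel hm hq hq1).2.1 l
  rw [kernelCoeff, ← hw]
  simp only [← LinearMap.comp_apply, LinearMap.lTensor_comp_rTensor]
  clear hw
  induction w with
  | zero => simp
  | tmul x y => simpa using Submodule.smul_mem _ _ x.2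
  | add x y hx hy => rw [map_add, map_add]; exact add_mem hx hy

-- The sum over basis coefficients is the functional applied to the x-variable, hence independent of
-- the basis. Finiteness of the support is proved along with it because `finsum` is additive only
-- for finite supports.
omit hm hq hq1 in
theorem finsum_coord_smul (Λ : Poly m q →ₗ[ℂ] ℂ) (z : Poly m q ⊗[ℂ] Poly m q) :
    (Function.support fun a => Λ (TensorProduct.rid ℂ (Poly m q)
      (((Module.Basis.ofVectorSpace ℂ (Poly m q)).coord a).lTensor (Poly m q) z)) •
        Module.Basis.ofVectorSpace ℂ (Poly m q) a).Finite ∧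
    ∑ᶠ a, Λ (TensorProduct.rid ℂ (Poly m q)
      (((Module.Basis.ofVectorSpace ℂ (Poly m q)).coord a).lTensor (Poly m q) z)) •
        Module.Basis.ofVectorSpace ℂ (Poly m q) a =
      TensorProduct.lid ℂ (Poly m q) (Λ.rTensor (Poly m q) z) := by
  set b := Module.Basis.ofVectorSpace ℂ (Poly m q)
  induction z with
  | zero => simp
  | tmul x y =>
    have h : ∀ a, Λ (TensorProduct.rid ℂ (Poly m q) ((b.coord a).lTensor (Poly m q) (x ⊗ₜ y))) • b a =
        Λ x • (b.repr y a • b a) := fun a => by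
      simp [smul_smul, mul_comm]
    simp only [h]
    have hsub : (Function.support fun a => Λ x • (b.repr y a • b a)) ⊆ ↑(b.repr y).support := fun a ha => by
      rw [Finset.mem_coe, Finsupp.mem_support_iff]
      rintro h0
      simp [h0] at ha
    refine ⟨(b.repr y).support.finite_toSet.subset hsub, ?_⟩
    rw [finsum_eq_sum_of_support_subset _ hsub, ← Finset.smul_sum]
    have := b.linearCombination_repr y
    rw [Finsupp.linearCombination_apply, Finsupp.sum] at this
    rw [this]
    simp
  | add x y hx hy =>
    simp only [map_add, add_smul]
    refine ⟨(hx.1.union hy.1).subset (Function.support_add _ _), ?_⟩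
    rw [finsum_add_distrib hx.1 hy.1, hx.2, hy.2]

/-- Q(∂) exp(x|y) at x = 0 is Q(y), read off from basis coefficients. -/
theorem finsum_kernelCoeff {d : ℕ} {Q : Poly m q} (hQ : Q ∈ homog m q d) (c : ℂ) :
    ∑ᶠ a, (c * evalZero m q (diffOp hm hq hq1 Q (kernelCoeff m q d a))) •
      Module.Basis.ofVectorSpace ℂ (Poly m q) a = c • Q := by
  have h := (finsum_coord_smul (c • ((evalZero m q).toLinearMap ∘ₗ diffOp hm hq hq1 Q)) (kernel m q d)).2
  have h2 := leftAct_diffOp_kernel hm hq hq1 d 0 hQ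
  rw [zero_add, (isKernel_kernel hm hq hq1).1] at h2
  rw [LinearMap.rTensor_smul, LinearMap.smul_apply, LinearMap.rTensor_comp_apply, ← leftAct_apply, h2,
    rightMul_apply, LinearMap.lTensor_tmul, LinearMap.rTensor_tmul] at h
  simp only [LinearMap.mulRight_apply, one_mul, AlgHom.toLinearMap_apply, map_one, map_smul,
    TensorProduct.lid_tmul, one_smul, LinearMap.smul_apply, LinearMap.comp_apply, smul_eq_mul] at h
  exact h

end kernel
end QEuclid

namespace QEuclid

/-! ### The `q`-Gamma function -/

section gamma
variable {q : ℝ} (hq : 0 < q) (hq1 : q < 1)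
include hq hq1

theorem summable_mul_pow (u : ℝ) : Summable fun k : ℕ => -(u * q ^ k) :=
  ((summable_geometric_of_lt_one hq.le hq1).mul_left u).neg

theorem qPochInf_pos {u : ℝ} (hu0 : 0 ≤ u) (hu : u < 1) : 0 < qPochInf u q := by
  have h : ∀ k : ℕ, 0 < 1 - u * q ^ k := fun k => by
    have := mul_le_mul hu.le (pow_le_one₀ hq.le hq1.le (n := k)) (by positivity) zero_le_one
    have h2 : u * q ^ k ≤ u := mul_le_of_le_one_right hu0 (pow_le_one₀ hq.le hq1.le)
    linarith
  have hs := Real.summable_log_one_add_of_summable (summable_mul_pow hq hq1 u)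
  simp only [← sub_eq_add_neg] at hs
  rw [qPochInf, ← Real.rexp_tsum_eq_tprod h hs]
  exact Real.exp_pos _

theorem qPochInf_eq_mul (u : ℝ) :
    qPochInf u q = (1 - u) * qPochInf (u * q) q := by
  have hm : Multipliable fun k : ℕ => 1 - u * q ^ (k + 1) := by
    have h := Real.multipliable_one_add_of_summable (f := fun k : ℕ => -(u * q ^ (k + 1)))
      ((summable_nat_add_iff 1).2 (summable_mul_pow hq hq1 u))
    simpa only [← sub_eq_add_neg] using h
  have h2 : ∏' k : ℕ, (1 - u * q ^ k) = (1 - u * q ^ 0) * ∏' k : ℕ, (1 - u * q ^ (k + 1)) :=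
    tprod_eq_zero_mul' hm
  have h3 : (fun k : ℕ => 1 - u * q ^ (k + 1)) = fun k : ℕ => 1 - u * q * q ^ k := by
    funext k; ring
  rw [h3, pow_zero, mul_one] at h2
  exact h2

theorem qGamma_pos {t : ℝ} (ht : 0 < t) : 0 < qGamma q t := by
  have h1 := qPochInf_pos hq hq1 hq.le hq1
  have h2 := qPochInf_pos hq hq1 (Real.rpow_nonneg hq.le t) (Real.rpow_lt_one hq.le hq1 ht)
  have h3 := Real.rpow_pos_of_pos (sub_pos.2 hq1) (1 - t)
  rw [qGamma]
  positivity

theorem qGamma_add_one {t : ℝ} (ht : 0 < t) : qGamma q (t + 1) = qNum q t * qGamma q t := by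
  have h := qPochInf_eq_mul hq hq1 (q ^ t)
  have h2 := qPochInf_pos hq hq1 (Real.rpow_nonneg hq.le (t + 1))
    (Real.rpow_lt_one hq.le hq1 (by linarith))
  have h3 : (1 - q) ^ (1 - t) = (1 - q) * (1 - q) ^ (1 - (t + 1)) := by
    rw [show 1 - t = 1 + (1 - (t + 1)) by ring, Real.rpow_add (sub_pos.2 hq1), Real.rpow_one]
  rw [← Real.rpow_add_one hq.ne'] at h
  have h4 : 1 - q ^ t ≠ 0 := (sub_pos.2 (Real.rpow_lt_one hq.le hq1 ht)).ne'
  have h5 : 1 - q ≠ 0 := (sub_pos.2 hq1).ne'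
  have h6 : qNum q t = (1 - q ^ t) / (1 - q) := by
    rw [qNum, ← neg_sub, ← neg_sub 1 q, neg_div_neg_eq]
  rw [qGamma, qGamma, h, h3, h6]
  field_simp

end gamma

/-! ### The integral over the sphere -/

section sphere
variable {m : ℕ} {q : ℝ} (hm : 1 ≤ m) (hq : 0 < q) (hq1 : q < 1)

theorem contr_const_mul (c : ℂ) (t : Fin m → Fin m → ℂ) :
    contr m q (fun a b => c * t a b) = c * contr m q t := contr_smul c t

include hm hq hq1

/-- The factor is the ratio of consecutive denominators in the Pizzetti formula, which is why 𝐱² is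
invisible to the spherical integral. -/
theorem evalZero_laplace_pow_normSq_mul (n : ℕ) {R : Poly m q} (hR : R ∈ homog m q (2 * n)) :
    evalZero m q ((laplace m q ^ (n + 1)) (normSq m q * R)) =
      ((mu m q ^ 2 * qNum (q ^ 2) (n + 1) * qNum (q ^ 2) (n + (m : ℝ) / 2) : ℝ) : ℂ) *
        evalZero m q ((laplace m q ^ n) R) := by
  have hmc : ∀ (f : Poly m q →ₗ[ℂ] ℂ) (t : Fin m → Fin m → Poly m q),
      f (contr m q t) = contr m q fun i j => f (t i j) := fun f t => map_contr f t
  have h0 := hmc ((evalZero m q).toLinearMap ∘ₗ laplace m q ^ (n + 1))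
    (fun a b => coord m q a * (coord m q b * R))
  simp only [LinearMap.comp_apply, AlgHom.toLinearMap_apply] at h0
  rw [normSq_mul, h0]
  simp only [evalZero_laplace_pow_coord_mul hm hq hq1, ← partialD_laplace_pow hm hq hq1]
  obtain ⟨r, hr⟩ := mem_homog_zero (laplace_pow_mem_homog hm hq hq1 n (k := 0) (by rwa [zero_add]))
  have hε : evalZero m q ((laplace m q ^ n) R) = r := by rw [← hr, AlgHom.commutes]; rfl
  have hd : ∀ a b, evalZero m q (partialD m q a (coord m q b * (laplace m q ^ n) R)) =
      (metric m q a b : ℂ) • r := fun a b => by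
    rw [partialD_coord_mul hm hq hq1, ← hr]
    simp only [partialD_homog_zero hm hq hq1 (p := algebraMap ℂ (Poly m q) r)
      (by rw [hr]; exact laplace_pow_mem_homog hm hq hq1 n (k := 0) (by rwa [zero_add])), mul_zero,
      act_zero, smul_zero, add_zero, map_smul, AlgHom.commutes]
    rfl
  have hq2 : q ^ 2 ≠ 1 := by nlinarith
  -- Since the trace of the metric is μ [m/2], this is [n + m/2] = [n] + q^(2n) [m/2] in base q².
  have hQ : metricSq m q * q ^ (2 * n) + mu m q * qNum (q ^ 2) n =
      mu m q * qNum (q ^ 2) (n + (m : ℝ) / 2) := by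
    have h1 := metricSq_mul hq m
    have h2 : q ^ 2 - 1 ≠ 0 := sub_ne_zero.2 hq2
    have h3 : mu m q = 1 + q ^ 2 * (q ^ m)⁻¹ := by rw [mu_eq hq]; ring
    have h4 : (q ^ 2) ^ ((n : ℝ) + (m : ℝ) / 2) = q ^ (2 * n) * q ^ m := by
      rw [Real.rpow_add (by positivity), Real.rpow_natCast, ← pow_mul, ← Real.rpow_natCast q 2,
        ← Real.rpow_mul hq.le]
      congr 1
      rw [← Real.rpow_natCast]
      congr 1
      push_cast
      ring
    rw [qNum_natCast, qNum, h4, ← pow_mul]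
    field_simp
    rw [h3] at *
    linear_combination (-q ^ (2 * n)) * h1
  cases n with
  | zero =>
    have hQ' : (mu m q : ℂ) * (qNum (q ^ 2) ((0 : ℕ) + (m : ℝ) / 2) : ℝ) = metricSq m q := by
      rw [← Complex.ofReal_mul, ← hQ]; simp [qNum_zero]
    rw [hε]
    simp only [pow_zero, Module.End.one_apply] at hd ⊢
    simp only [hd, ← smul_eq_mul (a := ((mu m q * qNum (q ^ 2) ((0 : ℕ) + 1) : ℝ) : ℂ)), contr_smul,
      contr_metric]
    simp only [smul_eq_mul]
    push_cast at hQ' ⊢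
    linear_combination (mu m q : ℂ) * (qNum (q ^ 2) (0 + 1) : ℝ) * r * (-hQ')
  | succ n =>
    have h1 : ∀ a b, evalZero m q (partialD m q a ((laplace m q ^ (n + 1)) (coord m q b * R))) =
        ((mu m q * qNum (q ^ 2) (n + 1) : ℝ) : ℂ) * evalZero m q
          (partialD m q a (partialD m q b ((laplace m q ^ n) R))) +
        (q : ℂ) ^ (2 * (n + 1)) * ((metric m q a b : ℂ) • r) := fun a b => by
      rw [laplace_pow_coord_mul hm hq hq1, map_add, map_add, map_smul, map_smul, map_smul, map_smul, hd,
        smul_eq_mul, smul_eq_mul]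
    have h2 := hmc (evalZero m q).toLinearMap (fun a b => partialD m q a (partialD m q b ((laplace m q ^ n) R)))
    simp only [AlgHom.toLinearMap_apply] at h2
    rw [← laplace_apply, ← laplace_pow_succ, hε] at h2
    have hQ' := congrArg (fun t : ℝ => (t : ℂ)) hQ
    have h3 : contr m q (fun a b => evalZero m q (partialD m q a ((laplace m q ^ (n + 1))
        (coord m q b * R)))) = ((mu m q * qNum (q ^ 2) (n + 1) : ℝ) : ℂ) * r +
        (q : ℂ) ^ (2 * (n + 1)) * ((metricSq m q : ℂ) * r) := by
      simp only [h1, contr_const_mul, contr_add]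
      rw [← h2, contr_metric, smul_eq_mul]
    rw [contr_const_mul, h3, hε]
    push_cast at hQ' ⊢
    linear_combination (mu m q : ℂ) * (qNum (q ^ 2) (n + 1 + 1) : ℝ) * r * hQ'

theorem sphereInt_of_homog (n : ℕ) {R : Poly m q} (hR : R ∈ homog m q (2 * n)) :
    sphereInt m q R = ((2 * qGamma (q ^ 2) (1 / 2) ^ m /
      (mu m q ^ (2 * n) * qFactorial (q ^ 2) n * qGamma (q ^ 2) ((n : ℝ) + (m : ℝ) / 2)) : ℝ) : ℂ) *
      evalZero m q ((laplace m q ^ n) R) := by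
  rw [sphereInt, finsum_eq_single _ n fun k hk => ?_]
  rw [evalZero_laplace_pow hm hq hq1 k (by omega) hR, mul_zero]

theorem sphereInt_of_odd (n : ℕ) {R : Poly m q} (hR : R ∈ homog m q (2 * n + 1)) :
    sphereInt m q R = 0 := by
  rw [sphereInt, finsum_eq_zero_of_forall_eq_zero fun k => ?_]
  rw [evalZero_laplace_pow hm hq hq1 k (by omega) hR, mul_zero]

theorem sphereInt_normSq_mul {n : ℕ} {R : Poly m q} (hR : R ∈ homog m q n) :
    sphereInt m q (normSq m q * R) = sphereInt m q R := by
  have hx := mul_mem_homog normSq_mem_homog hR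
  obtain ⟨k, rfl | rfl⟩ := Nat.even_or_odd' n
  · rw [sphereInt_of_homog hm hq hq1 k hR, sphereInt_of_homog hm hq hq1 (k + 1)
      (by rwa [show 2 * (k + 1) = 2 + 2 * k by ring]), evalZero_laplace_pow_normSq_mul hm hq hq1 k hR,
      ← mul_assoc, ← Complex.ofReal_mul]
    congr 2
    have hm0 : (0 : ℝ) < m := by exact_mod_cast hm
    have hq2 : 0 < q ^ 2 := by positivity
    have hq21 : q ^ 2 < 1 := by nlinarith
    have hG := qGamma_pos hq2 hq21 (t := (k : ℝ) + (m : ℝ) / 2) (by positivity)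
    have hN := qNum_pos hq2 hq21 (u := (k : ℝ) + (m : ℝ) / 2) (by positivity)
    have hN1 := qNum_pos hq2 hq21 (u := (k : ℝ) + 1) (by positivity)
    have hF := qFactorial_pos hq2 hq21 k
    have hmu := mu_pos (m := m) hq
    rw [qFactorial_succ, Nat.cast_succ, show (k : ℝ) + 1 + (m : ℝ) / 2 = (k + (m : ℝ) / 2) + 1 by ring,
      qGamma_add_one hq2 hq21 (by positivity)]
    generalize (k : ℝ) + (m : ℝ) / 2 = t at *
    field_simp
    ring
  · rw [sphereInt_of_odd hm hq hq1 k hR, sphereInt_of_odd hm hq hq1 (k + 1)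
      (by rwa [show 2 * (k + 1) + 1 = 2 + (2 * k + 1) by ring])]

theorem sphereInt_normSq_pow_mul (i : ℕ) {n : ℕ} {R : Poly m q} (hR : R ∈ homog m q n) :
    sphereInt m q (normSq m q ^ i * R) = sphereInt m q R := by
  induction i with
  | zero => rw [pow_zero, one_mul]
  | succ i ih =>
    rw [pow_succ', mul_assoc, sphereInt_normSq_mul hm hq hq1
      (mul_mem_homog (normSq_pow_mem_homog i) hR), ih]

omit hm hq hq1 in
theorem sphereInt_smul (c : ℂ) (R : Poly m q) : sphereInt m q (c • R) = c * sphereInt m q R := by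
  simp only [sphereInt, map_smul, smul_eq_mul, mul_left_comm _ c]
  exact (smul_finsum c _).symm

end sphere
end QEuclid

namespace QEuclid

/-! ### The Fourier transform in terms of moments -/

section monomial
variable {R : Type*} [Semiring R]

theorem coeff_monomial_mul_of_lt {k n : ℕ} (h : n < k) (a : R) (F : R⟦X⟧) :
    PowerSeries.coeff n (PowerSeries.monomial k a * F) = 0 := by
  rw [PowerSeries.coeff_mul]
  refine Finset.sum_eq_zero fun p hp => ?_
  rw [Finset.HasAntidiagonal.mem_antidiagonal] at hp
  rw [PowerSeries.coeff_monomial, if_neg (by omega), zero_mul]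

theorem coeff_monomial_mul_add (k n : ℕ) (a : R) (F : R⟦X⟧) :
    PowerSeries.coeff (k + n) (PowerSeries.monomial k a * F) = a * PowerSeries.coeff n F := by
  rw [PowerSeries.coeff_mul, Finset.sum_eq_single (k, n)]
  · rw [PowerSeries.coeff_monomial_same]
  · rintro ⟨i, j⟩ hp hne
    rw [Finset.HasAntidiagonal.mem_antidiagonal] at hp
    rw [PowerSeries.coeff_monomial, if_neg, zero_mul]
    rintro rfl
    exact hne (Prod.ext rfl (by simpa using hp))
  · intro h
    exact absurd (by simp) h

theorem coeff_mul_monomial_of_lt {k n : ℕ} (h : n < k) (a : R) (F : R⟦X⟧) :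
    PowerSeries.coeff n (F * PowerSeries.monomial k a) = 0 := by
  rw [PowerSeries.coeff_mul]
  refine Finset.sum_eq_zero fun p hp => ?_
  rw [Finset.HasAntidiagonal.mem_antidiagonal] at hp
  rw [PowerSeries.coeff_monomial, if_neg (by omega), mul_zero]

theorem coeff_mul_monomial_add (k n : ℕ) (a : R) (F : R⟦X⟧) :
    PowerSeries.coeff (n + k) (F * PowerSeries.monomial k a) = PowerSeries.coeff n F * a := by
  rw [PowerSeries.coeff_mul, Finset.sum_eq_single (n, k)]
  · rw [PowerSeries.coeff_monomial_same]
  · rintro ⟨i, j⟩ hp hne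
    rw [Finset.HasAntidiagonal.mem_antidiagonal] at hp
    rw [PowerSeries.coeff_monomial, if_neg, mul_zero]
    rintro rfl
    exact hne (Prod.ext (by simpa using hp) rfl)
  · intro h
    exact absurd (by simp) h

end monomial

section fourier
variable {m : ℕ} {q : ℝ}

theorem coeff_complex_smul (c : ℂ) (F : (Poly m q)⟦X⟧) (n : ℕ) :
    PowerSeries.coeff n (c • F) = c • PowerSeries.coeff n F := rfl

theorem coeff_radial_even (φ : ℂ⟦X⟧) (i : ℕ) :
    PowerSeries.coeff (2 * i) (radial m q φ) = PowerSeries.coeff i φ • normSq m q ^ i := by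
  rw [radial, PowerSeries.coeff_mk, if_pos (even_two_mul i), Nat.mul_div_cancel_left i two_pos]

theorem coeff_radial_odd (φ : ℂ⟦X⟧) {n : ℕ} (hn : ¬ Even n) :
    PowerSeries.coeff n (radial m q φ) = 0 := by
  rw [radial, PowerSeries.coeff_mk, if_neg hn]

/-- The moment `∫_0^{γ·∞} d_q r r^n ψ(r²)`. -/
def radialMoment (q γ : ℝ) (ψ : ℂ⟦X⟧) (n : ℕ) : ℂ :=
  jacksonInfty q γ fun r => (r : ℂ) ^ n * evalSeries ψ (r ^ 2)

theorem jacksonInfty_mul_right (γ : ℝ) (f : ℝ → ℂ) (c : ℂ) :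
    jacksonInfty q γ (fun r => f r * c) = jacksonInfty q γ f * c := by
  rw [jacksonInfty, jacksonInfty, mul_assoc, ← tsum_mul_right]
  congr 2
  funext k
  ring

variable (hm : 1 ≤ m) (hq : 0 < q) (hq1 : q < 1)
include hm hq hq1

/-- Every power of 𝐱² is central and drops out of the spherical integral, so all coefficients of ψ
share the factor `sphereInt m q (S * K)` and resum to ψ(r²). -/
theorem spaceInt_monomial_mul_radial_mul_monomial (γ : ℝ) {k l : ℕ} {S K : Poly m q}
    (hS : S ∈ homog m q k) (hK : K ∈ homog m q l) (ψ : ℂ⟦X⟧) :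
    spaceInt m q γ (PowerSeries.monomial k S * radial m q ψ * PowerSeries.monomial l K) =
      radialMoment q γ ψ (m - 1 + k + l) * sphereInt m q (S * K) := by
  rw [spaceInt, radialMoment, ← jacksonInfty_mul_right]
  congr 1
  funext r
  have hg : Function.Injective fun i : ℕ => k + 2 * i + l := fun i j h => by
    simp only at h; omega
  have he : ∀ i : ℕ, (r : ℂ) ^ (k + 2 * i + l) * sphereInt m q (PowerSeries.coeff (k + 2 * i + l)
      (PowerSeries.monomial k S * radial m q ψ * PowerSeries.monomial l K)) =
      (r : ℂ) ^ (k + l) * (PowerSeries.coeff i ψ * ((r ^ 2 : ℝ) : ℂ) ^ i * sphereInt m q (S * K)) := fun i => by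
    rw [coeff_mul_monomial_add, coeff_monomial_mul_add, coeff_radial_even, mul_smul_comm, smul_mul_assoc,
      sphereInt_smul, (commute_normSq hm hq hq1 S).pow_left i |>.symm.eq, mul_assoc,
      sphereInt_normSq_pow_mul hm hq hq1 i (mul_mem_homog hS hK)]
    push_cast
    ring
  rw [← hg.tsum_eq, evalSeries]
  · rw [tsum_congr he, tsum_mul_left, tsum_mul_right]
    ring
  · intro n hn
    by_contra h
    apply hn
    have h0 : PowerSeries.coeff n (PowerSeries.monomial k S * radial m q ψ * PowerSeries.monomial l K) = 0 := by
      rcases lt_or_ge n l with h1 | h1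
      · exact coeff_mul_monomial_of_lt h1 _ _
      obtain ⟨n, rfl⟩ := Nat.exists_eq_add_of_le' h1
      rw [coeff_mul_monomial_add]
      rcases lt_or_ge n k with h2 | h2
      · rw [coeff_monomial_mul_of_lt h2, zero_mul]
      obtain ⟨n, rfl⟩ := Nat.exists_eq_add_of_le h2
      rw [coeff_monomial_mul_add, coeff_radial_odd, mul_zero, zero_mul]
      rintro ⟨j, rfl⟩
      exact h ⟨j, by simp only; omega⟩
    have h3 := sphereInt_smul (m := m) (q := q) 0 0
    rw [zero_smul, zero_mul] at h3
    simp only [h0, h3, mul_zero]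

/-- Only Δ^(i+k) survives in the Pizzetti formula. Adjointness uses k of the Laplacians to turn S
into S(∂); the other i are 𝐱²ⁱ(∂), and [i+k]! cancels. -/
theorem sphereInt_sphHarm_mul {k : ℕ} (i : ℕ) {S K : Poly m q} (hS : S ∈ sphHarm m q k)
    (hK : K ∈ homog m q (k + 2 * i)) :
    sphereInt m q (S * K) = ((2 * qGamma (q ^ 2) (1 / 2) ^ m /
      (mu m q ^ (k + 2 * i) * qFactorial (q ^ 2) i * qGamma (q ^ 2) ((k : ℝ) + i + (m : ℝ) / 2)) : ℝ) : ℂ) *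
      evalZero m q (diffOp hm hq hq1 (normSq m q ^ i * S) K) := by
  have hF : ∀ n, (qFactorial (q ^ 2) n : ℂ) ≠ 0 := fun n => by
    exact_mod_cast (qFactorial_pos (by positivity) (by nlinarith) n).ne'
  have hmu : (mu m q : ℂ) ≠ 0 := by exact_mod_cast (mu_pos hq).ne'
  have h := evalZero_laplace_pow_sphHarm_mul hm hq hq1 i k hS K
  have h2 := mul_mem_homog hS.1 hK
  rw [show k + (k + 2 * i) = 2 * (i + k) by ring] at h2
  have h3 : evalZero m q ((laplace m q ^ (i + k)) (S * K)) =
      (mu m q : ℂ) ^ k * (qFactorial (q ^ 2) (i + k) : ℂ) *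
        evalZero m q ((laplace m q ^ i) (diffOp hm hq hq1 S K)) / (qFactorial (q ^ 2) i : ℂ) := by
    rw [← h, mul_div_cancel_left₀ _ (hF i)]
  rw [sphereInt_of_homog hm hq hq1 (i + k) h2, h3, map_mul, map_pow, diffOp_normSq, Module.End.mul_apply,
    Nat.cast_add, add_comm (i : ℝ) k, show 2 * (i + k) = k + 2 * i + k by ring]
  push_cast
  rw [pow_add _ (k + 2 * i) k]
  have := hF i
  have := hF (i + k)
  field_simp

/-- Either the parity is wrong, or l < k and a harmonic is orthogonal to lower degrees. -/
theorem sphereInt_sphHarm_mul_eq_zero {k l : ℕ} (hl : ∀ i, l ≠ k + 2 * i) {S K : Poly m q}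
    (hS : S ∈ sphHarm m q k) (hK : K ∈ homog m q l) : sphereInt m q (S * K) = 0 := by
  have h2 := mul_mem_homog hS.1 hK
  obtain ⟨n, hn | hn⟩ := Nat.even_or_odd' (k + l)
  · rw [hn] at h2
    rw [sphereInt_of_homog hm hq hq1 n h2, evalZero_laplace_pow_sphHarm_mul_of_lt hm hq hq1 n k _ hS,
      mul_zero]
    by_contra h
    exact hl (n - k) (by omega)
  · rw [hn] at h2
    exact sphereInt_of_odd hm hq hq1 n h2

omit hm hq hq1 in
variable (m q) in
/-- The power series of the Fourier transform of the radial part of `S_k(𝐱) ψ(𝐱²)`. -/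
def bochnerSeries (γ : ℝ) (k : ℕ) (ψ : ℂ⟦X⟧) : ℂ⟦X⟧ :=
  PowerSeries.mk fun i =>
    (((1 + q) / (mu m q ^ ((m : ℝ) / 2) * mu m q ^ (k + 2 * i)) * ((-1) ^ i /
      (qFactorial (q ^ 2) i * qGamma (q ^ 2) ((k : ℝ) + i + (m : ℝ) / 2))) : ℝ) : ℂ) *
      radialMoment q γ ψ (m - 1 + 2 * k + 2 * i)

theorem fourier1_eq (β : ℝ) (s : ℤˣ) {k : ℕ} {S : Poly m q} (hS : S ∈ sphHarm m q k) (ψ : ℂ⟦X⟧) :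
    fourier1 m q β s (PowerSeries.monomial k S * radial m q ψ) =
      (((s : ℤ) : ℂ) * Complex.I) ^ k • (PowerSeries.monomial k S *
        radial m q (bochnerSeries m q (√(mu m q / ((1 - q ^ 2) * β))) k ψ)) := by
  set γ := √(mu m q / ((1 - q ^ 2) * β)) with hγ
  refine PowerSeries.ext fun l => ?_
  rw [fourier1, PowerSeries.coeff_mk, coeff_complex_smul, ← hγ]
  simp only [fun a => spaceInt_monomial_mul_radial_mul_monomial hm hq hq1 γ hS.1
    (kernelCoeff_mem hm hq hq1 l a) ψ]
  by_cases hl : ∃ i, l = k + 2 * i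
  · obtain ⟨i, rfl⟩ := hl
    simp only [fun a => sphereInt_sphHarm_mul hm hq hq1 i hS (kernelCoeff_mem hm hq hq1 (k + 2 * i) a),
      ← mul_assoc]
    have hQ : normSq m q ^ i * S ∈ homog m q (k + 2 * i) := by
      rw [add_comm]; exact mul_mem_homog (normSq_pow_mem_homog i) hS.1
    rw [finsum_kernelCoeff hm hq hq1 hQ, coeff_monomial_mul_add, coeff_radial_even, smul_smul,
      mul_smul_comm, smul_smul, ((commute_normSq hm hq hq1 S).pow_left i).symm.eq, bochnerSeries,
      PowerSeries.coeff_mk]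
    congr 1
    -- The alternating sign of the Bessel series; it does not depend on the sign of the transform.
    have hs : (((s : ℤ) : ℂ) * Complex.I) ^ (k + 2 * i) = (((s : ℤ) : ℂ) * Complex.I) ^ k * (-1) ^ i := by
      rw [pow_add, pow_mul]
      congr 2
      rw [mul_pow, Complex.I_sq, ← Int.cast_pow, ← Units.val_pow_eq_pow_val, Int.units_sq]
      simp
    have hG : (qGamma (q ^ 2) (1 / 2) : ℂ) ≠ 0 := by
      exact_mod_cast (qGamma_pos (by positivity) (by nlinarith) (by norm_num)).ne'
    rw [hs, show m - 1 + k + (k + 2 * i) = m - 1 + 2 * k + 2 * i by ring]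
    push_cast
    have hG' : (qGamma (q ^ 2) (1 / 2) : ℂ) ^ m ≠ 0 := pow_ne_zero _ hG
    generalize (qGamma (q ^ 2) (1 / 2) : ℂ) ^ m = G at *
    generalize ((mu m q ^ ((m : ℝ) / 2) : ℝ) : ℂ) = M
    field_simp
  · push Not at hl
    simp only [fun a => sphereInt_sphHarm_mul_eq_zero hm hq hq1 hl hS (kernelCoeff_mem hm hq hq1 l a),
      mul_zero, zero_smul, finsum_zero, smul_zero]
    symm
    rcases lt_or_ge l k with h2 | h2
    · rw [coeff_monomial_mul_of_lt h2, smul_zero]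
    obtain ⟨n, rfl⟩ := Nat.exists_eq_add_of_le h2
    rw [coeff_monomial_mul_add, coeff_radial_odd, mul_zero, smul_zero]
    rintro ⟨j, rfl⟩
    exact hl j (by omega)

end fourier
end QEuclid

namespace QEuclid

/-! ### Radial power series -/

section radial
variable {m : ℕ} {q : ℝ}

theorem radial_mul (φ χ : ℂ⟦X⟧) : radial m q (φ * χ) = radial m q φ * radial m q χ := by
  refine PowerSeries.ext fun n => ?_
  rw [PowerSeries.coeff_mul]
  obtain ⟨n, rfl | rfl⟩ := Nat.even_or_odd' n
  · rw [coeff_radial_even, PowerSeries.coeff_mul, Finset.sum_smul]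
    refine Finset.sum_of_injOn (fun p : ℕ × ℕ => (2 * p.1, 2 * p.2)) ?_ ?_ ?_ ?_
    · rintro ⟨a, b⟩ _ ⟨c, d⟩ _ h
      simp only [Prod.mk.injEq] at h ⊢
      omega
    · rintro ⟨a, b⟩ h
      simp only [Finset.mem_coe, Finset.HasAntidiagonal.mem_antidiagonal] at h ⊢
      omega
    · rintro ⟨a, b⟩ h hne
      simp only [Finset.HasAntidiagonal.mem_antidiagonal] at h
      rcases Nat.even_or_odd a with ha | ha
      · obtain ⟨c, rfl⟩ := ha
        refine absurd ⟨(c, n - c), ?_, ?_⟩ hne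
        · simp only [Finset.mem_coe, Finset.HasAntidiagonal.mem_antidiagonal]; omega
        · simp only [Prod.mk.injEq]; omega
      · rw [coeff_radial_odd φ (Nat.not_even_iff_odd.2 ha), zero_mul]
    · rintro ⟨a, b⟩ h
      simp only [Finset.HasAntidiagonal.mem_antidiagonal] at h
      simp only [coeff_radial_even, ← h, pow_add, smul_mul_assoc, mul_smul_comm, smul_smul,
        mul_comm (PowerSeries.coeff b χ)]
  · rw [coeff_radial_odd _ (by simp)]
    refine (Finset.sum_eq_zero fun p hp => ?_).symm
    rw [Finset.HasAntidiagonal.mem_antidiagonal] at hp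
    rcases Nat.even_or_odd p.1 with ha | ha
    · rw [coeff_radial_odd χ (fun hb => ?_), mul_zero]
      have := ha.add hb
      rw [hp] at this
      simp at this
    · rw [coeff_radial_odd φ (Nat.not_even_iff_odd.2 ha), zero_mul]

theorem radial_one : radial m q 1 = 1 := by
  refine PowerSeries.ext fun n => ?_
  obtain ⟨n, rfl | rfl⟩ := Nat.even_or_odd' n
  · rw [coeff_radial_even, PowerSeries.coeff_one, PowerSeries.coeff_one]
    rcases n with _ | n <;> simp
  · rw [coeff_radial_odd _ (by simp), PowerSeries.coeff_one, if_neg (by omega)]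

theorem monomial_mul_radial_mem_polySeries {k : ℕ} {S : Poly m q} (hS : S ∈ homog m q k) {φ : ℂ⟦X⟧} {N : ℕ}
    (hφ : ∀ n, N < n → PowerSeries.coeff n φ = 0) :
    PowerSeries.monomial k S * radial m q φ ∈ polySeries m q := by
  refine ⟨fun n => ?_, k + 2 * N, fun n hn => ?_⟩
  · rcases lt_or_ge n k with h | h
    · rw [coeff_monomial_mul_of_lt h]; exact zero_mem _
    obtain ⟨n, rfl⟩ := Nat.exists_eq_add_of_le h
    rw [coeff_monomial_mul_add]
    obtain ⟨n, rfl | rfl⟩ := Nat.even_or_odd' n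
    · rw [coeff_radial_even]
      exact mul_mem_homog hS (Submodule.smul_mem _ _ (normSq_pow_mem_homog n))
    · rw [coeff_radial_odd _ (by simp), mul_zero]; exact zero_mem _
  · obtain ⟨n, rfl⟩ := Nat.exists_eq_add_of_le (show k ≤ n by omega)
    rw [coeff_monomial_mul_add]
    obtain ⟨n, rfl | rfl⟩ := Nat.even_or_odd' n
    · rw [coeff_radial_even, hφ n (by omega), zero_smul, mul_zero]
    · rw [coeff_radial_odd _ (by simp), mul_zero]

variable (hm : 1 ≤ m) (hq : 0 < q) (hq1 : q < 1)
include hm hq hq1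

theorem radial_mul_monomial (k : ℕ) (S : Poly m q) (φ : ℂ⟦X⟧) :
    radial m q φ * PowerSeries.monomial k S = PowerSeries.monomial k S * radial m q φ := by
  refine PowerSeries.ext fun n => ?_
  rcases lt_or_ge n k with h | h
  · rw [coeff_monomial_mul_of_lt h, coeff_mul_monomial_of_lt h]
  obtain ⟨n, rfl⟩ := Nat.exists_eq_add_of_le h
  rw [coeff_monomial_mul_add, add_comm, coeff_mul_monomial_add]
  obtain ⟨n, rfl | rfl⟩ := Nat.even_or_odd' n
  · rw [coeff_radial_even, smul_mul_assoc, mul_smul_comm, ((commute_normSq hm hq hq1 S).pow_left n).eq]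
  · rw [coeff_radial_odd _ (by simp), mul_zero, zero_mul]

/-- χ is invertible, and the coefficients of ψ/χ multiply the elements 𝐱^(2n) S, none of which is
zero; boundedness of the degree of P then makes ψ/χ a polynomial. -/
theorem exists_polynomial_mul {k : ℕ} {S : Poly m q} (hS : S ∈ sphHarm m q k) (hS0 : S ≠ 0) {ψ χ : ℂ⟦X⟧}
    (hχ : PowerSeries.constantCoeff χ ≠ 0) {P : (Poly m q)⟦X⟧} (hP : P ∈ polySeries m q)
    (h : PowerSeries.monomial k S * radial m q ψ = P * radial m q χ) :
    ∃ G : Polynomial ℂ, ψ = (G : ℂ⟦X⟧) * χ := by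
  have hχχ : χ * χ⁻¹ = 1 := PowerSeries.mul_inv_cancel χ hχ
  have h2 : PowerSeries.monomial k S * radial m q (ψ * χ⁻¹) = P := by
    rw [radial_mul, ← mul_assoc, h, mul_assoc, ← radial_mul, hχχ, radial_one, mul_one]
  obtain ⟨N, hN⟩ := hP.2
  have h3 : ∀ n, N + 1 ≤ n → PowerSeries.coeff n (ψ * χ⁻¹) = 0 := fun n hn => by
    have h4 := hN (k + 2 * n) (by omega)
    rw [← h2, coeff_monomial_mul_add, coeff_radial_even, mul_smul_comm,
      ← ((commute_normSq hm hq hq1 S).pow_left n).eq] at h4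
    exact (smul_eq_zero.1 h4).resolve_right (normSq_pow_mul_sphHarm_ne_zero hm hq hq1 hS hS0 n)
  refine ⟨PowerSeries.trunc (N + 1) (ψ * χ⁻¹), ?_⟩
  have h5 : ((PowerSeries.trunc (N + 1) (ψ * χ⁻¹) : Polynomial ℂ) : ℂ⟦X⟧) = ψ * χ⁻¹ := by
    refine PowerSeries.ext fun n => ?_
    rw [Polynomial.coeff_coe, PowerSeries.coeff_trunc]
    split_ifs with hn
    · rfl
    · rw [h3 n (by omega)]
  rw [h5, mul_assoc, mul_comm χ⁻¹, hχχ, mul_one]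

end radial

/-! ### The `q`-exponential functions -/

section qexp
variable {p : ℝ} (hp : 0 < p) (hp1 : p < 1)

variable (p) in
/-- The coefficients of `E_p`. -/
def qExpCoeff (j : ℕ) : ℝ := p ^ j.choose 2 / qFactorial p j

include hp hp1

theorem one_le_qNum (n : ℕ) : 1 ≤ qNum p (n + 1) := by
  rw [qNum_add_one hp hp1.ne]
  have : 0 ≤ qNum p n := by
    rcases Nat.eq_zero_or_pos n with rfl | h
    · simp [qNum_zero]
    · exact (qNum_pos hp hp1 (by exact_mod_cast h)).le
  nlinarith

theorem one_le_qFactorial (n : ℕ) : 1 ≤ qFactorial p n := by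
  induction n with
  | zero => rw [qFactorial_zero]
  | succ n ih => rw [qFactorial_succ]; nlinarith [one_le_qNum hp hp1 n]

theorem qExpCoeff_pos (j : ℕ) : 0 < qExpCoeff p j :=
  div_pos (pow_pos hp _) (qFactorial_pos hp hp1 j)

theorem qExpCoeff_succ (j : ℕ) : qExpCoeff p (j + 1) = p ^ j / qNum p (j + 1) * qExpCoeff p j := by
  have h1 := (qFactorial_pos hp hp1 j).ne'
  have h2 := (qNum_pos hp hp1 (u := (j : ℝ) + 1) (by positivity)).ne'
  rw [qExpCoeff, qExpCoeff, qFactorial_succ, Nat.choose_succ_succ' j 1, Nat.choose_one_right, pow_add]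
  field_simp

theorem summable_qExpCoeff (z : ℝ) : Summable fun j => |qExpCoeff p j * z ^ j| := by
  have ht : Filter.Tendsto (fun j : ℕ => p ^ j * |z|) Filter.atTop (𝓝 0) := by
    simpa using (tendsto_pow_atTop_nhds_zero_of_lt_one hp.le hp1).mul_const |z|
  refine (summable_of_ratio_norm_eventually_le (r := 1 / 2) (by norm_num) ?_)
  filter_upwards [ht.eventually (gt_mem_nhds (show (0 : ℝ) < 1 / 2 by norm_num))] with j hj
  have h0 := qExpCoeff_pos hp hp1 j
  have h1 := one_le_qNum hp hp1 j
  rw [Real.norm_eq_abs, Real.norm_eq_abs, abs_abs, abs_abs, qExpCoeff_succ hp hp1, pow_succ, abs_mul, abs_mul,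
    abs_mul, abs_mul, abs_of_pos h0, abs_of_pos (by positivity : 0 < p ^ j / qNum p (j + 1))]
  have h2 : p ^ j / qNum p (j + 1) ≤ p ^ j := div_le_self (by positivity) h1
  calc p ^ j / qNum p (j + 1) * qExpCoeff p j * (|z ^ j| * |z|)
      ≤ p ^ j * qExpCoeff p j * (|z ^ j| * |z|) := by gcongr
    _ = (p ^ j * |z|) * (qExpCoeff p j * |z ^ j|) := by ring
    _ ≤ 1 / 2 * (qExpCoeff p j * |z ^ j|) := by gcongr

omit hp hp1 in
theorem qExp_eq (z : ℝ) : qExp p z = ∑' j, qExpCoeff p j * z ^ j :=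
  tsum_congr fun j => by rw [qExpCoeff]; ring

theorem hasSum_qExp (z : ℝ) : HasSum (fun j => qExpCoeff p j * z ^ j) (qExp p z) := by
  rw [qExp_eq]; exact (summable_qExpCoeff hp hp1 z).of_abs.hasSum

/-- The functional equation behind both the zeros of E_p and the recursion of its moments. -/
theorem qExp_eq_mul (z : ℝ) : qExp p z = (1 + (1 - p) * z) * qExp p (p * z) := by
  have h0 := hasSum_qExp hp hp1 (p * z)
  have h1 := (h0.mul_left ((1 - p) * z))
  have h2 : HasSum (fun j => qExpCoeff p j * z ^ j - qExpCoeff p j * (p * z) ^ j)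
      ((1 - p) * z * qExp p (p * z)) := by
    rw [← hasSum_nat_add_iff' 1]
    simp only [Finset.range_one, Finset.sum_singleton, pow_zero, sub_self, sub_zero]
    have he : ∀ j : ℕ, (1 - p) * z * (qExpCoeff p j * (p * z) ^ j) =
        qExpCoeff p (j + 1) * z ^ (j + 1) - qExpCoeff p (j + 1) * (p * z) ^ (j + 1) := fun j => ?_
    · simp only [he] at h1
      exact h1
    have h2 := (qNum_pos hp hp1 (u := (j : ℝ) + 1) (by positivity)).ne'
    have h3 : qNum p (j + 1) = (1 - p ^ (j + 1)) / (1 - p) := by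
      rw [← Nat.cast_succ, qNum_natCast, ← neg_sub, ← neg_sub 1 p, neg_div_neg_eq]
    have h4 : 1 - p ≠ 0 := (sub_pos.2 hp1).ne'
    have h5 : 1 - p ^ (j + 1) ≠ 0 := fun h => h2 (by rw [h3, h, zero_div])
    rw [qExpCoeff_succ hp hp1, h3]
    field_simp
    ring
  have h3 := h2.add h0
  simp only [sub_add_cancel] at h3
  rw [(hasSum_qExp hp hp1 z).unique h3]
  ring

theorem abs_qExp_le {z : ℝ} {b : ℝ} (hz : |z| ≤ b) : |qExp p z| ≤ qExp p b := by
  have hb : 0 ≤ b := (abs_nonneg z).trans hz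
  have hs := summable_qExpCoeff hp hp1 z
  simp only [← Real.norm_eq_abs] at hs
  have h1 := norm_tsum_le_tsum_norm hs
  rw [← qExp_eq] at h1
  refine (le_of_eq (Real.norm_eq_abs _).symm).trans (h1.trans ?_)
  rw [qExp_eq]
  refine hs.tsum_le_tsum (fun j => ?_) (summable_qExpCoeff hp hp1 b).of_abs
  rw [Real.norm_eq_abs, abs_mul, abs_of_pos (qExpCoeff_pos hp hp1 j), abs_pow]
  exact mul_le_mul_of_nonneg_left (pow_le_pow_left₀ (abs_nonneg z) hz j) (qExpCoeff_pos hp hp1 j).le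

end qexp
end QEuclid

namespace QEuclid

/-! ### Values of the `q`-exponential on the grid of its zeros -/

section grid
variable {p : ℝ} (hp : 0 < p) (hp1 : p < 1)

variable (p) in
/-- The values of `E_p` at the points `-p^j / (1 - p)`. -/
def gridVal (j : ℤ) : ℝ := qExp p (-(p ^ j / (1 - p)))

variable (p) in
/-- The generating function of the values of `E_p` at `-p^j / (1 - p)`. -/
def gridGen (z : ℝ) : ℝ := ∑' j : ℕ, z ^ j * gridVal p j

include hp hp1

theorem gridVal_eq_mul (j : ℤ) : gridVal p j = (1 - p ^ j) * gridVal p (j + 1) := by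
  have h : 1 - p ≠ 0 := (sub_pos.2 hp1).ne'
  rw [gridVal, qExp_eq_mul hp hp1, gridVal, zpow_add_one₀ hp.ne']
  congr 1
  · field_simp
    ring
  · congr 1
    ring

/-- The factor 1 - p^j vanishes at j = 0, and the functional equation carries this zero to all
negative j. This truncates the infinite Jackson integral. -/
theorem gridVal_neg (n : ℕ) : gridVal p (-n) = 0 := by
  induction n with
  | zero => rw [gridVal_eq_mul hp hp1]; simp
  | succ n ih =>
    rw [gridVal_eq_mul hp hp1, show (-((n + 1 : ℕ) : ℤ) + 1) = -n by push_cast; ring, ih, mul_zero]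

theorem abs_gridVal_le (n : ℕ) : |gridVal p n| ≤ qExp p (1 / (1 - p)) := by
  refine abs_qExp_le hp hp1 ?_
  have h : 0 < 1 - p := sub_pos.2 hp1
  rw [abs_neg, abs_of_pos (by positivity), zpow_natCast]
  exact div_le_div_of_nonneg_right (pow_le_one₀ hp.le hp1.le) h.le

theorem hasSum_gridGen {z : ℝ} (hz : 0 < z) (hz1 : z < 1) :
    HasSum (fun j : ℕ => z ^ j * gridVal p j) (gridGen p z) := by
  refine Summable.hasSum (Summable.of_norm_bounded
    ((summable_geometric_of_lt_one hz.le hz1).mul_right (qExp p (1 / (1 - p)))) fun j => ?_)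
  rw [Real.norm_eq_abs, abs_mul, abs_of_pos (pow_pos hz j)]
  exact mul_le_mul_of_nonneg_left (abs_gridVal_le hp hp1 j) (pow_pos hz j).le

/-- In p g(z) - g(pz), with g = `gridGen p`, the j-th coefficient acquires the factor p (1 -
p^(j-1)), by which the functional equation steps down to the previous grid value; the result is p z
g(z). -/
theorem gridGen_mul {z : ℝ} (hz : 0 < z) (hz1 : z < 1) :
    gridGen p (p * z) = p * (1 - z) * gridGen p z := by
  have hpz : p * z < 1 := by nlinarith
  have h1 := hasSum_gridGen hp hp1 hz hz1
  have h2 := hasSum_gridGen hp hp1 (mul_pos hp hz) hpz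
  have h00 : gridVal p ((0 : ℕ) : ℤ) = 0 := by simpa using gridVal_neg hp hp1 0
  have h0 : ∀ w : ℝ, ∑ i ∈ Finset.range 1, w ^ i * gridVal p i = 0 := fun w => by
    rw [Finset.sum_range_one, h00, mul_zero]
  have h3 := (hasSum_nat_add_iff' 1).2 h1
  have h4 := (hasSum_nat_add_iff' 1).2 h2
  rw [h0, sub_zero] at h3 h4
  have h5 := (h3.mul_left p).sub h4
  have h6 := h1.mul_left (p * z)
  have he : ∀ j : ℕ, p * (z ^ (j + 1) * gridVal p (j + 1 : ℕ)) - (p * z) ^ (j + 1) * gridVal p (j + 1 : ℕ) =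
      p * z * (z ^ j * gridVal p j) := fun j => by
    rw [gridVal_eq_mul hp hp1 j, mul_pow p z (j + 1), Nat.cast_succ, zpow_natCast]
    ring
  simp only [he] at h5
  linarith [h5.unique h6]

end grid

/-! ### The series with `q`-exponential decay -/

section expClass

variable {p : ℝ} (hp : 0 < p) (hp1 : p < 1)

variable (p) in
/-- The products of polynomials with the `q`-exponential `e_p(c u)`. -/
def expClass (c : ℂ) : Submodule ℂ ℂ⟦X⟧ :=
  LinearMap.range ((LinearMap.mulRight ℂ (PowerSeries.rescale c (qexpSeries p))) ∘ₗ
    (Polynomial.coeToPowerSeries.algHom (R := ℂ) ℂ).toLinearMap)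

theorem mem_expClass {c : ℂ} {φ : ℂ⟦X⟧} : φ ∈ expClass p c ↔
    ∃ P : Polynomial ℂ, φ = (P : ℂ⟦X⟧) * PowerSeries.rescale c (qexpSeries p) := by
  simp only [expClass, LinearMap.mem_range, LinearMap.comp_apply, LinearMap.mulRight_apply,
    AlgHom.toLinearMap_apply, Polynomial.coeToPowerSeries.algHom_apply, Algebra.algebraMap_self,
    PowerSeries.map_id, id_eq, eq_comm]

include hp hp1

theorem rescale_qexpSeries (c : ℂ) : PowerSeries.rescale (p : ℂ) (PowerSeries.rescale c (qexpSeries p)) =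
    (1 - PowerSeries.C ((1 - p) * c) * PowerSeries.X) * PowerSeries.rescale c (qexpSeries p) := by
  refine PowerSeries.ext fun n => ?_
  rw [sub_mul, one_mul, map_sub, mul_assoc, PowerSeries.coeff_C_mul]
  cases n with
  | zero => simp
  | succ n =>
    rw [PowerSeries.coeff_succ_X_mul]
    simp only [PowerSeries.coeff_rescale, qexpSeries, PowerSeries.coeff_mk, qFactorial_succ]
    have h1 : (qFactorial p n : ℂ) ≠ 0 := by exact_mod_cast (qFactorial_pos hp hp1 n).ne'
    have h2 := (qNum_pos hp hp1 (u := (n : ℝ) + 1) (by positivity)).ne'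
    have h3 : qNum p (n + 1) = (1 - p ^ (n + 1)) / (1 - p) := by
      rw [← Nat.cast_succ, qNum_natCast, ← neg_sub, ← neg_sub 1 p, neg_div_neg_eq]
    have h4 : 1 - p ≠ 0 := (sub_pos.2 hp1).ne'
    have h5 : 1 - p ^ (n + 1) ≠ 0 := fun h => h2 (by rw [h3, h, zero_div])
    rw [h3]
    push_cast
    have h4' : (1 : ℂ) - p ≠ 0 := by exact_mod_cast h4
    have h5' : (1 : ℂ) - (p : ℂ) ^ (n + 1) ≠ 0 := by exact_mod_cast h5
    field_simp
    ring

theorem rescale_mem_expClass {c : ℂ} {φ : ℂ⟦X⟧} (h : φ ∈ expClass p c) :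
    PowerSeries.rescale (p : ℂ) φ ∈ expClass p c := by
  rw [mem_expClass] at h ⊢
  obtain ⟨P, rfl⟩ := h
  refine ⟨P.comp (Polynomial.C (p : ℂ) * Polynomial.X) *
    (1 - Polynomial.C ((1 - p) * c) * Polynomial.X), ?_⟩
  have hP : PowerSeries.rescale (p : ℂ) (P : ℂ⟦X⟧) = (P.comp (Polynomial.C (p : ℂ) * Polynomial.X) : Polynomial ℂ) := by
    refine PowerSeries.ext fun n => ?_
    rw [PowerSeries.coeff_rescale, Polynomial.coeff_coe, Polynomial.coeff_coe,
      Polynomial.comp_C_mul_X_coeff, mul_comm]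
  rw [map_mul, hP, rescale_qexpSeries hp hp1]
  push_cast
  ring

/-- The moments of the grid values give a `q`-exponential. -/
theorem gridGen_mem_expClass {z : ℝ} (hz : 0 < z) (hz1 : z < 1) (c : ℂ) (w : ℕ → ℂ)
    (hw : ∀ i, w (i + 1) * ((p * (1 - z * p ^ i) : ℝ) : ℂ) * qNum p (i + 1) = w i * c) (d : ℕ) :
    (PowerSeries.mk fun i => w i * gridGen p (z * p ^ (i + d)) : ℂ⟦X⟧) ∈ expClass p c := by
  have hlt : ∀ i, z * p ^ i < 1 := fun i => by
    have := pow_le_one₀ hp.le hp1.le (n := i)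
    nlinarith
  have hstep : ∀ i, gridGen p (z * p ^ (i + 1)) = p * (1 - z * p ^ i) * gridGen p (z * p ^ i) := fun i => by
    rw [← gridGen_mul hp hp1 (by positivity) (hlt i)]
    congr 1
    ring
  -- For `d = 0` the recursions for `w` and `gridGen` combine to that of e_p. Raising `d` applies
  -- `gridGen_mul` at z p^(i+d), whose factor p^i is a rescaling of the variable, and rescaling by p
  -- preserves the class.
  induction d with
  | zero =>
    rw [mem_expClass]
    refine ⟨Polynomial.C (w 0 * gridGen p z), PowerSeries.ext fun i => ?_⟩
    rw [PowerSeries.coeff_mk, Polynomial.coe_C, PowerSeries.coeff_C_mul, PowerSeries.coeff_rescale,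
      qexpSeries, PowerSeries.coeff_mk]
    induction i with
    | zero => simp [qFactorial_zero]
    | succ i ih =>
      have h1 : (qNum p (i + 1) : ℂ) ≠ 0 := by
        exact_mod_cast (qNum_pos hp hp1 (u := (i : ℝ) + 1) (by positivity)).ne'
      have h2 : (qFactorial p i : ℂ) ≠ 0 := by exact_mod_cast (qFactorial_pos hp hp1 i).ne'
      have h3 := hw i
      rw [add_zero] at ih ⊢
      rw [hstep, qFactorial_succ]
      push_cast at ih h3 ⊢
      have h4 : w (i + 1) * ((p : ℂ) * (1 - z * p ^ i) * gridGen p (z * p ^ i)) * qNum p (i + 1) =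
          w i * gridGen p (z * p ^ i) * c := by linear_combination h3 * (gridGen p (z * p ^ i) : ℂ)
      rw [ih] at h4
      rw [← mul_left_inj' h1, h4, pow_succ]
      field_simp
  | succ d ih =>
    have h : (PowerSeries.mk fun i => w i * gridGen p (z * p ^ (i + (d + 1))) : ℂ⟦X⟧) =
        (p : ℂ) • ((PowerSeries.mk fun i => w i * gridGen p (z * p ^ (i + d)) : ℂ⟦X⟧) -
          ((z * p ^ d : ℝ) : ℂ) • PowerSeries.rescale (p : ℂ)
            (PowerSeries.mk fun i => w i * gridGen p (z * p ^ (i + d)))) := by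
      refine PowerSeries.ext fun i => ?_
      rw [map_smul, map_sub, map_smul, PowerSeries.coeff_rescale, PowerSeries.coeff_mk, PowerSeries.coeff_mk,
        ← add_assoc, hstep]
      push_cast
      simp only [smul_eq_mul]
      ring
    rw [h]
    exact Submodule.smul_mem _ _ (Submodule.sub_mem _ ih (Submodule.smul_mem _ _
      (rescale_mem_expClass hp hp1 ih)))

end expClass

/-! ### Moments of the radial part -/

section moment

theorem hasSum_polynomial_mul (G : Polynomial ℂ) {χ : ℂ⟦X⟧} {u v : ℂ}
    (h : HasSum (fun n => PowerSeries.coeff n χ * u ^ n) v) :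
    HasSum (fun n => PowerSeries.coeff n ((G : ℂ⟦X⟧) * χ) * u ^ n) (G.eval u * v) := by
  induction G using Polynomial.induction_on' with
  | add G H hG hH =>
    simp only [Polynomial.coe_add, add_mul, map_add, Polynomial.eval_add]
    exact hG.add hH
  | monomial d g =>
    rw [Polynomial.coe_monomial, Polynomial.eval_monomial, ← (add_right_injective d).hasSum_iff]
    · have he : (fun n => PowerSeries.coeff n (PowerSeries.monomial d g * χ) * u ^ n) ∘ (d + ·) =
          fun n => g * u ^ d * (PowerSeries.coeff n χ * u ^ n) := by
        funext n
        rw [Function.comp_apply, coeff_monomial_mul_add]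
        ring
      rw [he]
      exact h.mul_left _
    · intro n hn
      rw [coeff_monomial_mul_of_lt, zero_mul]
      by_contra hlt
      exact hn ⟨n - d, Nat.add_sub_cancel' (not_lt.1 hlt)⟩

theorem evalSeries_polynomial_mul {p : ℝ} (hp : 0 < p) (hp1 : p < 1) (G : Polynomial ℂ) (a u : ℝ) :
    evalSeries ((G : ℂ⟦X⟧) * PowerSeries.rescale (a : ℂ) (qExpSeries p)) u =
      G.eval (u : ℂ) * (qExp p (a * u) : ℂ) := by
  refine (hasSum_polynomial_mul G ?_).tsum_eq
  have h := Complex.hasSum_ofReal.2 (hasSum_qExp hp hp1 (a * u))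
  have he : ∀ j : ℕ, ((qExpCoeff p j * (a * u) ^ j : ℝ) : ℂ) =
      PowerSeries.coeff j (PowerSeries.rescale (a : ℂ) (qExpSeries p)) * (u : ℂ) ^ j := fun j => by
    rw [PowerSeries.coeff_rescale, qExpSeries, PowerSeries.coeff_mk, qExpCoeff]
    push_cast
    ring
  simp only [he] at h
  exact h

theorem jacksonInfty_eq_jackson {q γ : ℝ} {f : ℝ → ℂ} (h : ∀ n : ℕ, f (q ^ (-((n : ℤ) + 1)) * γ) = 0) :
    jacksonInfty q γ f = jackson q γ f := by
  rw [jacksonInfty, jackson]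
  congr 1
  rw [← Nat.cast_injective (R := ℤ) |>.tsum_eq]
  · simp only [zpow_natCast]
  · intro k hk
    rcases k with k | k
    · exact ⟨k, rfl⟩
    · exfalso
      apply hk
      have := h k
      rw [show (-((k : ℤ) + 1)) = Int.negSucc k by rw [Int.negSucc_eq]] at this
      simp only [this, zero_mul]

end moment
end QEuclid

namespace QEuclid

/-! ### The transform of a `q`-exponential -/

section transform
variable {m : ℕ} {q β : ℝ}

variable (m q β) in
/-- The base point of the grid of integration. -/
def gridBase : ℝ := √(mu m q / ((1 - q ^ 2) * β))

variable (m q β) in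
/-- The coefficients of the transform with respect to the moments on the grid. -/
def bochnerWeight (k i : ℕ) : ℝ :=
  (1 + q) / (mu m q ^ ((m : ℝ) / 2) * mu m q ^ (k + 2 * i)) * ((-1) ^ i /
    (qFactorial (q ^ 2) i * qGamma (q ^ 2) ((k : ℝ) + i + (m : ℝ) / 2))) *
      ((1 - q) * gridBase m q β ^ (m + 2 * k + 2 * i))

variable (hm : 1 ≤ m) (hq : 0 < q) (hq1 : q < 1) (hβ : 0 < β)
include hq hq1

theorem one_sub_sq_pos : 0 < 1 - q ^ 2 := by nlinarith

include hβ

theorem gridBase_pos : 0 < gridBase m q β :=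
  Real.sqrt_pos.2 (div_pos (mu_pos hq) (mul_pos (one_sub_sq_pos hq hq1) hβ))

theorem gridBase_sq : gridBase m q β ^ 2 = mu m q / ((1 - q ^ 2) * β) :=
  Real.sq_sqrt (div_pos (mu_pos hq) (mul_pos (one_sub_sq_pos hq hq1) hβ)).le

omit hq1 hβ in
theorem sq_zpow_mul (k : ℤ) (γ : ℝ) : (q ^ k * γ) ^ 2 = (q ^ 2) ^ k * γ ^ 2 := by
  rw [mul_pow, ← zpow_natCast, ← zpow_mul, ← zpow_natCast q 2, ← zpow_mul, mul_comm k]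

/-- The base point γ satisfies β γ²/μ = 1/(1 - q²), so the argument of E_{q²} runs through
-q^(2k)/(1 - q²). -/
theorem evalSeries_grid (G : Polynomial ℂ) (k : ℤ) :
    evalSeries ((G : ℂ⟦X⟧) * PowerSeries.rescale ((-(β / mu m q) : ℝ) : ℂ) (qExpSeries (q ^ 2)))
      ((q ^ k * gridBase m q β) ^ 2) =
    G.eval (((q ^ k * gridBase m q β) ^ 2 : ℝ) : ℂ) * (gridVal (q ^ 2) k : ℂ) := by
  rw [evalSeries_polynomial_mul (by positivity) (by nlinarith), gridVal, sq_zpow_mul hq,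
    gridBase_sq hq hq1 hβ]
  have h1 := (mu_pos (m := m) hq).ne'
  have h2 := (one_sub_sq_pos hq hq1).ne'
  congr 3
  field_simp

theorem evalSeries_grid_neg (G : Polynomial ℂ) (n : ℕ) :
    evalSeries ((G : ℂ⟦X⟧) * PowerSeries.rescale ((-(β / mu m q) : ℝ) : ℂ) (qExpSeries (q ^ 2)))
      ((q ^ (-((n : ℤ) + 1)) * gridBase m q β) ^ 2) = 0 := by
  rw [evalSeries_grid hq hq1 hβ, show -((n : ℤ) + 1) = -((n + 1 : ℕ) : ℤ) by push_cast; ring,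
    gridVal_neg (by positivity) (by nlinarith), Complex.ofReal_zero, mul_zero]

theorem exists_grid_bound (G : Polynomial ℂ) : ∃ B : ℝ, ∀ j : ℕ,
    ‖G.eval (((q ^ j * gridBase m q β) ^ 2 : ℝ) : ℂ) * (gridVal (q ^ 2) j : ℂ)‖ ≤ B := by
  obtain ⟨C, hC⟩ := (isCompact_Icc (a := (0 : ℝ)) (b := gridBase m q β ^ 2)).exists_bound_of_continuousOn
    (f := fun x : ℝ => G.eval (x : ℂ)) (by fun_prop)
  refine ⟨C * qExp (q ^ 2) (1 / (1 - q ^ 2)), fun j => ?_⟩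
  have h1 := hC ((q ^ j * gridBase m q β) ^ 2) ⟨by positivity, by
    rw [mul_pow]
    exact mul_le_of_le_one_left (by positivity) (pow_le_one₀ (by positivity) (pow_le_one₀ hq.le hq1.le))⟩
  have h2 := abs_gridVal_le (p := q ^ 2) (by positivity) (by nlinarith) j
  rw [norm_mul, Complex.norm_real, Real.norm_eq_abs]
  exact mul_le_mul h1 h2 (abs_nonneg _) ((norm_nonneg _).trans h1)

theorem radialMoment_eq (G : Polynomial ℂ) (n : ℕ) :
    radialMoment q (gridBase m q β)
      ((G : ℂ⟦X⟧) * PowerSeries.rescale ((-(β / mu m q) : ℝ) : ℂ) (qExpSeries (q ^ 2))) n =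
    (((1 - q) * gridBase m q β ^ (n + 1) : ℝ) : ℂ) * ∑' j : ℕ, ((q ^ (n + 1) : ℝ) : ℂ) ^ j *
      (G.eval (((q ^ j * gridBase m q β) ^ 2 : ℝ) : ℂ) * (gridVal (q ^ 2) j : ℂ)) := by
  rw [radialMoment, jacksonInfty_eq_jackson fun n => by rw [evalSeries_grid_neg hq hq1 hβ, mul_zero],
    jackson, ← tsum_mul_left, ← tsum_mul_left]
  refine tsum_congr fun j => ?_
  have h := evalSeries_grid (m := m) hq hq1 hβ G j
  rw [zpow_natCast] at h
  rw [h]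
  push_cast
  ring

theorem summable_moment (G : Polynomial ℂ) {z : ℝ} (hz : 0 < z) (hz1 : z < 1) :
    Summable fun j : ℕ => (z : ℂ) ^ j *
      (G.eval (((q ^ j * gridBase m q β) ^ 2 : ℝ) : ℂ) * (gridVal (q ^ 2) j : ℂ)) := by
  obtain ⟨B, hB⟩ := exists_grid_bound (m := m) hq hq1 hβ G
  refine Summable.of_norm_bounded ((summable_geometric_of_lt_one hz.le hz1).mul_right B) fun j => ?_
  rw [norm_mul, norm_pow, Complex.norm_real, Real.norm_eq_abs, abs_of_pos hz]
  exact mul_le_mul_of_nonneg_left (hB j) (by positivity)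

omit hq1 hβ in
theorem rpow_half (n m : ℕ) : (q ^ 2) ^ ((n : ℝ) + (m : ℝ) / 2) = q ^ (m + 2 * n) := by
  rw [← Real.rpow_natCast q 2, ← Real.rpow_mul hq.le, ← Real.rpow_natCast]
  congr 1
  push_cast
  ring

include hm

/-- The recursion required by `gridGen_mem_expClass` with p = q² and z = q^(m+2k): the ratio of
q-Gamma values supplies 1 - z p^i, and γ² supplies the constant, which is the scale of the
exponential in V_{1/β}. -/
theorem bochnerWeight_succ (k i : ℕ) : bochnerWeight m q β k (i + 1) *
    (q ^ 2 * (1 - q ^ (m + 2 * k) * (q ^ 2) ^ i)) * qNum (q ^ 2) (i + 1) =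
      bochnerWeight m q β k i * -(1 / β * q ^ 2 / mu m q) := by
  have hq2 : 0 < q ^ 2 := by positivity
  have hq21 : q ^ 2 < 1 := by nlinarith
  have hm0 : (0 : ℝ) < m := by exact_mod_cast hm
  have h1 : (0 : ℝ) < (k : ℝ) + i + (m : ℝ) / 2 := by positivity
  have hG := (qGamma_pos hq2 hq21 h1).ne'
  have hF := (qFactorial_pos hq2 hq21 i).ne'
  have hN := (qNum_pos hq2 hq21 (u := (i : ℝ) + 1) (by positivity)).ne'
  have hK : qNum (q ^ 2) ((k : ℝ) + i + (m : ℝ) / 2) =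
      (1 - q ^ (m + 2 * k) * (q ^ 2) ^ i) / (1 - q ^ 2) := by
    rw [qNum, ← Nat.cast_add, rpow_half hq, ← neg_sub, ← neg_sub 1 (q ^ 2), neg_div_neg_eq]
    congr 2
    ring
  have hK0 := (qNum_pos hq2 hq21 h1).ne'
  have hp := (one_sub_sq_pos hq hq1).ne'
  have hx : 1 - q ^ (m + 2 * k) * (q ^ 2) ^ i ≠ 0 := fun h => hK0 (by rw [hK, h, zero_div])
  have hM := (Real.rpow_pos_of_pos (mu_pos (m := m) hq) ((m : ℝ) / 2)).ne'
  have hmu := (mu_pos (m := m) hq).ne'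
  have hγ := gridBase_sq (m := m) hq hq1 hβ
  have e1 : (k : ℝ) + ((i + 1 : ℕ) : ℝ) + (m : ℝ) / 2 = (k + i + (m : ℝ) / 2) + 1 := by push_cast; ring
  have e2 : gridBase m q β ^ (m + 2 * k + 2 * (i + 1)) =
      gridBase m q β ^ (m + 2 * k + 2 * i) * (mu m q / ((1 - q ^ 2) * β)) := by
    rw [← hγ]; ring
  rw [bochnerWeight, bochnerWeight, e1, qGamma_add_one hq2 hq21 h1, qFactorial_succ, e2, hK]
  generalize qGamma (q ^ 2) ((k : ℝ) + i + (m : ℝ) / 2) = G at *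
  generalize mu m q ^ ((m : ℝ) / 2) = M at *
  generalize gridBase m q β ^ (m + 2 * k + 2 * i) = Γ at *
  generalize 1 - q ^ (m + 2 * k) * (q ^ 2) ^ i = x at *
  rw [show k + 2 * (i + 1) = k + 2 * i + 2 by ring, pow_add _ (k + 2 * i) 2, pow_succ (-1 : ℝ) i]
  field_simp

omit hm in
theorem coeff_bochnerSeries_eq (hm : 1 ≤ m) (G : Polynomial ℂ) (k i : ℕ) :
    PowerSeries.coeff i (bochnerSeries m q (gridBase m q β) k
      ((G : ℂ⟦X⟧) * PowerSeries.rescale ((-(β / mu m q) : ℝ) : ℂ) (qExpSeries (q ^ 2)))) =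
    (bochnerWeight m q β k i : ℂ) * ∑' j : ℕ, ((q ^ (m + 2 * k) * (q ^ 2) ^ i : ℝ) : ℂ) ^ j *
      (G.eval (((q ^ j * gridBase m q β) ^ 2 : ℝ) : ℂ) * (gridVal (q ^ 2) j : ℂ)) := by
  rw [bochnerSeries, PowerSeries.coeff_mk, radialMoment_eq hq hq1 hβ,
    show m - 1 + 2 * k + 2 * i + 1 = m + 2 * k + 2 * i by omega, bochnerWeight, ← mul_assoc,
    ← Complex.ofReal_mul, pow_add q, pow_mul q 2 i]

/-- Linear in `G`, so monomials suffice; the monomial of degree d multiplies the j-th grid term by a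
constant times q^(2dj), which shifts z p^i to z p^(i+d). -/
theorem bochnerSeries_mem_expClass (G : Polynomial ℂ) (k : ℕ) :
    bochnerSeries m q (gridBase m q β) k
      ((G : ℂ⟦X⟧) * PowerSeries.rescale ((-(β / mu m q) : ℝ) : ℂ) (qExpSeries (q ^ 2))) ∈
    expClass (q ^ 2) ((-(1 / β * q ^ 2 / mu m q) : ℝ) : ℂ) := by
  have hq2 : 0 < q ^ 2 := by positivity
  have hq21 : q ^ 2 < 1 := by nlinarith
  have hz : 0 < q ^ (m + 2 * k) := by positivity
  have hz1 : q ^ (m + 2 * k) < 1 := pow_lt_one₀ hq.le hq1 (by omega)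
  have hzi : ∀ i, q ^ (m + 2 * k) * (q ^ 2) ^ i < 1 := fun i => by
    have := pow_le_one₀ hq2.le hq21.le (n := i)
    nlinarith
  suffices h : (PowerSeries.mk fun i => (bochnerWeight m q β k i : ℂ) * ∑' j : ℕ,
      ((q ^ (m + 2 * k) * (q ^ 2) ^ i : ℝ) : ℂ) ^ j * (G.eval (((q ^ j * gridBase m q β) ^ 2 : ℝ) : ℂ) *
        (gridVal (q ^ 2) j : ℂ)) : ℂ⟦X⟧) ∈ expClass (q ^ 2) ((-(1 / β * q ^ 2 / mu m q) : ℝ) : ℂ) by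
    convert h using 1
    refine PowerSeries.ext fun i => ?_
    rw [coeff_bochnerSeries_eq hq hq1 hβ hm, PowerSeries.coeff_mk]
  induction G using Polynomial.induction_on' with
  | add G H hG hH =>
    convert add_mem hG hH using 1
    refine PowerSeries.ext fun i => ?_
    simp only [map_add, PowerSeries.coeff_mk]
    have hs := fun P : Polynomial ℂ => summable_moment (m := m) hq hq1 hβ P
      (mul_pos hz (pow_pos hq2 i)) (hzi i)
    have ht := (hs G).tsum_add (hs H)
    rw [← mul_add, ← ht]
    simp only [Polynomial.eval_add, add_mul, mul_add]
  | monomial d g =>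
    have h := gridGen_mem_expClass hq2 hq21 hz hz1 ((-(1 / β * q ^ 2 / mu m q) : ℝ) : ℂ)
      (fun i => (bochnerWeight m q β k i : ℂ)) (fun i => by
        exact_mod_cast bochnerWeight_succ hm hq hq1 hβ k i) d
    convert Submodule.smul_mem _ (g * (gridBase m q β ^ (2 * d) : ℝ)) h using 1
    refine PowerSeries.ext fun i => ?_
    rw [map_smul, PowerSeries.coeff_mk, PowerSeries.coeff_mk, gridGen, Complex.ofReal_tsum, smul_eq_mul,
      mul_left_comm]
    refine congrArg (_ * ·) ?_
    rw [← tsum_mul_left]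
    refine tsum_congr fun j => ?_
    rw [Polynomial.eval_monomial]
    push_cast
    ring

end transform
end QEuclid

namespace QEuclid

/-! ### Taylor series in one real variable -/

/-- The difference series converges at a positive point, hence is analytic near 0, and it vanishes
on a real interval accumulating at 0. Uniqueness gives `radialFun` its value. -/
theorem IsTaylor.unique {G : ℝ → ℂ} {φ χ : ℂ⟦X⟧} (h : IsTaylor G φ) (h' : IsTaylor G χ) : φ = χ := by
  set δ : ℕ → ℂ := fun n => PowerSeries.coeff n φ - PowerSeries.coeff n χ with hδ
  have hsum : ∀ᶠ u : ℝ in 𝓝[>] 0, HasSum (fun n => δ n * (u : ℂ) ^ n) 0 := by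
    filter_upwards [h, h'] with u h1 h2
    simpa only [hδ, sub_mul, sub_self] using h1.sub h2
  obtain ⟨u, hu, hu0⟩ := (hsum.and self_mem_nhdsWithin).exists
  have hu0 : 0 < u := hu0
  set P := FormalMultilinearSeries.ofScalars ℂ δ
  have hr : ((u.toNNReal : NNReal) : ENNReal) ≤ P.radius := by
    refine P.le_radius_of_tendsto (l := 0) ?_
    have h1 := hu.summable.tendsto_atTop_zero.norm
    simp only [norm_mul, norm_pow, Complex.norm_real, Real.norm_eq_abs, abs_of_pos hu0, norm_zero] at h1
    simpa only [P, FormalMultilinearSeries.ofScalars_norm, Real.coe_toNNReal u hu0.le] using h1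
  have hp := (P.hasFPowerSeriesOnBall
    (lt_of_lt_of_le (by simpa using hu0) hr)).hasFPowerSeriesAt
  have hfreq : ∃ᶠ z in 𝓝[≠] (0 : ℂ), P.sum z = 0 := by
    have ht : Filter.Tendsto (fun x : ℝ => (x : ℂ)) (𝓝[>] 0) (𝓝[≠] 0) := by
      refine tendsto_nhdsWithin_of_tendsto_nhds_of_eventually_within _ ?_ ?_
      · exact (Complex.continuous_ofReal.tendsto' 0 0 Complex.ofReal_zero).mono_left nhdsWithin_le_nhds
      · filter_upwards [self_mem_nhdsWithin] with x hx
        simpa using (show (0 : ℝ) < x from hx).ne'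
    refine ht.frequently (Filter.Eventually.frequently ?_)
    filter_upwards [hsum] with x hx
    have := congrFun (FormalMultilinearSeries.ofScalarsSum_eq_tsum (E := ℂ) δ) (x : ℂ)
    refine this.trans ?_
    simpa only [smul_eq_mul] using hx.tsum_eq
  have hP := hp.eq_zero_of_eventually (hp.analyticAt.frequently_zero_iff_eventually_zero.1 hfreq)
  have h0 : δ = 0 := (FormalMultilinearSeries.ofScalars_series_eq_zero ℂ).1 hP
  refine PowerSeries.ext fun n => sub_eq_zero.1 (congrFun h0 n)

theorem epsilon_isTaylor {G : ℝ → ℂ} {φ : ℂ⟦X⟧} (h : IsTaylor G φ) : Classical.epsilon (IsTaylor G) = φ :=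
  (Classical.epsilon_spec ⟨φ, h⟩ : IsTaylor G _).unique h

/-! ### The Hankel transform -/

section bessel
variable {m : ℕ} {q β : ℝ}

/-- Γ_p(t + 1) = [t] Γ_p(t) with [t] ≥ 1 for t ≥ 1, so the values do not decrease from `i = 1` on;
`i = 0` is separate because `s` may be below 1. -/
theorem exists_qGamma_lower_bound {p s : ℝ} (hp : 0 < p) (hp1 : p < 1) (hs : 0 < s) :
    ∃ C : ℝ, 0 < C ∧ ∀ i : ℕ, C ≤ qGamma p (i + s) := by
  refine ⟨min (qGamma p s) (qGamma p (1 + s)),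
    lt_min (qGamma_pos hp hp1 hs) (qGamma_pos hp hp1 (by positivity)), fun i => ?_⟩
  rcases i with _ | i
  · simp
  refine (min_le_right _ _).trans ?_
  induction i with
  | zero => simp
  | succ i ih =>
    have h1 : (0 : ℝ) < ((i + 1 : ℕ) : ℝ) + s := by positivity
    rw [show (((i + 1 + 1 : ℕ) : ℝ) + s) = ((i + 1 : ℕ) : ℝ) + s + 1 by push_cast; ring,
      qGamma_add_one hp hp1 h1]
    have h2 : 1 ≤ qNum p (((i + 1 : ℕ) : ℝ) + s) := by
      rw [qNum, ← neg_div_neg_eq, neg_sub, neg_sub, one_le_div (sub_pos.2 hp1)]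
      have h3 : p ^ (((i + 1 : ℕ) : ℝ) + s) ≤ p ^ (1 : ℝ) :=
        Real.rpow_le_rpow_of_exponent_ge hp hp1.le (by push_cast; linarith [(Nat.cast_nonneg i : (0 : ℝ) ≤ i)])
      rw [Real.rpow_one] at h3
      linarith
    have h4 := qGamma_pos hp hp1 h1
    nlinarith

variable (hm : 1 ≤ m) (hq : 0 < q) (hq1 : q < 1) (hβ : 0 < β)
include hm hq hq1

-- The bound on `r * t` keeps the argument inside the disc of convergence, so the defining branch is
-- the power series, and the non-integral power cancels.
omit hm in
theorem qBessel1_div_rpow (ν : ℝ) {r t : ℝ} (hr : 0 < r) (ht : 0 < t) (hrt : r * t < mu m q) :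
    qBessel1 q ν ((1 + q) / mu m q * r * t) / (r * t) ^ ν = (mu m q ^ ν)⁻¹ *
      ∑' i : ℕ, (-1) ^ i / (qFactorial (q ^ 2) i * qGamma (q ^ 2) ((i : ℝ) + ν + 1)) *
        (r * t / mu m q) ^ (2 * i) := by
  have hmu := mu_pos (m := m) hq
  have hx : (1 + q) / mu m q * r * t / (1 + q) = r * t / mu m q := by field_simp
  have hlt : |(1 + q) / mu m q * r * t| < 1 / (1 - q) := by
    rw [abs_of_pos (by positivity), lt_div_iff₀ (sub_pos.2 hq1)]
    have h1 : r * t / mu m q < 1 := (div_lt_one hmu).2 hrt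
    have h2 : 0 < r * t / mu m q := by positivity
    rw [show (1 + q) / mu m q * r * t * (1 - q) = (1 - q ^ 2) * (r * t / mu m q) by ring]
    nlinarith [sq_nonneg q]
  have hpos : 0 < (r * t) ^ ν := Real.rpow_pos_of_pos (by positivity) _
  rw [qBessel1, if_pos hlt, hx, Real.div_rpow (by positivity) hmu.le, mul_comm (_ / _), mul_div_assoc,
    mul_comm]
  congr 1
  field_simp

theorem bochnerWeight_mul_pow (k i j : ℕ) {u : ℝ} (hu : 0 < u) :
    bochnerWeight m q β k i * u ^ i * (q ^ (m + 2 * k) * (q ^ 2) ^ i) ^ j =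
      (1 + q) / mu m q * ((1 - q) * gridBase m q β) * q ^ j * (q ^ j * gridBase m q β) ^ (m + 2 * k - 1) *
        (mu m q ^ ((m : ℝ) / 2 + k - 1))⁻¹ * ((-1) ^ i /
          (qFactorial (q ^ 2) i * qGamma (q ^ 2) ((i : ℝ) + ((m : ℝ) / 2 + k - 1) + 1)) *
            (q ^ j * gridBase m q β * √u / mu m q) ^ (2 * i)) := by
  have hmu := mu_pos (m := m) hq
  have hM : mu m q * mu m q ^ ((m : ℝ) / 2 + k - 1) = mu m q ^ ((m : ℝ) / 2) * mu m q ^ k := by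
    rw [← Real.rpow_natCast (mu m q) k, ← Real.rpow_add hmu, mul_comm, ← Real.rpow_add_one hmu.ne']
    congr 1
    ring
  have hM' : mu m q ^ ((m : ℝ) / 2 + k - 1) = mu m q ^ ((m : ℝ) / 2) * mu m q ^ k / mu m q := by
    rw [← hM, mul_div_cancel_left₀ _ hmu.ne']
  have hM0 := (Real.rpow_pos_of_pos hmu ((m : ℝ) / 2)).ne'
  obtain ⟨n, hn⟩ : ∃ n, m + 2 * k = n + 1 := ⟨m + 2 * k - 1, by omega⟩
  rw [bochnerWeight, hM', show (i : ℝ) + ((m : ℝ) / 2 + k - 1) + 1 = k + i + (m : ℝ) / 2 by ring, hn,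
    Nat.add_sub_cancel]
  have hu2 : u = √u ^ 2 := (Real.sq_sqrt hu.le).symm
  have hG : 0 < qGamma (q ^ 2) ((k : ℝ) + i + (m : ℝ) / 2) :=
    qGamma_pos (by positivity) (by nlinarith) (by
      have : (0 : ℝ) < m := by exact_mod_cast hm
      positivity)
  have hF := qFactorial_pos (q := q ^ 2) (by positivity) (by nlinarith) i
  generalize qGamma (q ^ 2) ((k : ℝ) + i + (m : ℝ) / 2) = G at *
  generalize mu m q ^ ((m : ℝ) / 2) = M at *
  generalize qFactorial (q ^ 2) i = F at *
  have h1 : u ^ i = √u ^ (2 * i) := by rw [pow_mul, ← hu2]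
  rw [h1, div_pow, mul_pow _ (√u), mul_pow (q ^ j), mul_pow (q ^ j), pow_add _ k, pow_add _ (n + 1) (2 * i)]
  field_simp
  ring

include hβ

/-- A double series over the degree i and the grid point j: its row sums are the terms of the
transform, and its column sums are the Bessel series at r = q^j γ, by `bochnerWeight_mul_pow`. -/
theorem hasSum_bochnerSeries (G : Polynomial ℂ) (k : ℕ) {u : ℝ} (hu : 0 < u)
    (hu1 : gridBase m q β * √u < mu m q) :
    HasSum (fun i => PowerSeries.coeff i (bochnerSeries m q (gridBase m q β) k ((G : ℂ⟦X⟧) *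
      PowerSeries.rescale ((-(β / mu m q) : ℝ) : ℂ) (qExpSeries (q ^ 2)))) * (u : ℂ) ^ i)
    (((1 + q) / mu m q : ℝ) * jackson q (gridBase m q β) fun r =>
      (r : ℂ) ^ (m + 2 * k - 1) * evalSeries ((G : ℂ⟦X⟧) *
        PowerSeries.rescale ((-(β / mu m q) : ℝ) : ℂ) (qExpSeries (q ^ 2))) (r ^ 2) *
          ((qBessel1 q ((m : ℝ) / 2 + k - 1) ((1 + q) / mu m q * r * √u) /
            (r * √u) ^ ((m : ℝ) / 2 + k - 1) : ℝ) : ℂ)) := by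
  have hmu := mu_pos (m := m) hq
  have hγ := gridBase_pos (m := m) hq hq1 hβ
  have hq2 : 0 < q ^ 2 := by positivity
  have hq21 : q ^ 2 < 1 := by nlinarith
  have hs : 0 < √u := Real.sqrt_pos.2 hu
  have hm0 : (0 : ℝ) < m := by exact_mod_cast hm
  set v : ℕ → ℂ := fun j => G.eval (((q ^ j * gridBase m q β) ^ 2 : ℝ) : ℂ) * (gridVal (q ^ 2) j : ℂ) with hv
  obtain ⟨B, hB⟩ := exists_grid_bound (m := m) hq hq1 hβ G
  obtain ⟨C, hC, hCG⟩ := exists_qGamma_lower_bound hq2 hq21 (s := (k : ℝ) + (m : ℝ) / 2) (by positivity)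
  set F : ℕ → ℕ → ℂ := fun i j =>
    ((bochnerWeight m q β k i * u ^ i * (q ^ (m + 2 * k) * (q ^ 2) ^ i) ^ j : ℝ) : ℂ) * v j with hF
  -- The terms are dominated by a constant times θ^(2i) q^j; the ratio q in j comes from m + 2k ≥ 1.
  set θ := gridBase m q β * √u / mu m q with hθ
  have hθ0 : 0 < θ := by positivity
  have hθ1 : θ ^ 2 < 1 := by
    have : θ < 1 := (div_lt_one hmu).2 hu1
    nlinarith
  have hsum : Summable (Function.uncurry F) := by
    set A := (1 + q) / (mu m q ^ ((m : ℝ) / 2) * mu m q ^ k) * C⁻¹ * ((1 - q) * gridBase m q β ^ (m + 2 * k))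
      with hA
    have hA0 : 0 < A := by
      have := sub_pos.2 hq1
      positivity
    have hw : ∀ i, |bochnerWeight m q β k i * u ^ i| ≤ A * (θ ^ 2) ^ i := fun i => by
      have h1 := hCG i
      rw [show (i : ℝ) + (k + (m : ℝ) / 2) = k + i + (m : ℝ) / 2 by ring] at h1
      have h2 := one_le_qFactorial hq2 hq21 i
      have h3 : (qFactorial (q ^ 2) i * qGamma (q ^ 2) ((k : ℝ) + i + (m : ℝ) / 2))⁻¹ ≤ C⁻¹ :=
        inv_anti₀ hC (by nlinarith)
      have h4 : bochnerWeight m q β k i * u ^ i = (-1) ^ i * ((1 + q) / (mu m q ^ ((m : ℝ) / 2) * mu m q ^ k) *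
          (qFactorial (q ^ 2) i * qGamma (q ^ 2) ((k : ℝ) + i + (m : ℝ) / 2))⁻¹ *
          ((1 - q) * gridBase m q β ^ (m + 2 * k)) * (θ ^ 2) ^ i) := by
        have hu2 : u ^ i = √u ^ (2 * i) := by rw [pow_mul, Real.sq_sqrt hu.le]
        rw [bochnerWeight, hu2, hθ, ← pow_mul, div_pow, mul_pow, pow_add _ k, pow_add _ (m + 2 * k)]
        field_simp
      have h5 := sub_pos.2 hq1
      have h6 : 0 < qFactorial (q ^ 2) i * qGamma (q ^ 2) ((k : ℝ) + i + (m : ℝ) / 2) := by nlinarith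
      rw [h4, abs_mul, abs_pow, abs_neg, abs_one, one_pow, one_mul, abs_of_pos (by positivity), hA]
      gcongr
    refine Summable.of_norm_bounded (((summable_geometric_of_lt_one (by positivity) hθ1).mul_left A).mul_of_nonneg
      ((summable_geometric_of_lt_one hq.le hq1).mul_right B) (fun i => by positivity) (fun j => ?_)) ?_
    · exact mul_nonneg (by positivity) ((norm_nonneg _).trans (hB 0))
    · rintro ⟨i, j⟩
      simp only [Function.uncurry, hF]
      rw [norm_mul, Complex.norm_real, Real.norm_eq_abs, abs_mul, mul_assoc]
      refine mul_le_mul (hw i) ?_ (by positivity) (by positivity)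
      refine mul_le_mul ?_ (hB j) (norm_nonneg _) (by positivity)
      rw [abs_of_pos (by positivity)]
      refine pow_le_pow_left₀ (by positivity) ?_ j
      calc q ^ (m + 2 * k) * (q ^ 2) ^ i ≤ q ^ 1 * 1 := by
            refine mul_le_mul (pow_le_pow_of_le_one hq.le hq1.le (by omega))
              (pow_le_one₀ hq2.le hq21.le) (by positivity) (by positivity)
        _ = q := by ring
  have hrow : ∀ i, ∑' j, F i j = PowerSeries.coeff i (bochnerSeries m q (gridBase m q β) k ((G : ℂ⟦X⟧) *
      PowerSeries.rescale ((-(β / mu m q) : ℝ) : ℂ) (qExpSeries (q ^ 2)))) * (u : ℂ) ^ i := fun i => by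
    rw [coeff_bochnerSeries_eq hq hq1 hβ hm, mul_right_comm, ← tsum_mul_left]
    refine tsum_congr fun j => ?_
    simp only [hF, hv]
    push_cast
    ring
  have hcol : ∑' j, ∑' i, F i j = ((1 + q) / mu m q : ℝ) * jackson q (gridBase m q β) fun r =>
      (r : ℂ) ^ (m + 2 * k - 1) * evalSeries ((G : ℂ⟦X⟧) *
        PowerSeries.rescale ((-(β / mu m q) : ℝ) : ℂ) (qExpSeries (q ^ 2))) (r ^ 2) *
          ((qBessel1 q ((m : ℝ) / 2 + k - 1) ((1 + q) / mu m q * r * √u) /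
            (r * √u) ^ ((m : ℝ) / 2 + k - 1) : ℝ) : ℂ) := by
    rw [jackson, ← tsum_mul_left, ← tsum_mul_left]
    refine tsum_congr fun j => ?_
    have hr : 0 < q ^ j * gridBase m q β := by positivity
    have hrt : q ^ j * gridBase m q β * √u < mu m q := by
      refine lt_of_le_of_lt ?_ hu1
      rw [mul_assoc]
      exact mul_le_of_le_one_left (by positivity) (pow_le_one₀ hq.le hq1.le)
    have h1 := evalSeries_grid (m := m) hq hq1 hβ G j
    rw [zpow_natCast] at h1
    rw [h1, qBessel1_div_rpow hq hq1 _ hr hs hrt]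
    simp only [hF]
    rw [tsum_mul_right, ← Complex.ofReal_tsum]
    simp only [bochnerWeight_mul_pow hm hq hq1 k _ j hu]
    rw [tsum_mul_left]
    simp only [hv]
    generalize ∑' i : ℕ, ((-1) ^ i / (qFactorial (q ^ 2) i * qGamma (q ^ 2)
      ((i : ℝ) + ((m : ℝ) / 2 + k - 1) + 1)) * (q ^ j * gridBase m q β * √u / mu m q) ^ (2 * i)) = T
    generalize mu m q ^ ((m : ℝ) / 2 + k - 1) = M
    push_cast
    ring
  rw [← hcol, hsum.tsum_comm]
  have h := hsum.prod.hasSum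
  simp only [Function.uncurry] at h
  simp only [hrow] at h ⊢
  exact h

end bessel
end QEuclid

namespace QEuclid

/-! ### Bochner's relations assembled -/

section bochner
variable {m : ℕ} {q β : ℝ} (hm : 1 ≤ m) (hq : 0 < q) (hq1 : q < 1) (hβ : 0 < β)

include hm hq hq1 hβ

theorem isTaylor_bochnerSeries (G : Polynomial ℂ) (k : ℕ) :
    IsTaylor (fun u : ℝ => ((1 + q) / mu m q : ℝ) * jackson q (gridBase m q β) fun r =>
      (r : ℂ) ^ (m + 2 * k - 1) * evalSeries ((G : ℂ⟦X⟧) *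
        PowerSeries.rescale ((-(β / mu m q) : ℝ) : ℂ) (qExpSeries (q ^ 2))) (r ^ 2) *
          ((qBessel1 q ((m : ℝ) / 2 + k - 1) ((1 + q) / mu m q * r * √u) /
            (r * √u) ^ ((m : ℝ) / 2 + k - 1) : ℝ) : ℂ))
    (bochnerSeries m q (gridBase m q β) k ((G : ℂ⟦X⟧) *
      PowerSeries.rescale ((-(β / mu m q) : ℝ) : ℂ) (qExpSeries (q ^ 2)))) := by
  have hmu := mu_pos (m := m) hq
  have hγ := gridBase_pos (m := m) hq hq1 hβ
  have h0 : 0 < (mu m q / gridBase m q β) ^ 2 := by positivity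
  filter_upwards [Ioo_mem_nhdsGT h0] with u hu
  refine hasSum_bochnerSeries hm hq hq1 hβ G k hu.1 ?_
  have h1 : √u < mu m q / gridBase m q β := (Real.sqrt_lt' (by positivity)).2 hu.2
  rw [lt_div_iff₀ hγ] at h1
  linarith

omit hβ in
theorem hankelF1_eq (hβ : 0 < β) (k : ℕ) (f : ℝ → ℂ) :
    hankelF1 m q β ((m : ℝ) / 2 + k - 1) f = fun u : ℝ => ((1 + q) / mu m q : ℝ) *
      jackson q (gridBase m q β) fun r => (r : ℂ) ^ (m + 2 * k - 1) * f (r ^ 2) *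
        ((qBessel1 q ((m : ℝ) / 2 + k - 1) ((1 + q) / mu m q * r * √u) /
          (r * √u) ^ ((m : ℝ) / 2 + k - 1) : ℝ) : ℂ) := by
  funext u
  have hγ := gridBase_pos (m := m) hq hq1 hβ
  rw [hankelF1, hankel1, ← gridBase, jackson, jackson]
  congr 2
  refine tsum_congr fun j => ?_
  have hr : 0 < q ^ j * gridBase m q β := by positivity
  have he : (q ^ j * gridBase m q β) ^ (2 * ((m : ℝ) / 2 + k - 1) + 1) =
      (q ^ j * gridBase m q β) ^ (m + 2 * k - 1) := by
    rw [← Real.rpow_natCast (q ^ j * gridBase m q β), Nat.cast_sub (by omega)]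
    congr 1
    push_cast
    ring
  rw [he, Complex.ofReal_mul, Complex.ofReal_pow]
  ring

omit hm hq hq1 hβ in
theorem constantCoeff_rescale_qExpSeries (c : ℂ) :
    PowerSeries.constantCoeff (PowerSeries.rescale c (qExpSeries (q ^ 2))) ≠ 0 := by
  rw [← PowerSeries.coeff_zero_eq_constantCoeff_apply, PowerSeries.coeff_rescale, qExpSeries,
    PowerSeries.coeff_mk, qFactorial_zero]
  simp

omit hm hq hq1 hβ in
theorem monomial_mul_radial_mem_V {k : ℕ} {S : Poly m q} (hS : S ∈ homog m q k) {φ : ℂ⟦X⟧}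
    (hφ : φ ∈ expClass (q ^ 2) ((-(1 / β * q ^ 2 / mu m q) : ℝ) : ℂ)) :
    PowerSeries.monomial k S * radial m q φ ∈ V m q (1 / β) := by
  obtain ⟨P, rfl⟩ := mem_expClass.1 hφ
  refine ⟨PowerSeries.monomial k S * radial m q P,
    monomial_mul_radial_mem_polySeries hS (N := P.natDegree) fun n hn => ?_, ?_⟩
  · rw [Polynomial.coeff_coe, Polynomial.coeff_eq_zero_of_natDegree_lt hn]
  · rw [radial_mul, mul_assoc]

omit hm hq hq1 hβ in
theorem complex_smul_monomial_mul (c : ℂ) (k : ℕ) (S : Poly m q) (F : (Poly m q)⟦X⟧) :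
    c • (PowerSeries.monomial k S * F) = PowerSeries.monomial k (c • S) * F := by
  refine PowerSeries.ext fun n => ?_
  rw [coeff_complex_smul]
  rcases lt_or_ge n k with h | h
  · rw [coeff_monomial_mul_of_lt h, coeff_monomial_mul_of_lt h, smul_zero]
  obtain ⟨n, rfl⟩ := Nat.exists_eq_add_of_le h
  rw [coeff_monomial_mul_add, coeff_monomial_mul_add, smul_mul_assoc]

end bochner
end QEuclid
end
theorem corollary4p7 (m : ℕ) (hm : 1 ≤ m) (q : ℝ) (hq0 : 0 < q) (hq1 : q < 1)
    (β : ℝ) (hβ : 0 < β) (s : ℤˣ) (k : ℕ)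
    (S : QEuclid.Poly m q) (hS : S ∈ QEuclid.sphHarm m q k) (ψ : PowerSeries ℂ)
    (hψ : PowerSeries.monomial k S * QEuclid.radial m q ψ ∈ QEuclid.Vbar m q β) :
    -- the transform lies in the target space of the Fourier transform
    QEuclid.fourier1 m q β s (PowerSeries.monomial k S * QEuclid.radial m q ψ)
        ∈ QEuclid.VClass m q (1 / β) ∧
    -- the Hankel transform of `ψ` is analytic at the origin
    (S ≠ 0 → ∃ φ, QEuclid.IsTaylor
      (QEuclid.hankelF1 m q β ((m : ℝ) / 2 + k - 1) (QEuclid.evalSeries ψ)) φ) ∧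
    -- Bochner's relations
    QEuclid.fourier1 m q β s (PowerSeries.monomial k S * QEuclid.radial m q ψ) =
      (((s : ℤ) : ℂ) * Complex.I) ^ k •
        (PowerSeries.monomial k S * QEuclid.radialFun m q
          (QEuclid.hankelF1 m q β ((m : ℝ) / 2 + k - 1) (QEuclid.evalSeries ψ))) ∧
    -- the explicit formula, with `t² = u` replaced by the norm squared
    QEuclid.fourier1 m q β s (PowerSeries.monomial k S * QEuclid.radial m q ψ) =
      (((s : ℤ) : ℂ) * Complex.I) ^ k •
        (QEuclid.radialFun m q (fun u : ℝ =>
          ((1 + q) / QEuclid.mu m q : ℝ) *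
            QEuclid.jackson q (√(QEuclid.mu m q / ((1 - q ^ 2) * β))) fun r =>
              (r : ℂ) ^ (m + 2 * k - 1) * QEuclid.evalSeries ψ (r ^ 2) *
                ((QEuclid.qBessel1 q ((m : ℝ) / 2 + k - 1) ((1 + q) / QEuclid.mu m q * r * √u) /
                  (r * √u) ^ ((m : ℝ) / 2 + k - 1) : ℝ) : ℂ)) *
          PowerSeries.monomial k S) := by
  have hbase : √(QEuclid.mu m q / ((1 - q ^ 2) * β)) = QEuclid.gridBase m q β := rfl
  have hV : QEuclid.V m q (1 / β) ⊆ QEuclid.VClass m q (1 / β) := fun F hF =>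
    Set.mem_iUnion.2 ⟨0, by simpa using hF⟩
  have hF := QEuclid.fourier1_eq hm hq0 hq1 β s hS ψ
  rw [hbase] at hF ⊢
  -- If S = 0, the hypothesis says nothing about ψ, and the Hankel transform may have no Taylor
  -- series; but every term is then multiplied by zero.
  by_cases hS0 : S = 0
  · subst hS0
    simp only [map_zero, zero_mul, mul_zero, smul_zero] at hF ⊢
    refine ⟨?_, fun h => absurd rfl h, hF, hF⟩
    rw [hF]
    refine hV ⟨0, ⟨fun n => ?_, 0, fun n _ => ?_⟩, by rw [zero_mul]⟩
    · rw [map_zero]; exact zero_mem _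
    · rw [map_zero]
  obtain ⟨P, hP, hψP⟩ := hψ
  obtain ⟨G, hG⟩ := QEuclid.exists_polynomial_mul hm hq0 hq1 hS hS0
    (QEuclid.constantCoeff_rescale_qExpSeries _) hP hψP
  have hT := QEuclid.isTaylor_bochnerSeries hm hq0 hq1 hβ G k
  rw [← hG] at hT
  have hH := QEuclid.hankelF1_eq hm hq0 hq1 hβ k (QEuclid.evalSeries ψ)
  refine ⟨?_, fun _ => ⟨_, hH ▸ hT⟩, ?_, ?_⟩
  · rw [hF, QEuclid.complex_smul_monomial_mul]
    refine hV (QEuclid.monomial_mul_radial_mem_V (Submodule.smul_mem _ _ hS.1) ?_)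
    rw [hG]
    exact QEuclid.bochnerSeries_mem_expClass hm hq0 hq1 hβ G k
  · rw [hF, QEuclid.radialFun, hH, QEuclid.epsilon_isTaylor hT]
  · rw [hF, QEuclid.radialFun, QEuclid.epsilon_isTaylor hT, QEuclid.radial_mul_monomial hm hq0 hq1]
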